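/- **Setting.** Let $\mathfrak H$ be a real separable Hilbert space and $W=\{W(h):h\in\mathfrak H\}$ an isonormal Gaussian process on a probability space $(\Omega,\mathcal F,\mathbb P)$, i.e. a centered Gaussian family with $\mathbb E[W(h_1)W(h_2)]=\langle h_1,h_2\rangle_{\mathfrak H}$. Let $D$ be the Malliavin derivative, i.e. the closure in $L^2(\Omega)\times L^2(\Omega;\mathfrak H)$ of the operator $f(W(h_1),\dots,W(h_n))\mapsto\sum_i\partial_if(W(h_1),\dots,W(h_n))\,h_i$ ($f\in C^\infty$ with all derivatives of polynomial growth), and $\mathbb D^{1,2}$ its domain. Let $L^{-1}F=-\sum_{q\ge1}\frac1qJ_qF$, where $J_q$ is the orthogonal projection of $L^2(\Omega)$ onto the $q$-th Wiener chaos (the closed span of $H_q(W(h))$, $\|h\|=1$, with $H_q$ the $q$-th Hermite polynomial). For $F\in\mathbb D^{1,2}$ put $g_F=\mathbb E[\langle DF,-DL^{-1}F\rangle_{\mathfrak H}\mid F]$. For a class $\mathcal H$ of functions $\mathbb R\to\mathbb R$ put $d_{\mathcal H}(X,Z)=\sup_{h\in\mathcal H}|\mathbb E[h(X)]-\mathbb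 E[h(Z)]|$. Let $d_{\mathcal H}$ be the Wasserstein distance ($\mathcal H=\{h:\|h\|_{\mathrm{Lip}}\le1\}$) or the Fortet–Mourier distance ($\mathcal H=\{h:\|h\|_{\mathrm{Lip}}+\|h\|_\infty\le1\}$). **Assumption A.** $Z\in\mathbb D^{1,2}$ has mean $0$ and a density $\rho_*$ which, for some $-\infty\le l<0<u\le\infty$, is continuous and strictly positive on $(l,u)$ and zero outside $(l,u)$; $X\in\mathbb D^{1,2}$ has mean $0$. Put $$g_*(z)=\frac1{\rho_*(z)}\int_z^u y\rho_*(y)\,dy\quad(z\in(l,u)),\qquad g_*(z)=0\quad(z\notin(l,u)).$$ **Assumption A$'$.** Assumption A holds and, in addition, $g_*$ is bounded or $X$ has a density. **Assumption B.** (1) There is a positive $\tilde g\in C^1(l,u)$ with $0<\liminf g_*/\tilde g\le\limsup g_*/\tilde g<\infty$ both as $x\to u^-$ and as $x\to l^+$, such that the limits $\tilde g'(l^+)$ and $\tilde g'(u^-)$ exist in $[-\infty,\infty]$. (2) If $u=\infty$, then $\liminf_{x\to\infty}g_*(x)>0$. (3) If $l=-\infty$, then $\liminf_{x\to-\infty}g_*(x)>0$.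 **Theorem (NP bound in Wiener space).** Let $Z$ and $g_*$ be as in Assumptions A and B. Then $g_*(Z)=g_Z$ almost surely, and there is a finite constant $k\ge 0$, depending only on $Z$ and on $d_{\mathcal H}$, such that the following holds for every $X$ as in Assumption A. 1. In $[0,\infty]$, $$d_{\mathcal H}(X,Z)\le k\,\mathbb E|g_*(X)-g_X|\le k\,\mathbb E\big[(g_*(X)-g_X)^2\big]^{1/2}.$$ 2. Suppose that $g_*(X)$, $g_X$ and $g_*(Z)$ are square integrable, and put $a=|\mathbb E[g_*(X)^2]-\mathbb E[g_*(Z)^2]|$, $b=|\mathbb E[g_*(X)g_X]-\mathbb E[g_*(Z)g_Z]|$, $c=|\mathbb E[g_X^2]-\mathbb E[g_Z^2]|$. Then $$k\,\mathbb E\big[(g_*(X)-g_X)^2\big]^{1/2}\le k\sqrt{a+2b+c}\qquad\text{and}\qquad d_{\mathcal H}(X,Z)\le k\sqrt{a+b+c}.$$ 3. If, in addition to the square integrability in 2, Assumption A$'$ holds, then for every antiderivative $G_*$ of $g_*$ on $\mathbb R$ the random variables $XG_*(X)$ and $ZG_*(Z)$ are integrable and $$d_{\mathcal H}(X,Z)\le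 k\sqrt{a+\big|\mathbb E[XG_*(X)]-\mathbb E[ZG_*(Z)]\big|+c}.$$ -/

import Mathlib

open MeasureTheory ProbabilityTheory Filter Set Topology
open scoped ENNReal NNReal

noncomputable section

namespace WienerNP

/-! ### Wiener space: isonormal Gaussian processes and Malliavin operators -/

section Malliavin

variable {Ω H : Type*} [MeasurableSpace Ω] [NormedAddCommGroup H] [InnerProductSpace ℝ H]

/-- `W = {W(h) : h ∈ H}` is an isonormal Gaussian process over `H`: a centered Gaussian family with
`E[W(h₁) W(h₂)] = ⟪h₁, h₂⟫`. -/
structure IsIsonormal (P : Measure Ω) (W : H → Ω → ℝ) : Prop where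
  gaussian : IsGaussianProcess W P
  centered : ∀ h, ∫ ω, W h ω ∂P = 0
  covariance : ∀ h₁ h₂, ∫ ω, W h₁ ω * W h₂ ω ∂P = inner ℝ h₁ h₂

/-- The smooth cylindrical random variable `f(W(h₁), …, W(hₙ))`. -/
def cylinder (W : H → Ω → ℝ) {n : ℕ} (h : Fin n → H) (f : (Fin n → ℝ) → ℝ) (ω : Ω) : ℝ :=
  f (fun i => W (h i) ω)

/-- The Malliavin derivative `∑ᵢ ∂ᵢf(W(h₁), …, W(hₙ)) hᵢ` of a smooth cylindrical random
variable. -/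
def cylinderDeriv (W : H → Ω → ℝ) {n : ℕ} (h : Fin n → H) (f : (Fin n → ℝ) → ℝ) (ω : Ω) : H :=
  ∑ i, (fderiv ℝ f (fun j => W (h j) ω) (Pi.single i 1)) • h i

/-- `U` is the Malliavin derivative of `F`: the pair `(F, U)` is in the closure, in
`L²(Ω) × L²(Ω; H)`, of the pairs (smooth cylindrical random variable, its derivative). Here
"smooth" means `C^∞` with all derivatives of polynomial growth. -/
def HasMalliavinDeriv (P : Measure Ω) (W : H → Ω → ℝ) (F : Ω → ℝ) (U : Ω → H) : Prop :=
  MemLp F 2 P ∧ MemLp U 2 P ∧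
    ∀ ε : ℝ≥0∞, 0 < ε → ∃ (n : ℕ) (h : Fin n → H) (f : (Fin n → ℝ) → ℝ),
      f.HasTemperateGrowth ∧
      eLpNorm (fun ω => cylinder W h f ω - F ω) 2 P < ε ∧
      eLpNorm (fun ω => cylinderDeriv W h f ω - U ω) 2 P < ε

/-- The space `𝔻^{1,2}`, the domain of the (closed) Malliavin derivative in `L²(Ω)`. -/
def MemD12 (P : Measure Ω) (W : H → Ω → ℝ) (F : Ω → ℝ) : Prop :=
  ∃ U : Ω → H, HasMalliavinDeriv P W F U

open Classical in
/-- The Malliavin derivative `DF` (defined up to a null set; `0` if `F ∉ 𝔻^{1,2}`). -/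
def malliavinD (P : Measure Ω) (W : H → Ω → ℝ) (F : Ω → ℝ) : Ω → H :=
  if hF : MemD12 P W F then Classical.choose hF else 0

/-- The `q`-th Wiener chaos: the closed linear span in `L²(Ω)` of the random variables
`H_q(W(h))`, `‖h‖ = 1`, where `H_q` is the `q`-th (probabilists') Hermite polynomial. -/
def wienerChaos (P : Measure Ω) (W : H → Ω → ℝ) (q : ℕ) : Submodule ℝ (Lp ℝ 2 P) :=
  (Submodule.span ℝ {F : Lp ℝ 2 P | ∃ h : H, ‖h‖ = 1 ∧
    F =ᵐ[P] fun ω => Polynomial.aeval (W h ω) (Polynomial.hermite q)}).topologicalClosure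

instance wienerChaos.completeSpace (P : Measure Ω) (W : H → Ω → ℝ) (q : ℕ) : CompleteSpace (wienerChaos P W q) :=
  Submodule.topologicalClosure.completeSpace _

open Classical in
/-- The pseudo-inverse `L⁻¹F = - ∑_{q ≥ 1} (1/q) J_q F` of the generator of the Ornstein–Uhlenbeck
semigroup, `J_q` being the orthogonal projection of `L²(Ω)` onto the `q`-th Wiener chaos. -/
def ouInv (P : Measure Ω) (W : H → Ω → ℝ) (F : Ω → ℝ) : Ω → ℝ :=
  if hF : MemLp F 2 P then
    ((-∑' q : ℕ, ((q : ℝ) + 1)⁻¹ • (wienerChaos P W (q + 1)).starProjection (hF.toLp F) :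
      Lp ℝ 2 P) : Ω → ℝ)
  else 0

/-- The random variable `g_F = E[⟨DF, -D L⁻¹ F⟩ | F]`. -/
def gVar (P : Measure Ω) (W : H → Ω → ℝ) (F : Ω → ℝ) : Ω → ℝ :=
  condExp (MeasurableSpace.comap F inferInstance) P
    (fun ω => inner ℝ (malliavinD P W F ω) (-(malliavinD P W (ouInv P W F) ω)))

end Malliavin

/-! ### Objects attached to the target density -/

/-- The set of real points of the open interval `(l, u)`, `-∞ ≤ l`, `u ≤ ∞`. -/
def openInt (l u : EReal) : Set ℝ := {x : ℝ | l < (x : EReal) ∧ (x : EReal) < u}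

/-- The function `g_*(z) = (∫_z^u y ρ(y) dy) / ρ(z)` for `z ∈ (l, u)`, and `0` outside `(l, u)`. -/
def gStar (l u : EReal) (ρ : ℝ → ℝ) : ℝ → ℝ :=
  (openInt l u).indicator (fun z => (∫ y in {y : ℝ | z < y ∧ (y : EReal) < u}, y * ρ y) / ρ z)

/-- Real `x → l` from the right (`x → -∞` if `l = -∞`). -/
def toLeftEnd (l : EReal) : Filter ℝ := comap ((↑) : ℝ → EReal) (𝓝[>] l)

/-- Real `x → u` from the left (`x → ∞` if `u = ∞`). -/
def toRightEnd (u : EReal) : Filter ℝ := comap ((↑) : ℝ → EReal) (𝓝[<] u)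

/-- The conditions on `g = g_*` at the ends of `(l, u)`: `g` is comparable near both ends with a
positive `C¹` function on `(l, u)` whose derivative has limits in `[-∞, ∞]` at both ends, and `g` is
bounded away from `0` near each infinite end. -/
def EndpointConditions (l u : EReal) (g : ℝ → ℝ) : Prop :=
  (∃ gt : ℝ → ℝ, ContDiffOn ℝ 1 gt (openInt l u) ∧ (∀ x ∈ openInt l u, 0 < gt x) ∧
    (0 < liminf (fun x => ((g x / gt x : ℝ) : EReal)) (toRightEnd u) ∧
      limsup (fun x => ((g x / gt x : ℝ) : EReal)) (toRightEnd u) < ⊤) ∧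
    (0 < liminf (fun x => ((g x / gt x : ℝ) : EReal)) (toLeftEnd l) ∧
      limsup (fun x => ((g x / gt x : ℝ) : EReal)) (toLeftEnd l) < ⊤) ∧
    (∃ a : EReal, Tendsto (fun x => ((deriv gt x : ℝ) : EReal)) (toLeftEnd l) (𝓝 a)) ∧
    (∃ b : EReal, Tendsto (fun x => ((deriv gt x : ℝ) : EReal)) (toRightEnd u) (𝓝 b))) ∧
  (u = ⊤ → 0 < liminf (fun x => (g x : EReal)) (toRightEnd u)) ∧
  (l = ⊥ → 0 < liminf (fun x => (g x : EReal)) (toLeftEnd l))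

/-! ### Probability distances -/

/-- Test functions of the Wasserstein distance: `‖h‖_L ≤ 1`. -/
def wassersteinClass : Set (ℝ → ℝ) := {h | LipschitzWith 1 h}

/-- Test functions of the Fortet–Mourier distance: `‖h‖_L + ‖h‖_∞ ≤ 1`. -/
def fortetMourierClass : Set (ℝ → ℝ) :=
  {h | ∃ K M : ℝ≥0, LipschitzWith K h ∧ (∀ x, |h x| ≤ M) ∧ K + M ≤ 1}

/-- `d_𝓗(X, Z) = sup_{h ∈ 𝓗} |E[h(X)] - E[h(Z)]|`. -/
def distH {Ω : Type*} [MeasurableSpace Ω] (𝓗 : Set (ℝ → ℝ)) (P : Measure Ω) (X Z : Ω → ℝ) :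
    ℝ≥0∞ :=
  ⨆ h ∈ 𝓗, ENNReal.ofReal |∫ ω, h (X ω) ∂P - ∫ ω, h (Z ω) ∂P|

end WienerNP

end

/-! The proof is Stein's method for the law of `Z` joined to Malliavin integration by parts for `X`.
For a 1-Lipschitz `h` with `m = ∫ h ρ`, the function `f = steinSol l u ρ h` solves `h - m = g_* f' -
x f` on all of `ℝ`. Inserting `X` and using Stein's identity `E[X f(X)] = E[g_X f'(X)]` gives `E
h(X) - m = E[(g_*(X) - g_X) f'(X)]`. A Lipschitz constant of `f` valid for all `h` therefore yields
the first bound, and the moment bounds follow by expanding the square and using `g_*(Z) = g_Z`.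

Stein's identity rests on Gaussian integration by parts (`integral_mul`). On cylindrical variables
it represents the Dirichlet form by a second-order operator `ouGen`, of which the Hermite variables
of degree `q` are eigenvectors with eigenvalue `q`. Together with the chaos decomposition
(`tsum_chaos_eq`) this gives `E⟨DG, -DL⁻¹X⟩ = E[G X]` for cylindrical `G`, and then `E[X φ(X)] =
E[φ'(X)⟨DX, -DL⁻¹X⟩]` for smooth `φ` with bounded derivative (`integral_mul_comp`).

The step from smooth to Lipschitz functions, with no regularity of the law of `X`, uses the
zero-bias measure `λ`, defined by `E[X (f(X) - f(0))] = ∫ f' dλ`. It is positive and has a Lebesgue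
density by construction, and the law of `X` weighted by `g_X` is exactly `λ` (`mapDensity_gVar`).
This one identity gives `g_X ≥ 0`, Stein's identity for Lipschitz functions, `g_*(Z) = g_Z` (the
zero-bias measure of `Z` has density `g_* ρ`), and `E[X G_*(X)] = E[g_*(X) g_X]` by Tonelli.

For the uniform Lipschitz constant, put `p = g_* ρ` and let `A(x) = ∫_{-∞}^x (x-y)ρ`, `B(x) = ∫_x^∞
(y-x)ρ`. An algebraic identity gives `|f'| ≤ 2AB/(p g_*)` on the support, so what is needed is `AB ≤
K p g_*` (`exists_bound`). Compactness handles the middle, and near the right end one compares `xB`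
with `p g_*` through the differential equations of `p` and `B` (`exists_mul_tail_le`). The left end
is the right end of the law of `-Z`. -/

namespace WienerNP

/-! ### Moments of temperate functions and Gaussian integration by parts. -/

/-- A function with polynomial growth of a random variable with all moments has all moments. -/
theorem memLp_comp_of_poly_growth {Ω E F : Type*} [MeasurableSpace Ω] {P : Measure Ω}
    [IsFiniteMeasure P] [NormedAddCommGroup E] [NormedAddCommGroup F] {Y : Ω → E}
    (hY : ∀ p : ℕ, MemLp Y p P) {f : E → F} (hf : Continuous f) {C : ℝ} {k : ℕ}
    (hC : ∀ x, ‖f x‖ ≤ C * (1 + ‖x‖) ^ k) (q : ℕ) : MemLp (fun ω => f (Y ω)) q P := by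
  have h1 : ∀ p : ℕ, MemLp (fun ω => 1 + ‖Y ω‖) p P := fun p =>
    (memLp_const (1 : ℝ)).add (hY p).norm
  have h2 : ∀ k q : ℕ, MemLp (fun ω => (1 + ‖Y ω‖) ^ k) q P := by
    intro k
    induction k with
    | zero => intro q; simpa using memLp_const (1 : ℝ)
    | succ k ih =>
      intro q
      -- Hölder from `L^{2q} × L^{2q}` to `L^q`; this is why the induction keeps `q` arbitrary.
      have := (ih (2 * q)).mul (h1 (2 * q)) (r := (q : ℝ≥0∞)) (hpqr := ⟨by
        push_cast
        rcases eq_or_ne q 0 with rfl | hq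
        · simp
        · rw [← two_mul, ENNReal.mul_inv (by simp) (by simp), ← mul_assoc,
            ENNReal.mul_inv_cancel (by simp) (by simp), one_mul]⟩)
      refine this.congr_norm (by
        have := (h1 0).aestronglyMeasurable
        exact this.pow _) ?_
      filter_upwards with ω
      simp [pow_succ, mul_comm]
  refine ((h2 k q).const_mul C).mono' (hf.comp_aestronglyMeasurable (hY 0).aestronglyMeasurable) ?_
  filter_upwards with ω using hC _

/-- A temperate function of a random variable with all moments has all moments. -/
theorem memLp_comp_temperate {Ω E F : Type*} [MeasurableSpace Ω] {P : Measure Ω}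
    [IsFiniteMeasure P] [NormedAddCommGroup E] [NormedSpace ℝ E] [NormedAddCommGroup F]
    [NormedSpace ℝ F] {Y : Ω → E} (hY : ∀ p : ℕ, MemLp Y p P) {f : E → F}
    (hf : f.HasTemperateGrowth) (q : ℕ) : MemLp (fun ω => f (Y ω)) q P := by
  obtain ⟨k, C, h⟩ := hf.2 0
  exact memLp_comp_of_poly_growth hY hf.1.continuous (C := C) (k := k) (by simpa using h) q

theorem temperate_fderiv {E F : Type*} [NormedAddCommGroup E] [NormedSpace ℝ E]
    [NormedAddCommGroup F] [NormedSpace ℝ F] {f : E → F} (hf : f.HasTemperateGrowth) :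
    (fderiv ℝ f).HasTemperateGrowth := by
  refine ⟨hf.1.fderiv_right (by simp), fun n => ?_⟩
  obtain ⟨k, C, h⟩ := hf.2 (n + 1)
  refine ⟨k, C, fun x => ?_⟩
  rw [norm_iteratedFDeriv_fderiv]
  exact h x

theorem temperate_fderiv_apply {E F : Type*} [NormedAddCommGroup E] [NormedSpace ℝ E]
    [NormedAddCommGroup F] [NormedSpace ℝ F] {f : E → F} (hf : f.HasTemperateGrowth) (v : E) :
    (fun x => fderiv ℝ f x v).HasTemperateGrowth :=
  (ContinuousLinearMap.apply ℝ F v).hasTemperateGrowth.comp (temperate_fderiv hf)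

theorem temperate_deriv {f : ℝ → ℝ} (hf : f.HasTemperateGrowth) :
    (deriv f).HasTemperateGrowth := by
  have : deriv f = fun x => fderiv ℝ f x 1 := by ext x; simp
  rw [this]; exact temperate_fderiv_apply hf 1

theorem memLp_id_gaussianReal_nat (μ : ℝ) (v : ℝ≥0) (p : ℕ) :
    MemLp (fun x => x) p (gaussianReal μ v) := by
  simpa using! memLp_id_gaussianReal (μ := μ) (v := v) p

/-- Stein's identity for centered real Gaussian measures. -/
theorem integral_id_mul_gaussianReal (v : ℝ≥0) {g : ℝ → ℝ} (hg : g.HasTemperateGrowth) :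
    ∫ x, g x * x ∂(gaussianReal 0 v) = v * ∫ x, deriv g x ∂(gaussianReal 0 v) := by
  rcases eq_or_ne v 0 with rfl | hv
  · simp
  have hv' : (v : ℝ) ≠ 0 := by simpa using hv
  have hint : ∀ {f : ℝ → ℝ}, f.HasTemperateGrowth →
      Integrable (fun x => gaussianPDFReal 0 v x * f x) := by
    intro f hf
    have h1 : Integrable f (gaussianReal 0 v) := by
      have := memLp_comp_temperate (P := gaussianReal 0 v) (Y := fun x => x)
        (memLp_id_gaussianReal_nat 0 v) hf 1
      simpa [memLp_one_iff_integrable] using this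
    rw [gaussianReal_of_var_ne_zero _ hv] at h1
    rw [integrable_withDensity_iff_integrable_smul' (by fun_prop) (by simp [gaussianPDF])] at h1
    refine h1.congr (Eventually.of_forall fun x => ?_)
    simp [gaussianPDF, gaussianPDFReal_nonneg]
  rw [integral_gaussianReal_eq_integral_smul hv, integral_gaussianReal_eq_integral_smul hv]
  -- The density solves `φ' = -(x/v) φ`, which turns the identity into integration by parts on the
  -- line. The degenerate case `v = 0`, which has no density, was removed above.
  have hpdf : ∀ x, HasDerivAt (gaussianPDFReal 0 v) (-(x / v) * gaussianPDFReal 0 v x) x := by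
    intro x
    have h : HasDerivAt (fun x : ℝ => -(x - 0) ^ 2 / (2 * (v : ℝ)))
        (-(2 * x) / (2 * v)) x := by
      have h0 := (((hasDerivAt_id x).sub_const 0).pow 2).neg.div_const (2 * (v : ℝ))
      refine h0.congr_deriv ?_
      simp
    have := h.exp.const_mul ((√(2 * Real.pi * v))⁻¹)
    unfold gaussianPDFReal
    refine this.congr_deriv ?_
    field_simp
  have key := integral_mul_deriv_eq_deriv_mul_of_integrable (u := g) (v := gaussianPDFReal 0 v)
    (u' := deriv g) (v' := fun x => -(x / v) * gaussianPDFReal 0 v x)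
    (fun x _ => (hg.1.differentiable (by simp) x).hasDerivAt) (fun x _ => hpdf x)
    (by
      have := hint (f := fun x => -(x * g x) * (v : ℝ)⁻¹) (by fun_prop)
      refine this.congr (Eventually.of_forall fun x => ?_)
      simp; field_simp)
    (by
      refine (hint (temperate_deriv hg)).congr (Eventually.of_forall fun x => ?_)
      simp [mul_comm])
    (by
      refine (hint hg).congr (Eventually.of_forall fun x => ?_)
      simp [mul_comm])
  have e1 : ∫ x, gaussianPDFReal 0 v x • (g x * x)
      = -v * ∫ x, g x * (-(x / v) * gaussianPDFReal 0 v x) := by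
    rw [← integral_const_mul]
    congr 1; ext x; simp; field_simp
  rw [e1, key]
  simp only [smul_eq_mul, mul_comm (deriv g _)]
  ring

variable {Ω H : Type*} [MeasurableSpace Ω] [NormedAddCommGroup H] [InnerProductSpace ℝ H]
  {P : Measure Ω} {W : H → Ω → ℝ}

namespace IsIsonormal

theorem memLp (hW : IsIsonormal P W) (h : H) {p : ℝ≥0∞} (hp : p ≠ ∞) : MemLp (W h) p P :=
  (hW.gaussian.hasGaussianLaw_eval h).memLp hp

theorem hasGaussianLaw_pi (hW : IsIsonormal P W) {ι : Type*} [Fintype ι] (k : ι → H) :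
    HasGaussianLaw (fun ω i => W (k i) ω) P :=
  ((hW.gaussian.comp_right k).hasGaussianLaw Finset.univ).map
    (ContinuousLinearMap.pi fun i : ι =>
      ContinuousLinearMap.proj (⟨i, Finset.mem_univ i⟩ : (Finset.univ : Finset ι)))

theorem memLp_pi (hW : IsIsonormal P W) {ι : Type*} [Fintype ι] (k : ι → H) (p : ℕ) :
    MemLp (fun ω i => W (k i) ω) p P :=
  (hW.hasGaussianLaw_pi k).memLp (by simp)

theorem integrable_mul (hW : IsIsonormal P W) (h₁ h₂ : H) :
    Integrable (fun ω => W h₁ ω * W h₂ ω) P :=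
  (hW.memLp h₁ (p := 2) (by simp)).integrable_mul (hW.memLp h₂ (p := 2) (by simp))

/-- An isonormal process is almost surely linear. -/
theorem ae_linear (hW : IsIsonormal P W) (a : ℝ) (h m k : H) (hk : k = a • h + m) :
    W k =ᵐ[P] fun ω => W h ω * a + W m ω := by
  -- By the covariance rule the second moment of the difference is `‖k - a • h - m‖² = 0`.
  have h0 : ∫ ω, (W k ω - (W h ω * a + W m ω)) ^ 2 ∂P = 0 := by
    have e : ∀ ω, (W k ω - (W h ω * a + W m ω)) ^ 2 = W k ω * W k ω + a ^ 2 * (W h ω * W h ω)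
      + W m ω * W m ω - 2 * a * (W k ω * W h ω) - 2 * (W k ω * W m ω)
      + 2 * a * (W h ω * W m ω) := fun ω => by ring
    simp_rw [e]
    have i := hW.integrable_mul
    rw [integral_add, integral_sub, integral_sub, integral_add, integral_add]
    · simp only [integral_const_mul, hW.covariance, hk]
      simp only [inner_add_left, inner_add_right, inner_smul_left, inner_smul_right]
      simp [real_inner_comm]
      ring
    all_goals fun_prop
  rw [integral_eq_zero_iff_of_nonneg (fun ω => sq_nonneg _)] at h0
  · filter_upwards [h0] with ω hω
    simpa [sub_eq_zero] using hω
  · have : MemLp (fun ω => W k ω - (W h ω * a + W m ω)) 2 P :=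
      (hW.memLp k (by simp)).sub (((hW.memLp h (by simp)).mul_const a).add (hW.memLp m (by simp)))
    exact this.integrable_sq

theorem map_eq (hW : IsIsonormal P W) (h : H) :
    P.map (W h) = gaussianReal 0 (‖h‖₊ ^ 2) := by
  rw [(hW.gaussian.hasGaussianLaw_eval h).map_eq_gaussianReal, hW.centered]
  congr
  have := hW.gaussian.isProbabilityMeasure
  rw [variance_of_integral_eq_zero ((hW.memLp h (p := 2) (by simp)).aemeasurable) (hW.centered h)]
  simp_rw [sq, hW.covariance, real_inner_self_eq_norm_sq]
  ext; simp [sq, mul_self_nonneg]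

/-- Gaussian integration by parts for an isonormal process. -/
theorem integral_mul (hW : IsIsonormal P W) {ι : Type*} [Fintype ι] (k : ι → H)
    {f : (ι → ℝ) → ℝ} (hf : f.HasTemperateGrowth) (h : H) :
    ∫ ω, f (fun i => W (k i) ω) * W h ω ∂P
      = ∫ ω, fderiv ℝ f (fun i => W (k i) ω) (fun i => inner ℝ (k i) h) ∂P := by
  have := hW.gaussian.isProbabilityMeasure
  -- `a i • h` is the projection of `k i` onto the line of `h`, and `m i` the orthogonal remainder.
  -- For `h = 0` division by zero gives `a = 0`, so `hav` survives.
  set a : ι → ℝ := fun i => inner ℝ (k i) h / ‖h‖ ^ 2 with ha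
  set m : ι → H := fun i => k i - a i • h with hm
  have hav : ∀ i, ‖h‖ ^ 2 * a i = inner ℝ (k i) h := by
    intro i
    rcases eq_or_ne h 0 with rfl | hh
    · simp
    · simp only [ha]; field_simp
  have hmh : ∀ i, inner ℝ h (m i) = 0 := by
    intro i
    simp only [hm, inner_sub_right, inner_smul_right, real_inner_self_eq_norm_sq]
    rw [mul_comm, hav, real_inner_comm, sub_self]
  have hlin : ∀ᵐ ω ∂P, (fun i => W (k i) ω) = W h ω • a + fun i => W (m i) ω := by
    have := fun i => hW.ae_linear (a i) h (m i) (k i) (by simp [hm])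
    filter_upwards [ae_all_iff.2 this] with ω hω
    ext i; simp [hω i]
  -- Jointly Gaussian and uncorrelated, hence independent. By Fubini the variables `W (m i)` can be
  -- frozen, and only the one-dimensional Stein identity in `W h` is left.
  have hind : IndepFun (W h) (fun ω i => W (m i) ω) P := by
    have hp : IsGaussianProcess (Sum.elim (fun _ : Unit => W h) (fun i => W (m i))) P := by
      have := hW.gaussian.comp_right (Sum.elim (fun _ : Unit => h) m)
      refine this.congr ?_
      rintro (_ | i) <;> rfl
    have := hp.indepFun_of_covariance_eq_zero (fun _ => hW.gaussian.aemeasurable _)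
      (fun i => hW.gaussian.aemeasurable _) (fun _ i => by
        rw [covariance_eq_sub (hW.memLp h (by simp)) (hW.memLp (m i) (by simp))]
        simp [hW.centered, hW.covariance, hmh])
    exact this.comp (φ := fun x : Unit → ℝ => x ()) (ψ := id) (by fun_prop) (by fun_prop)
  have hWh := hW.gaussian.aemeasurable h
  have hWm : AEMeasurable (fun ω i => W (m i) ω) P := (hW.hasGaussianLaw_pi m).aemeasurable
  have hmap := (indepFun_iff_map_prod_eq_prod_map_map hWh hWm).1 hind
  rw [hW.map_eq] at hmap
  set ν := P.map (fun ω i => W (m i) ω)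
  have : IsProbabilityMeasure ν := Measure.isProbabilityMeasure_map hWm
  have hY : ∀ p : ℕ, MemLp (fun ω => (W h ω, fun i => W (m i) ω)) p P := fun p =>
    (((hW.memLp h (by simp)).norm.add (hW.memLp_pi m p).norm).mono'
      ((hWh.prodMk hWm).aestronglyMeasurable)) (Eventually.of_forall fun ω => by
        simp only [Prod.norm_def, Pi.add_apply]
        exact max_le (by simp) (by simp))
  have hfub : ∀ {F : ℝ × (ι → ℝ) → ℝ}, F.HasTemperateGrowth →
      ∫ ω, F (W h ω, fun i => W (m i) ω) ∂P
        = ∫ y, ∫ x, F (x, y) ∂(gaussianReal 0 (‖h‖₊ ^ 2)) ∂ν := by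
    intro F hF
    have hc : AEStronglyMeasurable F (P.map fun ω => (W h ω, fun i => W (m i) ω)) :=
      hF.1.continuous.aestronglyMeasurable
    have hi : Integrable F (P.map fun ω => (W h ω, fun i => W (m i) ω)) := by
      rw [integrable_map_measure hc (hWh.prodMk hWm)]
      have := memLp_comp_temperate hY hF 1
      simpa [memLp_one_iff_integrable] using! this
    rw [← integral_map (hWh.prodMk hWm) hc]
    rw [hmap] at hi ⊢
    exact integral_prod_symm _ hi
  have e1 : ∫ ω, f (fun i => W (k i) ω) * W h ω ∂P
      = ∫ ω, (fun z : ℝ × (ι → ℝ) => f (z.1 • a + z.2) * z.1) (W h ω, fun i => W (m i) ω) ∂P := by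
    refine integral_congr_ae ?_
    filter_upwards [hlin] with ω hω
    simp [hω]
  have e2 : ∫ ω, fderiv ℝ f (fun i => W (k i) ω) (fun i => inner ℝ (k i) h) ∂P
      = ∫ ω, (fun z : ℝ × (ι → ℝ) => fderiv ℝ f (z.1 • a + z.2) (fun i => inner ℝ (k i) h))
        (W h ω, fun i => W (m i) ω) ∂P := by
    refine integral_congr_ae ?_
    filter_upwards [hlin] with ω hω
    simp [hω]
  have t0 : (fun z : ℝ × (ι → ℝ) => z.1).HasTemperateGrowth :=
    (ContinuousLinearMap.fst ℝ ℝ (ι → ℝ)).hasTemperateGrowth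
  have t0' : (fun z : ℝ × (ι → ℝ) => z.2).HasTemperateGrowth :=
    (ContinuousLinearMap.snd ℝ ℝ (ι → ℝ)).hasTemperateGrowth
  have t1 : (fun z : ℝ × (ι → ℝ) => z.1 • a + z.2).HasTemperateGrowth :=
    (t0.fun_smul (.const a)).fun_add t0'
  have t3 : (fun z : ℝ × (ι → ℝ) => f (z.1 • a + z.2) * z.1).HasTemperateGrowth :=
    (hf.comp t1).mul t0
  have t4 : (fun z : ℝ × (ι → ℝ) =>
      fderiv ℝ f (z.1 • a + z.2) (fun i => inner ℝ (k i) h)).HasTemperateGrowth :=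
    (temperate_fderiv_apply hf _).comp t1
  rw [e1, e2, hfub t3, hfub t4]
  congr 1; ext y
  have t2 : (fun x : ℝ => x • a + y).HasTemperateGrowth := by fun_prop
  have hd : ∀ x : ℝ, deriv (fun x : ℝ => f (x • a + y)) x = fderiv ℝ f (x • a + y) a := by
    intro x
    have h1 : HasDerivAt (fun x : ℝ => x • a + y) a x := by
      simpa using ((hasDerivAt_id x).smul_const a).add_const y
    exact ((hf.1.differentiable (by simp) _).hasFDerivAt.comp_hasDerivAt x h1).deriv
  have := integral_id_mul_gaussianReal (‖h‖₊ ^ 2) (hf.comp t2)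
  simp only [Function.comp_def, hd] at this
  simp only
  rw [this, ← integral_const_mul]
  congr 1; ext x
  have : (fun i => inner ℝ (k i) h) = (‖h‖ ^ 2) • a := by ext i; simp [hav]
  rw [this, map_smul]; simp

end IsIsonormal

end WienerNP

/-! ### The second-order operator on cylindrical variables and the closed graph of the derivative.
-/

namespace WienerNP

/-- The equation at `n` says that the derivative of `hermite (n + 1)` is `(n + 1) * hermite n`, and
this relation gives the equation at `n + 1`. It is the source of the eigenvalue `q` on the `q`-th
chaos. -/
theorem hermite_ode (q : ℕ) :
    Polynomial.X * (Polynomial.hermite q).derivative - (Polynomial.hermite q).derivative.derivative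
      = (q : Polynomial ℤ) * Polynomial.hermite q := by
  induction q with
  | zero => simp
  | succ n ih =>
    have h1 : (Polynomial.hermite (n + 1)).derivative
        = ((n : Polynomial ℤ) + 1) * Polynomial.hermite n := by
      rw [Polynomial.hermite_succ]
      simp only [Polynomial.derivative_sub, Polynomial.derivative_mul, Polynomial.derivative_X]
      linear_combination ih
    rw [h1, Polynomial.hermite_succ]
    simp only [Polynomial.derivative_mul, Polynomial.derivative_add, Polynomial.derivative_one,
      Polynomial.derivative_natCast]
    push_cast
    ring

theorem temperate_aeval {R : Type*} [CommSemiring R] [Algebra R ℝ] (p : Polynomial R) :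
    (fun x : ℝ => Polynomial.aeval x p).HasTemperateGrowth := by
  induction p using Polynomial.induction_on' with
  | add p q hp hq => simpa using hp.fun_add hq
  | monomial n a =>
    simp only [Polynomial.aeval_monomial]
    fun_prop

section

variable {Ω H : Type*} [MeasurableSpace Ω] [NormedAddCommGroup H] [InnerProductSpace ℝ H]
  {P : Measure Ω} {W : H → Ω → ℝ}

/-- The function `∑ᵢ xᵢ ∂ᵢf - ∑ᵢⱼ ⟪hⱼ, hᵢ⟫ ∂ⱼ∂ᵢf`, which represents the divergence of the Malliavin
derivative of the cylindrical variable `f(W(h₁), …, W(hₙ))`. -/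
noncomputable def ouGen {n : ℕ} (h : Fin n → H) (f : (Fin n → ℝ) → ℝ) (x : Fin n → ℝ) : ℝ :=
  ∑ i, (fderiv ℝ f x (Pi.single i 1) * x i
    - fderiv ℝ (fun y => fderiv ℝ f y (Pi.single i 1)) x (fun j => inner ℝ (h j) (h i)))

theorem temperate_apply {ι : Type*} [Fintype ι] (i : ι) :
    (fun x : ι → ℝ => x i).HasTemperateGrowth :=
  (ContinuousLinearMap.proj (R := ℝ) (φ := fun _ : ι => ℝ) i).hasTemperateGrowth

theorem temperate_ouGen {n : ℕ} (h : Fin n → H) {f : (Fin n → ℝ) → ℝ} (hf : f.HasTemperateGrowth) :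
    (ouGen h f).HasTemperateGrowth := by
  unfold ouGen
  refine Function.HasTemperateGrowth.sum fun i _ => ?_
  have h1 := temperate_fderiv_apply hf (Pi.single i 1)
  exact (h1.fun_mul (temperate_apply i)).fun_sub (temperate_fderiv_apply h1 _)

theorem temperate_grad {n : ℕ} (h : Fin n → H) {f : (Fin n → ℝ) → ℝ}
    (hf : f.HasTemperateGrowth) :
    (fun x => ∑ i, (fderiv ℝ f x (Pi.single i 1)) • h i).HasTemperateGrowth := by
  refine Function.HasTemperateGrowth.sum fun i _ => ?_
  exact (temperate_fderiv_apply hf (Pi.single i 1)).fun_smul (.const (h i))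

namespace IsIsonormal

theorem memLp_cylinder (hW : IsIsonormal P W) {n : ℕ} (h : Fin n → H) {f : (Fin n → ℝ) → ℝ}
    (hf : f.HasTemperateGrowth) : MemLp (cylinder W h f) 2 P :=
  have := hW.gaussian.isProbabilityMeasure
  memLp_comp_temperate (hW.memLp_pi h) hf 2

theorem memLp_cylinderDeriv (hW : IsIsonormal P W) {n : ℕ} (h : Fin n → H) {f : (Fin n → ℝ) → ℝ}
    (hf : f.HasTemperateGrowth) : MemLp (cylinderDeriv W h f) 2 P :=
  have := hW.gaussian.isProbabilityMeasure
  memLp_comp_temperate (hW.memLp_pi h) (temperate_grad h hf) 2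

/-- Integration by parts for a product of two cylindrical variables. -/
theorem integral_mul_mul (hW : IsIsonormal P W) {ι κ : Type*} [Fintype ι] [Fintype κ] (h : ι → H)
    (k : κ → H) {a : (ι → ℝ) → ℝ} {b : (κ → ℝ) → ℝ} (ha : a.HasTemperateGrowth)
    (hb : b.HasTemperateGrowth) (g : H) :
    ∫ ω, a (fun i => W (h i) ω) * fderiv ℝ b (fun j => W (k j) ω) (fun j => inner ℝ (k j) g) ∂P
      = ∫ ω, (a (fun i => W (h i) ω) * W g ω
          - fderiv ℝ a (fun i => W (h i) ω) (fun i => inner ℝ (h i) g))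
        * b (fun j => W (k j) ω) ∂P := by
  have := hW.gaussian.isProbabilityMeasure
  -- Both factors are functions of the concatenated family indexed by `ι ⊕ κ`. Gaussian integration
  -- by parts for their product, expanded by the Leibniz rule, is the claimed duality.
  let L₁ : (ι ⊕ κ → ℝ) →L[ℝ] (ι → ℝ) :=
    ContinuousLinearMap.pi fun i => ContinuousLinearMap.proj (Sum.inl i)
  let L₂ : (ι ⊕ κ → ℝ) →L[ℝ] (κ → ℝ) :=
    ContinuousLinearMap.pi fun i => ContinuousLinearMap.proj (Sum.inr i)
  have h1 : (fun z => a (L₁ z) * b (L₂ z)).HasTemperateGrowth :=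
    (ha.comp L₁.hasTemperateGrowth).mul (hb.comp L₂.hasTemperateGrowth)
  have hd : ∀ z v, fderiv ℝ (fun z => a (L₁ z) * b (L₂ z)) z v
      = a (L₁ z) * fderiv ℝ b (L₂ z) (L₂ v) + fderiv ℝ a (L₁ z) (L₁ v) * b (L₂ z) := by
    intro z v
    have da := (ha.1.differentiable (by simp) (L₁ z)).hasFDerivAt.comp z L₁.hasFDerivAt
    have db := (hb.1.differentiable (by simp) (L₂ z)).hasFDerivAt.comp z L₂.hasFDerivAt
    have := (da.mul db).fderiv
    simp only [Pi.mul_def, Function.comp_def] at this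
    rw [this]
    simp [mul_comm]
  have key := hW.integral_mul (Sum.elim h k) h1 g
  simp only [hd] at key
  have e1 : ∀ ω, L₁ (fun i => W (Sum.elim h k i) ω) = fun i => W (h i) ω := fun ω => rfl
  have e2 : ∀ ω, L₂ (fun i => W (Sum.elim h k i) ω) = fun i => W (k i) ω := fun ω => rfl
  have e3 : L₁ (fun i => inner ℝ (Sum.elim h k i) g) = fun i => inner ℝ (h i) g := rfl
  have e4 : L₂ (fun i => inner ℝ (Sum.elim h k i) g) = fun i => inner ℝ (k i) g := rfl
  simp only [e1, e2, e3, e4] at key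
  have ma : MemLp (fun ω => a (fun i => W (h i) ω)) 4 P :=
    memLp_comp_temperate (hW.memLp_pi h) ha 4
  have mb : MemLp (fun ω => b (fun i => W (k i) ω)) 2 P :=
    memLp_comp_temperate (hW.memLp_pi k) hb 2
  have ma2 : MemLp (fun ω => a (fun i => W (h i) ω)) 2 P :=
    memLp_comp_temperate (hW.memLp_pi h) ha 2
  have md : MemLp (fun ω => fderiv ℝ b (fun j => W (k j) ω) (fun j => inner ℝ (k j) g)) 2 P :=
    memLp_comp_temperate (hW.memLp_pi k) (temperate_fderiv_apply hb _) 2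
  have mda : MemLp (fun ω => fderiv ℝ a (fun j => W (h j) ω) (fun j => inner ℝ (h j) g)) 2 P :=
    memLp_comp_temperate (hW.memLp_pi h) (temperate_fderiv_apply ha _) 2
  have mag : MemLp (fun ω => a (fun i => W (h i) ω) * W g ω) 2 P :=
    (hW.memLp g (p := 4) (by simp)).mul' ma (hpqr := ⟨by
      rw [← two_mul, show (4 : ℝ≥0∞) = 2 * 2 by norm_num, ENNReal.mul_inv (by simp) (by simp),
        ← mul_assoc, ENNReal.mul_inv_cancel (by simp) (by simp), one_mul]⟩)
  have i1 : Integrable (fun ω => a (fun i => W (h i) ω)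
      * fderiv ℝ b (fun j => W (k j) ω) (fun j => inner ℝ (k j) g)) P := ma2.integrable_mul md
  have i2 : Integrable (fun ω => fderiv ℝ a (fun j => W (h j) ω) (fun j => inner ℝ (h j) g)
      * b (fun i => W (k i) ω)) P := mda.integrable_mul mb
  have i3 : Integrable (fun ω => a (fun i => W (h i) ω) * W g ω
      * b (fun i => W (k i) ω)) P := mag.integrable_mul mb
  rw [integral_add i1 i2] at key
  simp only [sub_mul]
  rw [integral_sub i3 i2, eq_sub_iff_add_eq, ← key]
  congr 1; ext ω; ring

theorem fderiv_eq_sum {n : ℕ} (f : (Fin n → ℝ) → ℝ) (x v : Fin n → ℝ) :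
    fderiv ℝ f x v = ∑ j, fderiv ℝ f x (Pi.single j 1) * v j := by
  have : v = ∑ j, v j • (Pi.single j 1 : Fin n → ℝ) := by
    conv_lhs => rw [← Finset.univ_sum_single v]
    refine Finset.sum_congr rfl fun j _ => ?_
    ext i; simp [Pi.single_apply]
  conv_lhs => rw [this]
  simp [mul_comm, map_sum]

/-- The derivative of a cylindrical variable, tested against that of another one. -/
theorem integral_inner_cylinderDeriv (hW : IsIsonormal P W) {n m : ℕ} (h : Fin n → H)
    (k : Fin m → H) {f : (Fin n → ℝ) → ℝ} {e : (Fin m → ℝ) → ℝ} (hf : f.HasTemperateGrowth)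
    (he : e.HasTemperateGrowth) :
    ∫ ω, inner ℝ (cylinderDeriv W h f ω) (cylinderDeriv W k e ω) ∂P
      = ∫ ω, cylinder W h (ouGen h f) ω * cylinder W k e ω ∂P := by
  have := hW.gaussian.isProbabilityMeasure
  have e1 : ∀ ω, inner ℝ (cylinderDeriv W h f ω) (cylinderDeriv W k e ω)
      = ∑ i, fderiv ℝ f (fun j => W (h j) ω) (Pi.single i 1)
        * fderiv ℝ e (fun j => W (k j) ω) (fun j => inner ℝ (k j) (h i)) := by
    intro ω
    simp only [cylinderDeriv, sum_inner, inner_smul_left]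
    refine Finset.sum_congr rfl fun i _ => ?_
    rw [fderiv_eq_sum e]
    simp only [inner_sum, inner_smul_right, real_inner_comm (h i)]
    rfl
  simp only [e1, cylinder, ouGen, Finset.sum_mul]
  have mb : MemLp (fun ω => e (fun i => W (k i) ω)) 2 P :=
    memLp_comp_temperate (hW.memLp_pi k) he 2
  rw [integral_finsetSum, integral_finsetSum]
  · refine Finset.sum_congr rfl fun i _ => ?_
    exact hW.integral_mul_mul h k (temperate_fderiv_apply hf (Pi.single i 1)) he (h i)
  · intro i _
    refine MemLp.integrable_mul (p := 2) (q := 2) ?_ mb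
    have h1 := temperate_fderiv_apply hf (Pi.single i 1)
    exact memLp_comp_temperate (hW.memLp_pi h)
      ((h1.fun_mul (temperate_apply i)).fun_sub (temperate_fderiv_apply h1 _)) 2
  · intro i _
    refine MemLp.integrable_mul (p := 2) (q := 2) ?_ ?_
    · exact memLp_comp_temperate (hW.memLp_pi h) (temperate_fderiv_apply hf (Pi.single i 1)) 2
    · exact memLp_comp_temperate (hW.memLp_pi k) (temperate_fderiv_apply he _) 2

end IsIsonormal

/-- The pairs (smooth cylindrical variable, its Malliavin derivative) in `L²(Ω) × L²(Ω; H)`. -/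
noncomputable def cylGraph (P : Measure Ω) (W : H → Ω → ℝ) : Submodule ℝ (Lp ℝ 2 P × Lp H 2 P) where
  carrier := {p | ∃ (n : ℕ) (h : Fin n → H) (f : (Fin n → ℝ) → ℝ), f.HasTemperateGrowth ∧
    p.1 =ᵐ[P] cylinder W h f ∧ p.2 =ᵐ[P] cylinderDeriv W h f}
  zero_mem' := by
    refine ⟨0, Fin.elim0, 0, .zero, ?_, ?_⟩
    · filter_upwards [Lp.coeFn_zero ℝ 2 P] with ω hω
      simpa [cylinder] using hω
    · filter_upwards [Lp.coeFn_zero H 2 P] with ω hω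
      simpa [cylinderDeriv] using hω
  add_mem' := by
    rintro ⟨a, a'⟩ ⟨b, b'⟩ ⟨n, h, f, hf, h1, h2⟩ ⟨m, k, e, he, h3, h4⟩
    -- A sum of two cylindrical variables is cylindrical over the appended family; `L₁` and `L₂`
    -- select the two blocks of coordinates.
    let L₁ : (Fin (n + m) → ℝ) →L[ℝ] (Fin n → ℝ) :=
      ContinuousLinearMap.pi fun i => ContinuousLinearMap.proj (Fin.castAdd m i)
    let L₂ : (Fin (n + m) → ℝ) →L[ℝ] (Fin m → ℝ) :=
      ContinuousLinearMap.pi fun i => ContinuousLinearMap.proj (Fin.natAdd n i)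
    have e1 : ∀ ω, L₁ (fun i => W (Fin.append h k i) ω) = fun i => W (h i) ω := by
      intro ω; ext i; simp [L₁]
    have e2 : ∀ ω, L₂ (fun i => W (Fin.append h k i) ω) = fun i => W (k i) ω := by
      intro ω; ext i; simp [L₂]
    refine ⟨n + m, Fin.append h k, fun x => f (L₁ x) + e (L₂ x),
      (hf.comp L₁.hasTemperateGrowth).add (he.comp L₂.hasTemperateGrowth), ?_, ?_⟩
    · filter_upwards [Lp.coeFn_add a b, h1, h3] with ω hω h1 h3
      simp only [Prod.mk_add_mk] at *
      rw [hω, Pi.add_apply, h1, h3]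
      simp [cylinder, e1, e2]
    · filter_upwards [Lp.coeFn_add a' b', h2, h4] with ω hω h1 h3
      simp only [Prod.mk_add_mk] at *
      rw [hω, Pi.add_apply, h1, h3]
      have hd : ∀ z v, fderiv ℝ (fun x => f (L₁ x) + e (L₂ x)) z v
          = fderiv ℝ f (L₁ z) (L₁ v) + fderiv ℝ e (L₂ z) (L₂ v) := by
        intro z v
        have da := (hf.1.differentiable (by simp) (L₁ z)).hasFDerivAt.comp z L₁.hasFDerivAt
        have db := (he.1.differentiable (by simp) (L₂ z)).hasFDerivAt.comp z L₂.hasFDerivAt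
        have := (da.add db).fderiv
        simp only [Pi.add_def, Function.comp_def] at this
        rw [this]
        simp
      have s1 : ∀ i, L₁ (Pi.single (Fin.castAdd m i) 1) = Pi.single i 1 := by
        intro i; ext j; simp [L₁, Pi.single_apply]
      have s2 : ∀ i, L₁ (Pi.single (Fin.natAdd n i) 1) = 0 := by
        intro i; ext j; simp [L₁, Pi.single_apply, Fin.ext_iff]; omega
      have s3 : ∀ i, L₂ (Pi.single (Fin.castAdd m i) 1) = 0 := by
        intro i; ext j; simp [L₂, Pi.single_apply, Fin.ext_iff]; omega
      have s4 : ∀ i, L₂ (Pi.single (Fin.natAdd n i) 1) = Pi.single i 1 := by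
        intro i; ext j; simp [L₂, Pi.single_apply]
      simp [cylinderDeriv, hd, Fin.sum_univ_add, s1, s2, s3, s4, e1, e2]
  smul_mem' := by
    rintro c ⟨a, a'⟩ ⟨n, h, f, hf, h1, h2⟩
    refine ⟨n, h, fun x => c * f x, (Function.HasTemperateGrowth.const c).mul hf, ?_, ?_⟩
    · filter_upwards [Lp.coeFn_smul c a, h1] with ω hω h1
      simp only [Prod.smul_mk] at *
      rw [hω, Pi.smul_apply, h1]
      simp [cylinder]
    · filter_upwards [Lp.coeFn_smul c a', h2] with ω hω h1
      simp only [Prod.smul_mk] at *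
      rw [hω, Pi.smul_apply, h1]
      simp only [cylinderDeriv, Finset.smul_sum, smul_smul]
      refine Finset.sum_congr rfl fun i _ => ?_
      rw [fderiv_const_mul (hf.1.differentiable (by simp) _)]
      simp

/-- The closed graph of the Malliavin derivative. -/
noncomputable def derivGraph (P : Measure Ω) (W : H → Ω → ℝ) : Submodule ℝ (Lp ℝ 2 P × Lp H 2 P) :=
  (cylGraph P W).topologicalClosure

theorem edist_toLp_eq {E : Type*} [NormedAddCommGroup E] {f g : Ω → E} (hf : MemLp f 2 P)
    (hg : MemLp g 2 P) : edist (hg.toLp g) (hf.toLp f) = eLpNorm (fun ω => f ω - g ω) 2 P := by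
  rw [edist_comm, Lp.edist_toLp_toLp]; rfl

/-- The approximation condition is membership in a closure for the maximum distance on the product.
Statements on derivatives can thus be proved for cylindrical variables and extended by closedness in
`Lp`. -/
theorem hasMalliavinDeriv_iff (hW : IsIsonormal P W) {F : Ω → ℝ} {U : Ω → H} (hF : MemLp F 2 P)
    (hU : MemLp U 2 P) :
    HasMalliavinDeriv P W F U ↔ (hF.toLp F, hU.toLp U) ∈ derivGraph P W := by
  rw [← SetLike.mem_coe, derivGraph, Submodule.topologicalClosure_coe, EMetric.mem_closure_iff]
  constructor
  · rintro ⟨-, -, h⟩ ε hε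
    obtain ⟨n, k, f, hf, h1, h2⟩ := h ε hε
    refine ⟨((hW.memLp_cylinder k hf).toLp (cylinder W k f),
        (hW.memLp_cylinderDeriv k hf).toLp (cylinderDeriv W k f)),
      ⟨n, k, f, hf, (hW.memLp_cylinder k hf).coeFn_toLp,
        (hW.memLp_cylinderDeriv k hf).coeFn_toLp⟩, ?_⟩
    rw [Prod.edist_eq]
    simp only [edist_toLp_eq]
    exact max_lt h1 h2
  · intro h
    refine ⟨hF, hU, fun ε hε => ?_⟩
    obtain ⟨⟨a, b⟩, ⟨n, k, f, hf, h1, h2⟩, h3⟩ := h ε hε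
    refine ⟨n, k, f, hf, ?_⟩
    have ea : a = (hW.memLp_cylinder k hf).toLp _ := by
      ext1; exact h1.trans (MemLp.coeFn_toLp _).symm
    have eb : b = (hW.memLp_cylinderDeriv k hf).toLp _ := by
      ext1; exact h2.trans (MemLp.coeFn_toLp _).symm
    rw [Prod.edist_eq] at h3
    simp only [ea, eb, edist_toLp_eq] at h3
    exact max_lt_iff.1 h3

end

end WienerNP

/-! ### Wiener chaoses as orthogonal eigenspaces, and differentiability of `L⁻¹F`. -/

namespace WienerNP

section

theorem inner_toLp_eq {Ω E : Type*} [MeasurableSpace Ω] {P : Measure Ω} [NormedAddCommGroup E]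
    [InnerProductSpace ℝ E] {f g : Ω → E} (hf : MemLp f 2 P) (hg : MemLp g 2 P) :
    inner ℝ (hf.toLp f) (hg.toLp g) = ∫ ω, inner ℝ (f ω) (g ω) ∂P := by
  rw [L2.inner_def]
  refine integral_congr_ae ?_
  filter_upwards [hf.coeFn_toLp, hg.coeFn_toLp] with ω h1 h2
  rw [h1, h2]

/-- A square-summable orthogonal sequence in a Hilbert space is summable. -/
theorem summable_of_orthogonal {E : Type*} [NormedAddCommGroup E] [InnerProductSpace ℝ E]
    [CompleteSpace E] {u : ℕ → E} (ho : ∀ i j, i ≠ j → inner ℝ (u i) (u j) = 0)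
    (hs : Summable fun i => ‖u i‖ ^ 2) : Summable u := by
  have h := OrthogonalFamily.of_pairwise (𝕜 := ℝ) (V := fun i => Submodule.span ℝ {u i})
    (fun i j hij => by
      rw [Function.onFun, Submodule.isOrtho_span]
      rintro x rfl y rfl
      exact ho i j hij)
  have := (h.summable_iff_norm_sq_summable
    (fun i => (⟨u i, Submodule.mem_span_singleton_self _⟩ : Submodule.span ℝ {u i}))).2
    (by simpa using hs)
  simpa using this

/-- Bessel's inequality for orthogonal projections onto pairwise orthogonal subspaces. -/
theorem summable_norm_sq_starProjection {E : Type*} [NormedAddCommGroup E] [InnerProductSpace ℝ E]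
    (K : ℕ → Submodule ℝ E) [∀ i, (K i).HasOrthogonalProjection]
    (ho : ∀ i j, i ≠ j → ∀ x ∈ K i, ∀ y ∈ K j, inner ℝ x y = 0) (F : E) :
    Summable fun i => ‖(K i).starProjection F‖ ^ 2 := by
  refine summable_of_sum_le (c := ‖F‖ ^ 2) (fun i => sq_nonneg _) fun s => ?_
  set S := ∑ i ∈ s, (K i).starProjection F with hS
  have h1 : inner ℝ F S = ∑ i ∈ s, ‖(K i).starProjection F‖ ^ 2 := by
    rw [hS, inner_sum]
    refine Finset.sum_congr rfl fun i _ => ?_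
    have := (K i).starProjection_inner_eq_zero F ((K i).starProjection F)
      ((K i).starProjection_apply_mem F)
    rw [inner_sub_left, sub_eq_zero] at this
    rw [this, real_inner_self_eq_norm_sq]
  have h2 : ‖S‖ ^ 2 = ∑ i ∈ s, ‖(K i).starProjection F‖ ^ 2 := by
    rw [← real_inner_self_eq_norm_sq, hS, sum_inner]
    refine Finset.sum_congr rfl fun i hi => ?_
    rw [inner_sum, Finset.sum_eq_single i, real_inner_self_eq_norm_sq]
    · intro j _ hji
      exact ho i j hji.symm _ ((K i).starProjection_apply_mem F) _
        ((K j).starProjection_apply_mem F)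
    · exact fun h => absurd hi h
  -- Now `⟨F, S⟩ = ‖S‖²`, so Cauchy–Schwarz gives `‖S‖ ≤ ‖F‖`.
  rw [← h2] at h1 ⊢
  have h3 := real_inner_le_norm F S
  have := norm_nonneg S
  have := norm_nonneg F
  nlinarith

variable {Ω H : Type*} [MeasurableSpace Ω] [NormedAddCommGroup H] [InnerProductSpace ℝ H]
  {P : Measure Ω} {W : H → Ω → ℝ}

namespace IsIsonormal

/-- A cylindrical variable as an element of `L²`. -/
noncomputable def cylLp (hW : IsIsonormal P W) {n : ℕ} (h : Fin n → H) {f : (Fin n → ℝ) → ℝ}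
    (hf : f.HasTemperateGrowth) : Lp ℝ 2 P :=
  (hW.memLp_cylinder h hf).toLp (cylinder W h f)

/-- The derivative of a cylindrical variable as an element of `L²`. -/
noncomputable def cylDLp (hW : IsIsonormal P W) {n : ℕ} (h : Fin n → H) {f : (Fin n → ℝ) → ℝ}
    (hf : f.HasTemperateGrowth) : Lp H 2 P :=
  (hW.memLp_cylinderDeriv h hf).toLp (cylinderDeriv W h f)

theorem mem_cylGraph_iff (hW : IsIsonormal P W) {p : Lp ℝ 2 P × Lp H 2 P} :
    p ∈ cylGraph P W ↔ ∃ (n : ℕ) (h : Fin n → H) (f : (Fin n → ℝ) → ℝ)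
      (hf : f.HasTemperateGrowth), p = (hW.cylLp h hf, hW.cylDLp h hf) := by
  constructor
  · rintro ⟨n, h, f, hf, h1, h2⟩
    refine ⟨n, h, f, hf, Prod.ext ?_ ?_⟩
    · ext1; exact h1.trans (hW.memLp_cylinder h hf).coeFn_toLp.symm
    · ext1; exact h2.trans (hW.memLp_cylinderDeriv h hf).coeFn_toLp.symm
  · rintro ⟨n, h, f, hf, rfl⟩
    exact ⟨n, h, f, hf, (hW.memLp_cylinder h hf).coeFn_toLp,
      (hW.memLp_cylinderDeriv h hf).coeFn_toLp⟩

/-- Both sides are continuous in `p`, so the formula for cylindrical pairs passes to the closure. It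
holds for every pair in the closed graph, so no uniqueness of the derivative is ever needed. -/
theorem inner_cylDLp (hW : IsIsonormal P W) {n : ℕ} (h : Fin n → H) {f : (Fin n → ℝ) → ℝ}
    (hf : f.HasTemperateGrowth) {p : Lp ℝ 2 P × Lp H 2 P} (hp : p ∈ derivGraph P W) :
    inner ℝ (hW.cylDLp h hf) p.2 = inner ℝ (hW.cylLp h (temperate_ouGen h hf)) p.1 := by
  have hc : IsClosed {p : Lp ℝ 2 P × Lp H 2 P |
      inner ℝ (hW.cylDLp h hf) p.2 = inner ℝ (hW.cylLp h (temperate_ouGen h hf)) p.1} :=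
    isClosed_eq (by fun_prop) (by fun_prop)
  refine closure_minimal ?_ hc hp
  intro q hq
  obtain ⟨m, k, e, he, rfl⟩ := hW.mem_cylGraph_iff.1 hq
  simp only [mem_ofPred_eq, cylLp, cylDLp]
  rw [inner_toLp_eq, inner_toLp_eq, hW.integral_inner_cylinderDeriv h k hf he]
  simp [mul_comm]

/-- With one coordinate and `‖h‖ = 1` the operator is `x f' - f''`, and `hermite_ode` applies. -/
theorem ouGen_hermite (q : ℕ) (h : H) (hh : ‖h‖ = 1) (x : Fin 1 → ℝ) :
    ouGen (fun _ : Fin 1 => h) (fun x => Polynomial.aeval (x 0) (Polynomial.hermite q)) x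
      = q * Polynomial.aeval (x 0) (Polynomial.hermite q) := by
  have hd : ∀ (p : Polynomial ℤ) (x v : Fin 1 → ℝ),
      fderiv ℝ (fun x : Fin 1 → ℝ => Polynomial.aeval (x 0) p) x v
        = Polynomial.aeval (x 0) p.derivative * v 0 := by
    intro p x v
    have h1 : HasFDerivAt (fun x : Fin 1 → ℝ => x 0)
      (ContinuousLinearMap.proj (R := ℝ) (φ := fun _ : Fin 1 => ℝ) 0) x := hasFDerivAt_apply 0 x
    have := ((p.hasDerivAt_aeval (x 0)).comp_hasFDerivAt x h1).fderiv
    simp only [Function.comp_def] at this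
    rw [this]; simp
  simp only [ouGen, hd]
  simp only [Fin.sum_univ_one, Pi.single_eq_same, mul_one, hd, real_inner_self_eq_norm_sq, hh]
  have := congrArg (Polynomial.aeval (x 0)) (hermite_ode q)
  simp only [map_sub, map_mul, Polynomial.aeval_X, map_natCast] at this
  rw [← this]; ring

/-- The generators of the `q`-th chaos are cylindrical and eigenvectors of the generator. -/
theorem exists_cylLp_of_hermite (hW : IsIsonormal P W) (q : ℕ) {v : Lp ℝ 2 P} {h : H}
    (hh : ‖h‖ = 1) (hv : v =ᵐ[P] fun ω => Polynomial.aeval (W h ω) (Polynomial.hermite q)) :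
    ∃ (n : ℕ) (h : Fin n → H) (f : (Fin n → ℝ) → ℝ) (hf : f.HasTemperateGrowth),
      v = hW.cylLp h hf ∧ hW.cylLp h (temperate_ouGen h hf) = (q : ℝ) • v := by
  refine ⟨1, fun _ => h, fun x => Polynomial.aeval (x 0) (Polynomial.hermite q),
    (temperate_aeval _).comp (temperate_apply 0), ?_, ?_⟩
  · ext1; exact hv.trans (MemLp.coeFn_toLp _).symm
  · ext1
    refine (MemLp.coeFn_toLp _).trans ?_
    filter_upwards [Lp.coeFn_smul (q : ℝ) v, hv] with ω h1 h2
    rw [h1, Pi.smul_apply, h2, cylinder, ouGen_hermite q h hh]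
    simp

/-- The generator acts on the `q`-th chaos as multiplication by `q`. -/
theorem inner_cylLp_ouGen (hW : IsIsonormal P W) {n : ℕ} (h : Fin n → H) {f : (Fin n → ℝ) → ℝ}
    (hf : f.HasTemperateGrowth) {q : ℕ} {V : Lp ℝ 2 P} (hV : V ∈ wienerChaos P W q) :
    inner ℝ (hW.cylLp h (temperate_ouGen h hf)) V = q * inner ℝ (hW.cylLp h hf) V := by
  have hc : IsClosed {V : Lp ℝ 2 P |
      inner ℝ (hW.cylLp h (temperate_ouGen h hf)) V = q * inner ℝ (hW.cylLp h hf) V} :=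
    isClosed_eq (by fun_prop) (by fun_prop)
  refine closure_minimal ?_ hc hV
  intro V hV
  simp only [SetLike.mem_coe] at hV
  simp only [mem_ofPred_eq]
  induction hV using Submodule.span_induction with
  | zero => simp
  | add x y _ _ hx hy => rw [inner_add_right, inner_add_right, hx, hy]; ring
  | smul c x _ hx => rw [inner_smul_right, inner_smul_right, hx]; ring
  | mem v hv =>
    obtain ⟨g, hg, hv⟩ := hv
    obtain ⟨m, k, e, he, rfl, h2⟩ := hW.exists_cylLp_of_hermite q hg hv
    have m1 : (hW.cylLp k he, hW.cylDLp k he) ∈ derivGraph P W :=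
      Submodule.le_topologicalClosure _ (hW.mem_cylGraph_iff.2 ⟨m, k, e, he, rfl⟩)
    have m2 : (hW.cylLp h hf, hW.cylDLp h hf) ∈ derivGraph P W :=
      Submodule.le_topologicalClosure _ (hW.mem_cylGraph_iff.2 ⟨n, h, f, hf, rfl⟩)
    -- Symmetry through the Dirichlet form: `⟨ouGen f, v⟩ = ⟨Df, Dv⟩ = ⟨f, ouGen e⟩ = q ⟨f, v⟩` for
    -- a Hermite generator `v`.
    have e1 := hW.inner_cylDLp h hf m1
    have e2 := hW.inner_cylDLp k he m2
    rw [h2, inner_smul_left, real_inner_comm] at e2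
    rw [← e1, e2, real_inner_comm]
    simp

/-- Eigenvectors of a symmetric operator with distinct eigenvalues `p` and `q` are orthogonal. -/
theorem inner_wienerChaos (hW : IsIsonormal P W) {p q : ℕ} (hpq : p ≠ q) {V V' : Lp ℝ 2 P}
    (hV : V ∈ wienerChaos P W p) (hV' : V' ∈ wienerChaos P W q) : inner ℝ V V' = 0 := by
  have hc : IsClosed {V : Lp ℝ 2 P | inner ℝ V V' = 0} := isClosed_eq (by fun_prop) (by fun_prop)
  refine closure_minimal ?_ hc hV
  intro V hV
  simp only [SetLike.mem_coe] at hV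
  simp only [mem_ofPred_eq]
  induction hV using Submodule.span_induction with
  | zero => simp
  | add x y _ _ hx hy => rw [inner_add_left, hx, hy]; ring
  | smul c x _ hx => rw [inner_smul_left, hx]; simp
  | mem v hv =>
    obtain ⟨g, hg, hv⟩ := hv
    obtain ⟨m, k, e, he, rfl, h2⟩ := hW.exists_cylLp_of_hermite p hg hv
    have := hW.inner_cylLp_ouGen k he hV'
    rw [h2, inner_smul_left] at this
    have h3 : ((p : ℝ) - q) * inner ℝ (hW.cylLp k he) V' = 0 := by
      simp only [conj_trivial] at this
      linear_combination this
    exact (mul_eq_zero.1 h3).resolve_left (sub_ne_zero.2 (by exact_mod_cast hpq))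

/-- Elements of the `q`-th chaos are orthogonal to the constants, `q ≥ 1`. -/
theorem inner_const_wienerChaos (hW : IsIsonormal P W) [IsProbabilityMeasure P] {q : ℕ}
    (hq : q ≠ 0) {V : Lp ℝ 2 P} (hV : V ∈ wienerChaos P W q) : ∫ ω, V ω ∂P = 0 := by
  have := hW.inner_cylLp_ouGen (Fin.elim0 : Fin 0 → H) (.const 1) hV
  -- The constant `1` is a cylindrical variable over the empty family and the operator annihilates
  -- it, whence `0 = q * E[V]`.
  have h0 : hW.cylLp (Fin.elim0 : Fin 0 → H) (temperate_ouGen (Fin.elim0 : Fin 0 → H) (.const 1)) = 0 := by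
    ext1
    refine (MemLp.coeFn_toLp _).trans ?_
    filter_upwards [Lp.coeFn_zero ℝ 2 P] with ω h1
    rw [h1]; simp [cylinder, ouGen]
  rw [h0, inner_zero_left] at this
  have h1 := (mul_eq_zero.1 this.symm).resolve_left (by exact_mod_cast hq)
  rw [L2.inner_def] at h1
  rw [← h1]
  refine integral_congr_ae ?_
  have := MemLp.coeFn_toLp (hW.memLp_cylinder (Fin.elim0 : Fin 0 → H) (.const 1))
  filter_upwards [this] with ω h2
  simp only [cylLp, h2]
  simp [cylinder]

theorem exists_deriv_of_mem_span (hW : IsIsonormal P W) {q : ℕ} {V : Lp ℝ 2 P}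
    (hV : V ∈ Submodule.span ℝ {F : Lp ℝ 2 P | ∃ h : H, ‖h‖ = 1 ∧
      F =ᵐ[P] fun ω => Polynomial.aeval (W h ω) (Polynomial.hermite q)}) :
    ∃ U, (V, U) ∈ cylGraph P W := by
  induction hV using Submodule.span_induction with
  | zero => exact ⟨0, Submodule.zero_mem _⟩
  | add x y _ _ hx hy =>
    obtain ⟨U, hU⟩ := hx
    obtain ⟨U', hU'⟩ := hy
    exact ⟨U + U', Submodule.add_mem _ hU hU'⟩
  | smul c x _ hx =>
    obtain ⟨U, hU⟩ := hx
    exact ⟨c • U, Submodule.smul_mem _ c hU⟩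
  | mem v hv =>
    obtain ⟨g, hg, hv⟩ := hv
    obtain ⟨m, k, e, he, rfl, h2⟩ := hW.exists_cylLp_of_hermite q hg hv
    exact ⟨_, hW.mem_cylGraph_iff.2 ⟨m, k, e, he, rfl⟩⟩

/-- The Dirichlet form of an element of the `q`-th chaos and an arbitrary differentiable
variable. -/
theorem inner_deriv_wienerChaos (hW : IsIsonormal P W) {q : ℕ} {V : Lp ℝ 2 P} {U : Lp H 2 P}
    (hV : V ∈ wienerChaos P W q) (hU : (V, U) ∈ derivGraph P W) {p : Lp ℝ 2 P × Lp H 2 P}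
    (hp : p ∈ derivGraph P W) : inner ℝ p.2 U = q * inner ℝ p.1 V := by
  have hc : IsClosed {p : Lp ℝ 2 P × Lp H 2 P | inner ℝ p.2 U = q * inner ℝ p.1 V} :=
    isClosed_eq (by fun_prop) (by fun_prop)
  refine closure_minimal ?_ hc hp
  intro r hr
  obtain ⟨n, h, f, hf, rfl⟩ := hW.mem_cylGraph_iff.1 hr
  simp only [mem_ofPred_eq]
  rw [hW.inner_cylDLp h hf hU, hW.inner_cylLp_ouGen h hf hV]

/-- Chaos elements are differentiable. -/
theorem exists_deriv_wienerChaos [CompleteSpace H] (hW : IsIsonormal P W) {q : ℕ} {V : Lp ℝ 2 P}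
    (hV : V ∈ wienerChaos P W q) : ∃ U, (V, U) ∈ derivGraph P W := by
  obtain ⟨v, hv, hvV⟩ := mem_closure_iff_seq_limit.1 hV
  choose u hu using fun n => hW.exists_deriv_of_mem_span (hv n)
  have hu' : ∀ n, (v n, u n) ∈ derivGraph P W := fun n => Submodule.le_topologicalClosure _ (hu n)
  have hvc : ∀ n, v n ∈ wienerChaos P W q := fun n => Submodule.le_topologicalClosure _ (hv n)
  -- On the `q`-th chaos the Dirichlet form is `q` times the inner product. The derivative is
  -- therefore `√q` times an isometry and keeps Cauchy sequences Cauchy.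
  have hd : ∀ n m, ‖u n - u m‖ = √q * ‖v n - v m‖ := by
    intro n m
    have h1 := hW.inner_deriv_wienerChaos (Submodule.sub_mem _ (hvc n) (hvc m))
      (Submodule.sub_mem _ (hu' n) (hu' m)) (Submodule.sub_mem _ (hu' n) (hu' m))
    simp only [Prod.mk_sub_mk] at h1
    rw [real_inner_self_eq_norm_sq, real_inner_self_eq_norm_sq] at h1
    rw [← Real.sqrt_sq (norm_nonneg (u n - u m)), h1, Real.sqrt_mul (by positivity),
      Real.sqrt_sq (norm_nonneg _)]
  have hcau : CauchySeq u := by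
    have h1 := hvV.cauchySeq
    rw [Metric.cauchySeq_iff] at h1 ⊢
    intro ε hε
    obtain ⟨N, hN⟩ := h1 (ε / (√q + 1)) (by positivity)
    refine ⟨N, fun m hm n hn => ?_⟩
    have := hN m hm n hn
    rw [dist_eq_norm] at this ⊢
    rw [hd]
    rw [lt_div_iff₀ (by positivity)] at this
    nlinarith [norm_nonneg (v m - v n), Real.sqrt_nonneg q]
  obtain ⟨U, hU⟩ := cauchySeq_tendsto_of_complete hcau
  refine ⟨U, ?_⟩
  exact (Submodule.isClosed_topologicalClosure _).mem_of_tendsto (hvV.prodMk_nhds hU)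
    (Eventually.of_forall hu')

theorem summable_norm_sq_chaos (hW : IsIsonormal P W) (F : Lp ℝ 2 P) :
    Summable fun q : ℕ => ‖(wienerChaos P W (q + 1)).starProjection F‖ ^ 2 :=
  summable_norm_sq_starProjection (fun q => wienerChaos P W (q + 1))
    (fun i j hij x hx y hy => hW.inner_wienerChaos (by simpa using hij) hx hy) F

theorem summable_chaos (hW : IsIsonormal P W) (F : Lp ℝ 2 P) :
    Summable fun q : ℕ => (wienerChaos P W (q + 1)).starProjection F :=
  summable_of_orthogonal (fun i j hij => hW.inner_wienerChaos (p := i + 1) (q := j + 1)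
    (by simpa using hij) (Submodule.starProjection_apply_mem _ F)
    (Submodule.starProjection_apply_mem _ F)) (hW.summable_norm_sq_chaos F)

theorem inv_mul_le_self_of_one_le {c x : ℝ} (hc : 1 ≤ c) (hx : 0 ≤ x) : c⁻¹ * x ≤ x :=
  mul_le_of_le_one_left hx (inv_le_one_of_one_le₀ hc)

theorem summable_ouInv (hW : IsIsonormal P W) (F : Lp ℝ 2 P) :
    Summable fun q : ℕ => ((q : ℝ) + 1)⁻¹ • (wienerChaos P W (q + 1)).starProjection F := by
  refine summable_of_orthogonal (fun i j hij => ?_) ?_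
  · rw [inner_smul_left, inner_smul_right, hW.inner_wienerChaos (p := i + 1) (q := j + 1)
      (by simpa using hij) (Submodule.starProjection_apply_mem _ F)
      (Submodule.starProjection_apply_mem _ F)]
    simp
  · refine Summable.of_nonneg_of_le (fun i => by positivity) (fun i => ?_)
      (hW.summable_norm_sq_chaos F)
    rw [norm_smul]
    gcongr
    rw [Real.norm_of_nonneg (by positivity)]
    exact inv_mul_le_self_of_one_le (by simp) (norm_nonneg _)

/-- `L⁻¹` maps `L²` to the domain of the Malliavin derivative. -/
theorem exists_deriv_ouInv [CompleteSpace H] (hW : IsIsonormal P W) (F : Lp ℝ 2 P) :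
    ∃ U, (∑' q : ℕ, ((q : ℝ) + 1)⁻¹ • (wienerChaos P W (q + 1)).starProjection F, U)
      ∈ derivGraph P W := by
  have hJ : ∀ q : ℕ, (wienerChaos P W (q + 1)).starProjection F ∈ wienerChaos P W (q + 1) :=
    fun q => Submodule.starProjection_apply_mem _ F
  set J : ℕ → Lp ℝ 2 P := fun q => (wienerChaos P W (q + 1)).starProjection F with hJdef
  choose u hu using fun q => hW.exists_deriv_wienerChaos (hJ q)
  -- The `u q` inherit orthogonality from the chaoses, and `‖u q‖² = (q + 1) ‖J q‖²` because index
  -- `q` stands for chaos `q + 1`. After the weight `(q + 1)⁻¹`, squared, a summable `(q + 1)⁻¹ ‖J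
  -- q‖²` remains.
  have hin : ∀ i j, inner ℝ (u i) (u j) = ((j : ℝ) + 1) * inner ℝ (J i) (J j) := fun i j => by
    have := hW.inner_deriv_wienerChaos (hJ j) (hu j) (hu i)
    push_cast at this
    exact this
  have hs : Summable fun q : ℕ => ((q : ℝ) + 1)⁻¹ • u q := by
    refine summable_of_orthogonal (fun i j hij => ?_) ?_
    · rw [inner_smul_left, inner_smul_right, hin, hW.inner_wienerChaos (p := i + 1) (q := j + 1)
        (by simpa using hij) (hJ i) (hJ j)]
      simp
    · refine Summable.of_nonneg_of_le (fun i => by positivity) (fun i => ?_)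
        (hW.summable_norm_sq_chaos F)
      rw [norm_smul, mul_pow, ← real_inner_self_eq_norm_sq (u i), hin,
        real_inner_self_eq_norm_sq, norm_inv, Real.norm_of_nonneg (by positivity)]
      have : (((i : ℝ) + 1)⁻¹) ^ 2 * (((i : ℝ) + 1) * ‖J i‖ ^ 2)
          = ((i : ℝ) + 1)⁻¹ * ‖J i‖ ^ 2 := by field_simp
      rw [this]
      exact inv_mul_le_self_of_one_le (by simp) (sq_nonneg _)
  refine ⟨∑' q : ℕ, ((q : ℝ) + 1)⁻¹ • u q, ?_⟩
  have := (hW.summable_ouInv F).hasSum.prodMk hs.hasSum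
  refine (Submodule.isClosed_topologicalClosure (cylGraph P W)).mem_of_tendsto this
    (Eventually.of_forall fun s => ?_)
  exact Submodule.sum_mem _ fun q _ => Submodule.smul_mem _ (((q : ℝ) + 1)⁻¹) (hu q)

/-- The generator applied to a cylindrical variable, tested against `-L⁻¹F`. -/
theorem inner_ouGen_ouInv (hW : IsIsonormal P W) (F : Lp ℝ 2 P) {n : ℕ} (h : Fin n → H)
    {f : (Fin n → ℝ) → ℝ} (hf : f.HasTemperateGrowth) :
    inner ℝ (hW.cylLp h (temperate_ouGen h hf))
      (∑' q : ℕ, ((q : ℝ) + 1)⁻¹ • (wienerChaos P W (q + 1)).starProjection F)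
      = inner ℝ (hW.cylLp h hf) (∑' q : ℕ, (wienerChaos P W (q + 1)).starProjection F) := by
  have h1 := (innerSL ℝ (hW.cylLp h (temperate_ouGen h hf))).hasSum (hW.summable_ouInv F).hasSum
  have h2 := (innerSL ℝ (hW.cylLp h hf)).hasSum (hW.summable_chaos F).hasSum
  refine h1.unique ?_
  simp only [innerSL_apply_apply] at h2
  convert h2 using 2 with q
  simp only [innerSL_apply_apply]
  -- The eigenvalue `q + 1` cancels the weight in the series for `-L⁻¹F`.
  rw [inner_smul_right, hW.inner_cylLp_ouGen h hf (q := q + 1)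
    (Submodule.starProjection_apply_mem _ F)]
  push_cast
  field_simp

end IsIsonormal

end

end WienerNP

/-! ### Fourier uniqueness and completeness of the chaos decomposition. -/

namespace WienerNP

section

/-- The push-forward of the measure with density the positive part of `Y`. -/
noncomputable def mapDensity {Ω E : Type*} [MeasurableSpace Ω] [MeasurableSpace E] (P : Measure Ω)
    (V : Ω → E) (Y : Ω → ℝ) : Measure E :=
  (P.withDensity fun ω => ENNReal.ofReal (Y ω)).map V

theorem isFiniteMeasure_mapDensity {Ω E : Type*} [MeasurableSpace Ω] [MeasurableSpace E]
    {P : Measure Ω} (V : Ω → E) {Y : Ω → ℝ} (hY : Integrable Y P) :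
    IsFiniteMeasure (mapDensity P V Y) := by
  have : IsFiniteMeasure (P.withDensity fun ω => ENNReal.ofReal (Y ω)) :=
    isFiniteMeasure_withDensity_ofReal hY.2
  unfold mapDensity
  infer_instance

theorem integral_mapDensity {Ω E F : Type*} [MeasurableSpace Ω] [MeasurableSpace E]
    [NormedAddCommGroup F] [NormedSpace ℝ F]
    {P : Measure Ω} {V : Ω → E} (hV : AEMeasurable V P) {Y : Ω → ℝ} (hY : AEMeasurable Y P)
    {g : E → F} (hg : StronglyMeasurable g) :
    ∫ x, g x ∂(mapDensity P V Y) = ∫ ω, max (Y ω) 0 • g (V ω) ∂P := by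
  unfold mapDensity
  rw [integral_map (hV.mono_ac (withDensity_absolutelyContinuous _ _)) hg.aestronglyMeasurable,
    integral_withDensity_eq_integral_toReal_smul₀ hY.ennreal_ofReal (by simp)]
  simp [ENNReal.toReal_ofReal']

/-- Since `max Y 0 - max (-Y) 0 = Y`, a signed weight `Y` is handled as a difference of two positive
finite measures, to which uniqueness of characteristic functions applies. -/
theorem integral_mapDensity_sub {Ω E F : Type*} [MeasurableSpace Ω] [MeasurableSpace E]
    [NormedAddCommGroup F] [NormedSpace ℝ F]
    {P : Measure Ω} {V : Ω → E} (hV : AEMeasurable V P) {Y : Ω → ℝ} (hY : AEMeasurable Y P)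
    {g : E → F} (hg : StronglyMeasurable g) (hi : Integrable (fun ω => Y ω • g (V ω)) P) :
    ∫ x, g x ∂(mapDensity P V Y) - ∫ x, g x ∂(mapDensity P V fun ω => -Y ω)
      = ∫ ω, Y ω • g (V ω) ∂P := by
  have hgV : AEStronglyMeasurable (fun ω => g (V ω)) P :=
    (hg.aestronglyMeasurable (μ := P.map V)).comp_aemeasurable hV
  have hmax : ∀ {Y' : Ω → ℝ}, AEMeasurable Y' P → (∀ ω, |Y' ω| = |Y ω|) →
      Integrable (fun ω => max (Y' ω) 0 • g (V ω)) P := by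
    intro Y' hm hY'
    refine hi.mono (hm.max aemeasurable_const |>.aestronglyMeasurable.smul hgV) ?_
    filter_upwards with ω
    rw [norm_smul, norm_smul]
    gcongr
    rw [Real.norm_eq_abs, Real.norm_eq_abs, ← hY', abs_of_nonneg (le_max_right _ _)]
    exact max_le (le_abs_self _) (abs_nonneg _)
  rw [integral_mapDensity hV hY hg, integral_mapDensity hV (Y := fun ω => -Y ω) hY.neg hg,
    ← integral_sub (hmax hY fun _ => rfl) (hmax (Y' := fun ω => -Y ω) hY.neg fun ω => abs_neg _)]
  congr 1; ext ω
  rw [← sub_smul]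
  congr 1
  rcases le_total (Y ω) 0 with h | h
  · rw [max_eq_right h, max_eq_left (by linarith)]; ring
  · rw [max_eq_left h, max_eq_right (by linarith)]; ring

/-- If all Fourier integrals of `V` against the density `Y` vanish, then `Y` is orthogonal to all
functions of `V`. -/
theorem integral_smul_comp_eq_zero {Ω E F : Type*} [MeasurableSpace Ω] [NormedAddCommGroup E]
    [NormedSpace ℝ E] [MeasurableSpace E] [BorelSpace E] [SecondCountableTopology E]
    [CompleteSpace E] [NormedAddCommGroup F] [NormedSpace ℝ F]
    {P : Measure Ω} {V : Ω → E} (hV : AEMeasurable V P) {Y : Ω → ℝ} (hY : Integrable Y P)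
    (h0 : ∀ L : StrongDual ℝ E, ∫ ω, Y ω • Complex.exp (L (V ω) * Complex.I) ∂P = 0)
    {g : E → F} (hg : StronglyMeasurable g) (hi : Integrable (fun ω => Y ω • g (V ω)) P) :
    ∫ ω, Y ω • g (V ω) ∂P = 0 := by
  have := isFiniteMeasure_mapDensity V hY
  have := isFiniteMeasure_mapDensity V hY.neg
  have key : mapDensity P V Y = mapDensity P V fun ω => -Y ω := by
    refine Measure.ext_of_charFunDual ?_
    ext L
    rw [charFunDual_apply, charFunDual_apply, ← sub_eq_zero]
    have hm : StronglyMeasurable fun x : E => Complex.exp (L x * Complex.I) :=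
      (by fun_prop : Continuous fun x : E => Complex.exp (L x * Complex.I)).stronglyMeasurable
    rw [integral_mapDensity_sub hV hY.aemeasurable hm, h0]
    refine hY.norm.mono (hY.aestronglyMeasurable.smul
      ((hm.aestronglyMeasurable (μ := P.map V)).comp_aemeasurable hV)) ?_
    filter_upwards with ω
    simp [Complex.norm_exp_ofReal_mul_I]
  rw [← integral_mapDensity_sub hV hY.aemeasurable hg hi, ← key, sub_self]

variable {Ω H : Type*} [MeasurableSpace Ω] [NormedAddCommGroup H] [InnerProductSpace ℝ H]
  {P : Measure Ω} {W : H → Ω → ℝ}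

namespace IsIsonormal

theorem integrable_exp_mul (hW : IsIsonormal P W) (h : H) (t : ℝ) :
    Integrable (fun ω => Real.exp (t * W h ω)) P := by
  have h1 := integrable_exp_mul_gaussianReal (μ := 0) (v := ‖h‖₊ ^ 2) t
  rw [← hW.map_eq h] at h1
  exact (integrable_map_measure (by fun_prop) (hW.gaussian.aemeasurable h)).1 h1

theorem memLp_exp_abs (hW : IsIsonormal P W) (h : H) (t : ℝ) :
    MemLp (fun ω => Real.exp (|t| * |W h ω|)) 2 P := by
  have hm := hW.gaussian.aemeasurable h
  rw [memLp_two_iff_integrable_sq (by fun_prop)]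
  have := integrable_exp_mul_abs (hW.integrable_exp_mul h (2 * |t|))
    (hW.integrable_exp_mul h (-(2 * |t|)))
  refine this.congr (Eventually.of_forall fun ω => ?_)
  simp only
  rw [← Real.exp_nat_mul]
  push_cast; ring_nf

/-- A variable orthogonal to all powers of a Gaussian variable is orthogonal to its exponentials. -/
theorem integral_smul_cexp_eq_zero (hW : IsIsonormal P W) {Y : Ω → ℝ} (hY : MemLp Y 2 P) (h : H)
    (h0 : ∀ n : ℕ, ∫ ω, Y ω * W h ω ^ n ∂P = 0) (t : ℝ) :
    ∫ ω, Y ω • Complex.exp ((t * W h ω : ℝ) * Complex.I) ∂P = 0 := by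
  have hm := hW.gaussian.aemeasurable h
  have hYm := hY.aemeasurable
  have hs : ∀ ω, HasSum (fun n : ℕ => |Y ω| * ((|t| * |W h ω|) ^ n / n.factorial))
      (|Y ω| * Real.exp (|t| * |W h ω|)) := fun ω => by
    have := NormedSpace.expSeries_div_hasSum_exp (𝔸 := ℝ) (|t| * |W h ω|)
    rw [← Real.exp_eq_exp_ℝ] at this
    exact this.mul_left _
  -- The exponential series is integrated term by term. It is dominated by `|Y| exp(|t| |W h|)`, a
  -- product of two square integrable variables.
  have key := hasSum_integral_of_dominated_convergence (μ := P)
    (F := fun n ω => ((Y ω : ℝ) : ℂ) * ((((t * W h ω : ℝ) : ℂ) * Complex.I) ^ n / n.factorial))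
    (f := fun ω => ((Y ω : ℝ) : ℂ) * Complex.exp (((t * W h ω : ℝ) : ℂ) * Complex.I))
    (fun n ω => |Y ω| * ((|t| * |W h ω|) ^ n / n.factorial))
    (fun n => by
      refine AEMeasurable.aestronglyMeasurable ?_
      fun_prop)
    (fun n => by
      filter_upwards with ω
      simp [mul_pow])
    (by filter_upwards with ω using (hs ω).summable)
    (by
      simp_rw [fun ω => (hs ω).tsum_eq]
      exact hY.abs.integrable_mul (hW.memLp_exp_abs h t))
    (by
      filter_upwards with ω
      have := NormedSpace.expSeries_div_hasSum_exp (𝔸 := ℂ) (((t * W h ω : ℝ) : ℂ) * Complex.I)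
      rw [← Complex.exp_eq_exp_ℂ] at this
      exact this.mul_left _)
  have e : ∀ n : ℕ, ∫ ω, ((Y ω : ℝ) : ℂ)
      * ((((t * W h ω : ℝ) : ℂ) * Complex.I) ^ n / n.factorial) ∂P = 0 := by
    intro n
    have : ∀ ω, ((Y ω : ℝ) : ℂ) * ((((t * W h ω : ℝ) : ℂ) * Complex.I) ^ n / n.factorial)
        = (t * Complex.I) ^ n / n.factorial * ((Y ω * W h ω ^ n : ℝ) : ℂ) := by
      intro ω; push_cast; ring
    simp_rw [this]
    rw [integral_const_mul, integral_complex_ofReal, h0 n]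
    simp
  simp_rw [e] at key
  have := key.unique hasSum_zero
  simpa [Complex.real_smul] using this

theorem ae_sum (hW : IsIsonormal P W) {n : ℕ} (h : Fin n → H) (c : Fin n → ℝ) :
    (fun ω => ∑ i, c i * W (h i) ω) =ᵐ[P] W (∑ i, c i • h i) := by
  have key : ∀ s : Finset (Fin n),
      (fun ω => ∑ i ∈ s, c i * W (h i) ω) =ᵐ[P] W (∑ i ∈ s, c i • h i) := by
    intro s
    classical
    induction s using Finset.induction_on with
    | empty =>
      have := hW.ae_linear (-1) 0 0 0 (by simp)
      filter_upwards [this] with ω hω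
      simp at hω ⊢
      linarith
    | insert a s ha ih =>
      have := hW.ae_linear (c a) (h a) (∑ i ∈ s, c i • h i) (∑ i ∈ insert a s, c i • h i)
        (by rw [Finset.sum_insert ha])
      filter_upwards [this, ih] with ω hω h2
      rw [hω, Finset.sum_insert ha, h2, mul_comm]
  exact key Finset.univ

/-- A variable orthogonal to all chaoses is orthogonal to all cylindrical variables. -/
theorem inner_cylLp_eq_zero (hW : IsIsonormal P W) {Y : Lp ℝ 2 P} (hY0 : ∫ ω, Y ω ∂P = 0)
    (hY : ∀ q : ℕ, q ≠ 0 → ∀ V ∈ wienerChaos P W q, inner ℝ V Y = 0) {n : ℕ} (h : Fin n → H)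
    {f : (Fin n → ℝ) → ℝ} (hf : f.HasTemperateGrowth) : inner ℝ (hW.cylLp h hf) Y = 0 := by
  have := hW.gaussian.isProbabilityMeasure
  have hYm : MemLp Y 2 P := Lp.memLp Y
  have hpm : ∀ (g : H) (p : Polynomial ℤ), MemLp (fun ω => Polynomial.aeval (W g ω) p) 2 P :=
    fun g p => memLp_comp_temperate (Y := W g) (fun p => hW.memLp g (by simp)) (temperate_aeval p) 2
  -- orthogonality to the polynomials in `W(g)`
  have hpoly : ∀ g : H, ‖g‖ = 1 → ∀ (n : ℕ) (p : Polynomial ℤ), p.degree < n →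
      ∫ ω, Y ω * Polynomial.aeval (W g ω) p ∂P = 0 := by
    intro g hg n
    induction n with
    | zero =>
      intro p hp
      have : p = 0 := by simpa using hp
      simp [this]
    | succ n ih =>
      intro p hp
      -- Hermite polynomials are monic with integer coefficients, so subtracting `p.coeff n` times
      -- the `n`-th one lowers the degree and stays within `ℤ[X]`.
      have hdeg : (p - Polynomial.C (p.coeff n) * Polynomial.hermite n).degree < n := by
        rw [Polynomial.degree_lt_iff_coeff_zero]
        intro m hm
        rw [Polynomial.coeff_sub, Polynomial.coeff_C_mul]
        rcases hm.eq_or_lt with rfl | hm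
        · simp
        · rw [Polynomial.coeff_hermite_of_lt hm,
            (Polynomial.degree_lt_iff_coeff_zero _ _).1 hp m hm]
          simp
      have h1 := ih _ hdeg
      have h2 : ∫ ω, Y ω * Polynomial.aeval (W g ω) (Polynomial.hermite n) ∂P = 0 := by
        rcases eq_or_ne n 0 with rfl | hn
        · simpa using hY0
        · have hv : (hpm g (Polynomial.hermite n)).toLp _ ∈ wienerChaos P W n :=
            Submodule.le_topologicalClosure _ (Submodule.subset_span
              ⟨g, hg, (hpm g (Polynomial.hermite n)).coeFn_toLp⟩)
          have := hY n hn _ hv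
          rw [← Lp.toLp_coeFn Y hYm, inner_toLp_eq] at this
          simpa using this
      simp only [map_sub, map_mul, Polynomial.aeval_C, mul_sub] at h1
      have i1 : Integrable (fun ω => Y ω * Polynomial.aeval (W g ω) p) P :=
        hYm.integrable_mul (hpm g p)
      have i2 : Integrable (fun ω => Y ω * ((algebraMap ℤ ℝ) (p.coeff n)
          * Polynomial.aeval (W g ω) (Polynomial.hermite n))) P :=
        hYm.integrable_mul ((hpm g (Polynomial.hermite n)).const_mul _)
      rw [integral_sub i1 i2] at h1
      have e : ∀ ω, Y ω * ((algebraMap ℤ ℝ) (p.coeff n)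
          * Polynomial.aeval (W g ω) (Polynomial.hermite n)) = (algebraMap ℤ ℝ) (p.coeff n)
          * (Y ω * Polynomial.aeval (W g ω) (Polynomial.hermite n)) := fun ω => by ring
      simp_rw [e] at h1
      rw [integral_const_mul, h2, mul_zero, sub_zero] at h1
      exact h1
  have hpow : ∀ g : H, ‖g‖ = 1 → ∀ n : ℕ, ∫ ω, Y ω * W g ω ^ n ∂P = 0 := by
    intro g hg n
    have := hpoly g hg (n + 1) (Polynomial.X ^ n) (by
      rw [Polynomial.degree_X_pow]; exact_mod_cast Nat.lt_succ_self n)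
    simpa using this
  have hexp : ∀ g : H, ∫ ω, Y ω • Complex.exp ((W g ω : ℝ) * Complex.I) ∂P = 0 := by
    intro g
    rcases eq_or_ne g 0 with rfl | hg
    · have h0 := hW.ae_linear (-1) 0 0 0 (by simp)
      have : ∫ ω, Y ω • Complex.exp ((W (0 : H) ω : ℝ) * Complex.I) ∂P = ∫ ω, ((Y ω : ℝ) : ℂ) ∂P := by
        refine integral_congr_ae ?_
        filter_upwards [h0] with ω hω
        have : W (0 : H) ω = 0 := by linarith
        simp [this]
      rw [this, integral_complex_ofReal, hY0]; simp
    · have hg' : ‖g‖ ≠ 0 := norm_ne_zero_iff.2 hg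
      have h1 : ‖(‖g‖⁻¹ • g)‖ = 1 := by rw [norm_smul, norm_inv, norm_norm, inv_mul_cancel₀ hg']
      have h0 := hW.ae_linear ‖g‖ (‖g‖⁻¹ • g) 0 g (by rw [smul_smul, mul_inv_cancel₀ hg']; simp)
      have h00 := hW.ae_linear (-1) 0 0 0 (by simp)
      rw [← hW.integral_smul_cexp_eq_zero hYm (‖g‖⁻¹ • g) (hpow _ h1) ‖g‖]
      refine integral_congr_ae ?_
      filter_upwards [h0, h00] with ω hω h2
      have : W (0 : H) ω = 0 := by linarith
      rw [hω, this, add_zero, mul_comm ‖g‖]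
  have hcyl := hW.memLp_cylinder h hf
  have hVm : AEMeasurable (fun ω i => W (h i) ω) P := (hW.hasGaussianLaw_pi h).aemeasurable
  have := integral_smul_comp_eq_zero hVm (hYm.integrable (by norm_num)) (fun L => ?_)
    hf.1.continuous.stronglyMeasurable (hYm.integrable_mul hcyl)
  · rw [← Lp.toLp_coeFn Y hYm, cylLp, inner_toLp_eq]
    simpa [cylinder, mul_comm] using this
  -- Cramér–Wold: a linear functional of `(W (h i))` is almost surely `W` of a single vector, so
  -- Fourier integrals in one variable suffice.
  · rw [← hexp (∑ i, L (Pi.single i 1) • h i)]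
    refine integral_congr_ae ?_
    filter_upwards [hW.ae_sum h fun i => L (Pi.single i 1)] with ω hω
    have : L (fun i => W (h i) ω) = ∑ i, L (Pi.single i 1) * W (h i) ω := by
      conv_lhs => rw [← Finset.univ_sum_single (fun i => W (h i) ω)]
      rw [map_sum]
      refine Finset.sum_congr rfl fun i _ => ?_
      have : (Pi.single i (W (h i) ω) : Fin n → ℝ) = W (h i) ω • Pi.single i 1 := by
        ext j; simp [Pi.single_apply]
      rw [this, map_smul, smul_eq_mul, mul_comm]
    rw [this, hω]

/-- Chaos decomposition of a centered differentiable variable. -/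
theorem tsum_chaos_eq (hW : IsIsonormal P W) {F : Lp ℝ 2 P} {U : Lp H 2 P}
    (hF : (F, U) ∈ derivGraph P W) (hF0 : ∫ ω, F ω ∂P = 0) :
    ∑' q : ℕ, (wienerChaos P W (q + 1)).starProjection F = F := by
  have := hW.gaussian.isProbabilityMeasure
  have hJ : ∀ q : ℕ, (wienerChaos P W (q + 1)).starProjection F ∈ wienerChaos P W (q + 1) :=
    fun q => Submodule.starProjection_apply_mem _ F
  have hS := (hW.summable_chaos F).hasSum
  set S := ∑' q : ℕ, (wienerChaos P W (q + 1)).starProjection F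
  have h1 : ∀ q : ℕ, q ≠ 0 → ∀ V ∈ wienerChaos P W q, inner ℝ V (F - S) = 0 := by
    intro q hq V hV
    obtain ⟨q, rfl⟩ := Nat.exists_eq_succ_of_ne_zero hq
    have := (innerSL ℝ V).hasSum hS
    have h2 := this.unique (hasSum_single q (fun p hp => by
      simp only [innerSL_apply_apply]
      exact hW.inner_wienerChaos (p := q + 1) (q := p + 1) (by simpa using hp.symm) hV (hJ p)))
    simp only [innerSL_apply_apply] at h2
    rw [inner_sub_right, h2, ← inner_sub_right, real_inner_comm]
    exact (wienerChaos P W (q + 1)).starProjection_inner_eq_zero F V hV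
  have hone : ∀ V : Lp ℝ 2 P,
      inner ℝ ((memLp_const (1 : ℝ)).toLp (fun _ : Ω => (1 : ℝ)) : Lp ℝ 2 P) V = ∫ ω, V ω ∂P := by
    intro V
    conv_lhs => rw [← Lp.toLp_coeFn V (Lp.memLp V)]
    rw [inner_toLp_eq]; simp
  have h2 : ∫ ω, (F - S : Lp ℝ 2 P) ω ∂P = 0 := by
    rw [← hone, inner_sub_right, hone, hF0, zero_sub, neg_eq_zero]
    have := (innerSL ℝ ((memLp_const (1 : ℝ)).toLp (fun _ : Ω => (1 : ℝ)) : Lp ℝ 2 P)).hasSum hS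
    refine this.unique ?_
    convert hasSum_zero using 1
    ext q
    simp only [innerSL_apply_apply, hone]
    exact hW.inner_const_wienerChaos (Nat.succ_ne_zero q) (hJ q)
  -- Here `F` must be a limit of cylindrical variables: `W` is not assumed to generate the σ-algebra
  -- of `Ω`, so the chaoses need not span all of `L²`.
  have h3 : inner ℝ F (F - S) = 0 := by
    have hc : IsClosed {p : Lp ℝ 2 P × Lp H 2 P | inner ℝ p.1 (F - S) = 0} :=
      isClosed_eq (by fun_prop) (by fun_prop)
    refine closure_minimal ?_ hc hF
    intro r hr
    obtain ⟨n, h, f, hf, rfl⟩ := hW.mem_cylGraph_iff.1 hr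
    exact hW.inner_cylLp_eq_zero h2 h1 h hf
  have h4 : inner ℝ S (F - S) = 0 := by
    rw [real_inner_comm]
    have := (innerSL ℝ (F - S)).hasSum hS
    refine this.unique ?_
    convert hasSum_zero using 1
    ext q
    simp only [innerSL_apply_apply]
    rw [real_inner_comm]
    exact h1 (q + 1) (Nat.succ_ne_zero q) _ (hJ q)
  have h5 : inner ℝ (F - S) (F - S) = 0 := by rw [inner_sub_left, h3, h4, sub_zero]
  exact (sub_eq_zero.1 (inner_self_eq_zero.1 h5)).symm

end IsIsonormal

end

end WienerNP

/-! ### Malliavin integration by parts for smooth functions of `X`. -/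

namespace WienerNP

section

theorem integrable_inner_of_memLp {Ω E : Type*} [MeasurableSpace Ω] {P : Measure Ω}
    [NormedAddCommGroup E] [InnerProductSpace ℝ E] {f g : Ω → E} (hf : MemLp f 2 P)
    (hg : MemLp g 2 P) : Integrable (fun ω => inner ℝ (f ω) (g ω)) P := by
  refine (L2.integrable_inner (𝕜 := ℝ) (hf.toLp f) (hg.toLp g)).congr ?_
  filter_upwards [hf.coeFn_toLp, hg.coeFn_toLp] with ω h1 h2
  rw [h1, h2]

theorem tendsto_integral_inner {Ω E : Type*} [MeasurableSpace Ω] {P : Measure Ω}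
    [NormedAddCommGroup E] [InnerProductSpace ℝ E] {f : ℕ → Ω → E} {f₀ g : Ω → E}
    (hf : ∀ n, MemLp (f n) 2 P) (hf₀ : MemLp f₀ 2 P) (hg : MemLp g 2 P)
    (h : Tendsto (fun n => eLpNorm (f n - f₀) 2 P) atTop (𝓝 0)) :
    Tendsto (fun n => ∫ ω, inner ℝ (f n ω) (g ω) ∂P) atTop (𝓝 (∫ ω, inner ℝ (f₀ ω) (g ω) ∂P)) := by
  have h1 := (Lp.tendsto_Lp_iff_tendsto_eLpNorm'' f hf f₀ hf₀).2 h
  have h2 := h1.inner (𝕜 := ℝ) (tendsto_const_nhds (x := hg.toLp g))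
  simpa only [inner_toLp_eq] using h2

variable {Ω H : Type*} [MeasurableSpace Ω] [NormedAddCommGroup H] [InnerProductSpace ℝ H]
  {P : Measure Ω} {W : H → Ω → ℝ}

theorem hasMalliavinDeriv_malliavinD {F : Ω → ℝ} (hF : MemD12 P W F) :
    HasMalliavinDeriv P W F (malliavinD P W F) := by
  rw [malliavinD, dif_pos hF]
  exact Classical.choose_spec hF

namespace IsIsonormal

/-- The integration by parts formula `E[⟨DG, -DL⁻¹F⟩] = E[G F]` for cylindrical `G`. -/
theorem integral_inner_malliavinD_ouInv [CompleteSpace H] (hW : IsIsonormal P W) {F : Ω → ℝ}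
    (hF : MemD12 P W F) (hF0 : ∫ ω, F ω ∂P = 0) :
    MemLp (malliavinD P W (ouInv P W F)) 2 P ∧
    ∀ {n : ℕ} (h : Fin n → H) {f : (Fin n → ℝ) → ℝ}, f.HasTemperateGrowth →
      ∫ ω, inner ℝ (cylinderDeriv W h f ω) (-(malliavinD P W (ouInv P W F) ω)) ∂P
        = ∫ ω, inner ℝ (cylinder W h f ω) (F ω) ∂P := by
  have hD := hasMalliavinDeriv_malliavinD hF
  have hFm : MemLp F 2 P := hD.1
  have hmem := (hasMalliavinDeriv_iff hW hFm hD.2.1).1 hD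
  have hF0' : ∫ ω, hFm.toLp F ω ∂P = 0 := by
    rw [← hF0]; exact integral_congr_ae hFm.coeFn_toLp
  have hJ := hW.tsum_chaos_eq hmem hF0'
  have hou : ouInv P W F = ((-∑' q : ℕ, ((q : ℝ) + 1)⁻¹ •
      (wienerChaos P W (q + 1)).starProjection (hFm.toLp F) : Lp ℝ 2 P) : Ω → ℝ) := by
    rw [ouInv, dif_pos hFm]
  set V := ∑' q : ℕ, ((q : ℝ) + 1)⁻¹ • (wienerChaos P W (q + 1)).starProjection (hFm.toLp F)
  obtain ⟨U₀, hU₀⟩ : ∃ U, (V, U) ∈ derivGraph P W := hW.exists_deriv_ouInv (hFm.toLp F)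
  have hVm : MemLp (ouInv P W F) 2 P := by rw [hou]; exact Lp.memLp _
  have hVeq : hVm.toLp (ouInv P W F) = -V := by
    ext1; refine hVm.coeFn_toLp.trans ?_; rw [hou]
  have hD12 : MemD12 P W (ouInv P W F) := by
    refine ⟨(-U₀ : Lp H 2 P), (hasMalliavinDeriv_iff hW hVm (Lp.memLp _)).2 ?_⟩
    rw [hVeq, Lp.toLp_coeFn]
    exact Submodule.neg_mem _ hU₀
  have hD2 := hasMalliavinDeriv_malliavinD hD12
  -- `malliavinD` is a choice of derivative; the duality formula holds for any element of the closed
  -- graph, hence for the chosen one.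
  have hmem2 := (hasMalliavinDeriv_iff hW hVm hD2.2.1).1 hD2
  rw [hVeq] at hmem2
  refine ⟨hD2.2.1, fun {n} h {f} hf => ?_⟩
  have h1 := hW.inner_cylDLp h hf (Submodule.neg_mem _ hmem2)
  simp only [Prod.neg_mk, neg_neg] at h1
  rw [hW.inner_ouGen_ouInv (hFm.toLp F) h hf, hJ, cylLp, cylDLp, inner_neg_right, inner_toLp_eq,
    inner_toLp_eq, ← integral_neg] at h1
  simpa only [inner_neg_right] using h1

theorem cylinderDeriv_comp {n : ℕ} (h : Fin n → H) {f : (Fin n → ℝ) → ℝ}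
    (hf : f.HasTemperateGrowth) {φ : ℝ → ℝ} (hφ : φ.HasTemperateGrowth) (ω : Ω) :
    cylinderDeriv W h (φ ∘ f) ω = deriv φ (cylinder W h f ω) • cylinderDeriv W h f ω := by
  have : ∀ x v, fderiv ℝ (φ ∘ f) x v = deriv φ (f x) * fderiv ℝ f x v := by
    intro x v
    have h1 := (hφ.1.differentiable (by simp) (f x)).hasDerivAt
    have h2 := (hf.1.differentiable (by simp) x).hasFDerivAt
    rw [(h1.comp_hasFDerivAt x h2).fderiv]
    simp
  simp only [cylinderDeriv, this, Finset.smul_sum, smul_smul, cylinder]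

/-- The integration by parts formula `E[X φ(X)] = E[φ'(X) ⟨DX, -DL⁻¹X⟩]`, for smooth `φ` with
bounded derivative. -/
theorem integral_mul_comp [CompleteSpace H] (hW : IsIsonormal P W) {X : Ω → ℝ}
    (hX : MemD12 P W X) (hX0 : ∫ ω, X ω ∂P = 0) {φ : ℝ → ℝ} (hφ : φ.HasTemperateGrowth) {M : ℝ≥0}
    (hM : ∀ x, |deriv φ x| ≤ M) :
    ∫ ω, X ω * φ (X ω) ∂P = ∫ ω, inner ℝ (malliavinD P W X ω) (-(malliavinD P W (ouInv P W X) ω))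
      * deriv φ (X ω) ∂P := by
  have := hW.gaussian.isProbabilityMeasure
  obtain ⟨hXm, hUm, happ⟩ := hasMalliavinDeriv_malliavinD hX
  obtain ⟨hVm, hG⟩ := hW.integral_inner_malliavinD_ouInv hX hX0
  set U := malliavinD P W X
  have hVm' : MemLp (fun ω => -(malliavinD P W (ouInv P W X) ω)) 2 P := hVm.neg
  set V := fun ω => -(malliavinD P W (ouInv P W X) ω) with hV
  have hlip : LipschitzWith M φ :=
    lipschitzWith_of_nnnorm_deriv_le (hφ.1.differentiable (by simp)) fun x => by
      rw [← NNReal.coe_le_coe]; simpa using hM x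
  have hd : Continuous (deriv φ) := (temperate_deriv hφ).1.continuous
  choose n h f hf h1 h2 using fun k : ℕ => happ ((k : ℝ≥0∞) + 1)⁻¹ (by simp)
  have hlim : Tendsto (fun k : ℕ => ((k : ℝ≥0∞) + 1)⁻¹) atTop (𝓝 0) := by
    have := (tendsto_add_atTop_iff_nat 1).2 ENNReal.tendsto_inv_nat_nhds_zero
    simpa using this
  have t1 : Tendsto (fun k => eLpNorm (cylinder W (h k) (f k) - X) 2 P) atTop (𝓝 0) :=
    tendsto_of_tendsto_of_tendsto_of_le_of_le tendsto_const_nhds hlim (fun _ => zero_le)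
      (fun k => (h1 k).le)
  have t2 : Tendsto (fun k => eLpNorm (cylinderDeriv W (h k) (f k) - U) 2 P) atTop (𝓝 0) :=
    tendsto_of_tendsto_of_tendsto_of_le_of_le tendsto_const_nhds hlim (fun _ => zero_le)
      (fun k => (h2 k).le)
  have hcm := fun k => hW.memLp_cylinder (h k) (hf k)
  -- Almost sure convergence along a subsequence is needed to pass to the limit in `φ'`, which is
  -- bounded and continuous but has no given Lipschitz constant.
  obtain ⟨s, hs, hae⟩ := (tendstoInMeasure_of_tendsto_eLpNorm (by simp)
    (fun k => (hcm k).aestronglyMeasurable) hXm.aestronglyMeasurable t1).exists_seq_tendsto_ae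
  have t1' := t1.comp hs.tendsto_atTop
  have t2' := t2.comp hs.tendsto_atTop
  have hcm' := fun k => hW.memLp_cylinder (h k) (hφ.comp (hf k))
  have hφX : MemLp (fun ω => φ (X ω)) 2 P := by
    have h0 : MemLp (fun ω => φ (X ω) - φ 0) 2 P := by
      refine hXm.of_le_mul (c := M) ((hlip.continuous.comp_aestronglyMeasurable
        hXm.aestronglyMeasurable).sub aestronglyMeasurable_const) ?_
      filter_upwards with ω
      simpa [dist_eq_norm] using hlip.dist_le_mul (X ω) 0
    refine (h0.add (memLp_const (φ 0))).congr_norm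
      (hlip.continuous.comp_aestronglyMeasurable hXm.aestronglyMeasurable) ?_
    filter_upwards with ω
    simp
  have hsmul : ∀ {Y : Ω → ℝ} {D : Ω → H}, MemLp Y 2 P → MemLp D 2 P →
      MemLp (fun ω => deriv φ (Y ω) • D ω) 2 P := by
    intro Y D hY hD
    refine hD.of_le_mul (c := M) ((hd.comp_aestronglyMeasurable hY.aestronglyMeasurable).smul
      hD.aestronglyMeasurable) ?_
    filter_upwards with ω
    rw [norm_smul]
    gcongr
    exact hM _
  have hsub : ∀ k, MemLp (fun ω => cylinderDeriv W (h (s k)) (f (s k)) ω - U ω) 2 P :=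
    fun k => (hW.memLp_cylinderDeriv (h (s k)) (hf (s k))).sub hUm
  -- the right-hand side of the approximating identities
  have r1 : Tendsto (fun k => ∫ ω, inner ℝ (cylinder W (h (s k)) (φ ∘ f (s k)) ω) (X ω) ∂P) atTop
      (𝓝 (∫ ω, inner ℝ (φ (X ω)) (X ω) ∂P)) := by
    refine tendsto_integral_inner (fun k => hcm' (s k)) hφX hXm ?_
    have t3 := ENNReal.Tendsto.const_mul (a := ENNReal.ofReal M) t1' (Or.inr (by simp))
    rw [mul_zero] at t3
    refine tendsto_of_tendsto_of_tendsto_of_le_of_le tendsto_const_nhds t3 (fun _ => zero_le)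
      (fun k => ?_)
    refine eLpNorm_le_mul_eLpNorm_of_ae_le_mul ?_ 2
    filter_upwards with ω
    simpa [dist_eq_norm, cylinder] using hlip.dist_le_mul (cylinder W (h (s k)) (f (s k)) ω) (X ω)
  -- the left-hand side
  have l1 : Tendsto (fun k => ∫ ω, inner ℝ (deriv φ (cylinder W (h (s k)) (f (s k)) ω) •
      (cylinderDeriv W (h (s k)) (f (s k)) ω - U ω)) (V ω) ∂P) atTop (𝓝 0) := by
    have := tendsto_integral_inner (f := fun k ω => deriv φ (cylinder W (h (s k)) (f (s k)) ω) •
      (cylinderDeriv W (h (s k)) (f (s k)) ω - U ω)) (f₀ := 0)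
      (fun k => hsmul (hcm (s k)) (hsub k))
      MemLp.zero hVm' ?_
    · simpa using this
    have t3 := ENNReal.Tendsto.const_mul (a := ENNReal.ofReal M) t2' (Or.inr (by simp))
    rw [mul_zero] at t3
    refine tendsto_of_tendsto_of_tendsto_of_le_of_le tendsto_const_nhds t3 (fun _ => zero_le)
      (fun k => ?_)
    refine eLpNorm_le_mul_eLpNorm_of_ae_le_mul ?_ 2
    filter_upwards with ω
    simp only [Pi.sub_apply, Pi.zero_apply, sub_zero]
    rw [norm_smul]
    gcongr
    exact hM _
  have hUV : Integrable (fun ω => inner ℝ (U ω) (V ω)) P := integrable_inner_of_memLp hUm hVm'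
  have l2 : Tendsto (fun k => ∫ ω, deriv φ (cylinder W (h (s k)) (f (s k)) ω) *
      inner ℝ (U ω) (V ω) ∂P) atTop (𝓝 (∫ ω, deriv φ (X ω) * inner ℝ (U ω) (V ω) ∂P)) := by
    refine tendsto_integral_of_dominated_convergence (fun ω => M * ‖inner ℝ (U ω) (V ω)‖)
      (fun k => (hd.comp_aestronglyMeasurable (hcm (s k)).aestronglyMeasurable).mul
        hUV.aestronglyMeasurable) (hUV.norm.const_mul _) (fun k => ?_) ?_
    · filter_upwards with ω
      rw [norm_mul]
      gcongr
      exact hM _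
    · filter_upwards [hae] with ω hω
      exact ((hd.tendsto _).comp hω).mul_const _
  have l3 := l1.add l2
  -- By the chain rule the derivative of `φ(X_k)` is `φ'(X_k)(DX_k - U) + φ'(X_k) U`. The first term
  -- vanishes in `L²`, and the second is treated by dominated convergence.
  have e : ∀ k, ∫ ω, inner ℝ (deriv φ (cylinder W (h (s k)) (f (s k)) ω) •
      (cylinderDeriv W (h (s k)) (f (s k)) ω - U ω)) (V ω) ∂P
      + ∫ ω, deriv φ (cylinder W (h (s k)) (f (s k)) ω) * inner ℝ (U ω) (V ω) ∂P
      = ∫ ω, inner ℝ (cylinder W (h (s k)) (φ ∘ f (s k)) ω) (X ω) ∂P := by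
    intro k
    rw [← hG (h (s k)) (hφ.comp (hf (s k))), ← integral_add]
    · congr 1; ext ω
      rw [cylinderDeriv_comp (h (s k)) (hf (s k)) hφ, ← real_inner_smul_left, ← inner_add_left,
        ← smul_add, sub_add_cancel]
    · exact integrable_inner_of_memLp (hsmul (hcm (s k)) (hsub k)) hVm'
    · have := integrable_inner_of_memLp (hsmul (hcm (s k)) hUm) hVm'
      simpa only [real_inner_smul_left] using this
  simp only [e, zero_add] at l3
  have := tendsto_nhds_unique r1 l3
  simpa only [RCLike.inner_apply, conj_trivial, mul_comm (deriv φ _)] using this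

end IsIsonormal

end

end WienerNP

/-! ### The zero-bias measure. -/

namespace WienerNP

section ZeroBias

variable {Ω : Type*} [MeasurableSpace Ω] {P : Measure Ω}

/-- The (unnormalized) zero-bias measure of `X`: the measure `λ` such that
`E[X (f(X) - f(0))] = ∫ f' dλ`. -/
noncomputable def zeroBias (P : Measure Ω) (X : Ω → ℝ) : Measure ℝ :=
  volume.withDensity fun t => ∫⁻ ω, (uIoc 0 (X ω)).indicator (fun _ => ‖X ω‖ₑ) t ∂P

theorem measurableSet_uIoc_graph {X : Ω → ℝ} (hX : Measurable X) :
    MeasurableSet {p : ℝ × Ω | p.1 ∈ uIoc 0 (X p.2)} := by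
  simp only [uIoc, mem_Ioc]
  have h1 : Measurable fun p : ℝ × Ω => min 0 (X p.2) := by fun_prop
  have h2 : Measurable fun p : ℝ × Ω => max 0 (X p.2) := by fun_prop
  exact (measurableSet_lt h1 measurable_fst).inter (measurableSet_le measurable_fst h2)

theorem measurable_zeroBias_aux {X : Ω → ℝ} (hX : Measurable X) :
    Measurable fun p : ℝ × Ω => (uIoc 0 (X p.2)).indicator (fun _ => ‖X p.2‖ₑ) p.1 := by
  have : (fun p : ℝ × Ω => (uIoc 0 (X p.2)).indicator (fun _ => ‖X p.2‖ₑ) p.1)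
      = {p : ℝ × Ω | p.1 ∈ uIoc 0 (X p.2)}.indicator fun p => ‖X p.2‖ₑ := by
    ext p; by_cases h : p.1 ∈ uIoc 0 (X p.2) <;> simp [h]
  rw [this]
  exact Measurable.indicator (by fun_prop) (measurableSet_uIoc_graph hX)

theorem lintegral_zeroBias [SFinite P] {X : Ω → ℝ} (hX : Measurable X) {ψ : ℝ → ℝ≥0∞}
    (hψ : Measurable ψ) :
    ∫⁻ t, ψ t ∂(zeroBias P X) = ∫⁻ ω, ‖X ω‖ₑ * (∫⁻ t in uIoc 0 (X ω), ψ t) ∂P := by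
  have hm := measurable_zeroBias_aux hX
  rw [zeroBias, lintegral_withDensity_eq_lintegral_mul _ hm.lintegral_prod_right' hψ]
  simp only [Pi.mul_apply]
  have e1 : ∀ t, (∫⁻ ω, (uIoc 0 (X ω)).indicator (fun _ => ‖X ω‖ₑ) t ∂P) * ψ t
      = ∫⁻ ω, (uIoc 0 (X ω)).indicator (fun _ => ‖X ω‖ₑ) t * ψ t ∂P := fun t =>
    (lintegral_mul_const _ (hm.comp measurable_prodMk_left)).symm
  simp_rw [e1]
  rw [lintegral_lintegral_swap (hm.mul (hψ.comp measurable_fst)).aemeasurable]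
  refine lintegral_congr fun ω => ?_
  rw [← lintegral_const_mul _ hψ, ← lintegral_indicator measurableSet_uIoc]
  refine lintegral_congr fun t => ?_
  by_cases h : t ∈ uIoc 0 (X ω) <;> simp [h]

theorem isFiniteMeasure_zeroBias [SFinite P] {X : Ω → ℝ} (hX : Measurable X) (hX2 : MemLp X 2 P) :
    IsFiniteMeasure (zeroBias P X) := by
  constructor
  rw [← setLIntegral_one, Measure.restrict_univ, lintegral_zeroBias hX measurable_const]
  have h1 := hX2.integrable_sq.2
  refine lt_of_le_of_lt (lintegral_mono fun ω => ?_) h1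
  simp only [setLIntegral_one, uIoc, Real.volume_Ioc, max_sub_min_eq_abs, sub_zero]
  rw [enorm_pow, sq, ← Real.enorm_eq_ofReal_abs]

/-- The sign of `x` cancels the orientation of the integral. Thus `x ∫₀ˣ ψ ≥ 0` for `ψ ≥ 0`, which
is what makes the zero-bias measure positive. -/
theorem mul_integral_eq_abs_mul (x : ℝ) (ψ : ℝ → ℝ) :
    x * ∫ t in (0 : ℝ)..x, ψ t = |x| * ∫ t in uIoc 0 x, ψ t := by
  rcases le_total 0 x with h | h
  · rw [abs_of_nonneg h, uIoc_of_le h, intervalIntegral.integral_of_le h]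
  · rw [abs_of_nonpos h, uIoc_of_ge h, intervalIntegral.integral_of_ge h]; ring

theorem enorm_mul_lintegral_eq {x : ℝ} {ψ : ℝ → ℝ} (hψ : IntegrableOn ψ (uIoc 0 x))
    (h0 : ∀ t, 0 ≤ ψ t) :
    ‖x‖ₑ * ∫⁻ t in uIoc 0 x, ENNReal.ofReal (ψ t) = ENNReal.ofReal (x * ∫ t in (0 : ℝ)..x, ψ t) := by
  rw [mul_integral_eq_abs_mul, ENNReal.ofReal_mul (abs_nonneg _),
    ofReal_integral_eq_lintegral_ofReal hψ (Eventually.of_forall h0), Real.enorm_eq_ofReal_abs]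

theorem integrable_mul_integral [IsProbabilityMeasure P] {X : Ω → ℝ} (hX2 : MemLp X 2 P)
    {ψ : ℝ → ℝ} (hψ : Measurable ψ) {M : ℝ} (hM : ∀ t, |ψ t| ≤ M) :
    Integrable (fun ω => X ω * ∫ t in (0 : ℝ)..X ω, ψ t) P := by
  have hi : ∀ a b : ℝ, IntervalIntegrable ψ volume a b := fun a b =>
    (intervalIntegrable_const (c := M)).mono_fun hψ.aestronglyMeasurable
      (Eventually.of_forall fun t => by simpa using (hM t).trans (le_abs_self M))
  have hc : Continuous fun x : ℝ => ∫ t in (0 : ℝ)..x, ψ t :=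
    intervalIntegral.continuous_primitive hi 0
  refine (hX2.integrable_sq.const_mul M).mono'
    (hX2.aestronglyMeasurable.mul (hc.comp_aestronglyMeasurable hX2.aestronglyMeasurable)) ?_
  filter_upwards with ω
  have := intervalIntegral.norm_integral_le_of_norm_le_const (a := 0) (b := X ω) (f := ψ) (C := M)
    (fun t _ => hM t)
  rw [norm_mul, ← sq_abs]
  simp only [Real.norm_eq_abs, sub_zero] at this ⊢
  nlinarith [abs_nonneg (X ω)]

theorem integral_zeroBias [IsProbabilityMeasure P] {X : Ω → ℝ} (hX : Measurable X)
    (hX2 : MemLp X 2 P) {ψ : ℝ → ℝ} (hψ : Measurable ψ) {M : ℝ} (hM : ∀ t, |ψ t| ≤ M) :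
    ∫ t, ψ t ∂(zeroBias P X) = ∫ ω, X ω * (∫ t in (0 : ℝ)..X ω, ψ t) ∂P := by
  have := isFiniteMeasure_zeroBias hX hX2
  have hnn : ∀ {ψ : ℝ → ℝ} {M : ℝ}, Measurable ψ → (∀ t, |ψ t| ≤ M) → (∀ t, 0 ≤ ψ t) →
      ∫ t, ψ t ∂(zeroBias P X) = ∫ ω, X ω * (∫ t in (0 : ℝ)..X ω, ψ t) ∂P := by
    intro ψ M hψ hM h0
    have hi : ∀ x, IntegrableOn ψ (uIoc 0 x) := fun x =>
      ((intervalIntegrable_const (c := M)).mono_fun hψ.aestronglyMeasurable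
        (Eventually.of_forall fun t => by simpa using (hM t).trans (le_abs_self M))).def'
    have hpos : ∀ x, 0 ≤ x * ∫ t in (0 : ℝ)..x, ψ t := fun x => by
      rw [mul_integral_eq_abs_mul]
      exact mul_nonneg (abs_nonneg _) (integral_nonneg h0)
    rw [integral_eq_lintegral_of_nonneg_ae (Eventually.of_forall h0) hψ.aestronglyMeasurable,
      integral_eq_lintegral_of_nonneg_ae (Eventually.of_forall fun ω => hpos _)
        (integrable_mul_integral hX2 hψ hM).aestronglyMeasurable,
      lintegral_zeroBias hX hψ.ennreal_ofReal]
    congr 1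
    exact lintegral_congr fun ω => enorm_mul_lintegral_eq (hi _) h0
  have hbd : ∀ {ψ : ℝ → ℝ} {M : ℝ}, Measurable ψ → (∀ t, |ψ t| ≤ M) →
      Integrable ψ (zeroBias P X) := fun hψ hM =>
    (integrable_const _).mono' hψ.aestronglyMeasurable (Eventually.of_forall hM)
  have hM0 : 0 ≤ M := (abs_nonneg _).trans (hM 0)
  -- A bounded `ψ` is written as the difference of the nonnegative functions `ψ + M` and `M`.
  have h1 := hnn (ψ := fun t => ψ t + M) (M := 2 * M) (by fun_prop)
    (fun t => (abs_add_le _ _).trans (by rw [abs_of_nonneg hM0]; linarith [hM t]))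
    (fun t => by linarith [neg_le_of_abs_le (hM t)])
  have h2 := hnn (ψ := fun _ => M) (M := M) measurable_const (fun t => (abs_of_nonneg hM0).le)
    (fun t => hM0)
  rw [integral_add (hbd hψ hM) (integrable_const _), h2] at h1
  have e : ∀ ω, X ω * ∫ t in (0 : ℝ)..X ω, (ψ t + M)
      = X ω * (∫ t in (0 : ℝ)..X ω, ψ t) + X ω * ∫ t in (0 : ℝ)..X ω, M := by
    intro ω
    rw [intervalIntegral.integral_add, mul_add]
    · exact (intervalIntegrable_const (c := M)).mono_fun hψ.aestronglyMeasurable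
        (Eventually.of_forall fun t => by simpa using (hM t).trans (le_abs_self M))
    · exact intervalIntegrable_const
  simp_rw [e] at h1
  rw [integral_add (integrable_mul_integral hX2 hψ hM)
    (integrable_mul_integral hX2 measurable_const (fun t => (abs_of_nonneg hM0).le))] at h1
  linarith

end ZeroBias

/-! ### The law of `X` weighted by `g_X`, and Stein's identity for Lipschitz functions. -/

section

theorem temperate_sin : Real.sin.HasTemperateGrowth :=
  ⟨Real.contDiff_sin, fun n => ⟨0, 1, fun x => by
    rw [norm_iteratedFDeriv_eq_norm_iteratedDeriv]
    simpa using Real.abs_iteratedDeriv_sin_le_one n x⟩⟩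

theorem temperate_cos : Real.cos.HasTemperateGrowth :=
  ⟨Real.contDiff_cos, fun n => ⟨0, 1, fun x => by
    rw [norm_iteratedFDeriv_eq_norm_iteratedDeriv]
    simpa using Real.abs_iteratedDeriv_cos_le_one n x⟩⟩

/-- Boundedness of `ψ` makes the primitive grow at most linearly, so it is an admissible `φ` in
`integral_mul_comp`, with `φ' = ψ`. -/
theorem temperate_primitive {ψ : ℝ → ℝ} (hψ : ψ.HasTemperateGrowth) {M : ℝ}
    (hM : ∀ t, |ψ t| ≤ M) :
    (fun x : ℝ => ∫ t in (0 : ℝ)..x, ψ t).HasTemperateGrowth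
      ∧ ∀ x, deriv (fun x : ℝ => ∫ t in (0 : ℝ)..x, ψ t) x = ψ x := by
  have hd : ∀ x, HasDerivAt (fun x : ℝ => ∫ t in (0 : ℝ)..x, ψ t) (ψ x) x := fun x =>
    intervalIntegral.integral_hasDerivAt_right (hψ.1.continuous.intervalIntegrable _ _)
      hψ.1.continuous.stronglyMeasurable.stronglyMeasurableAtFilter hψ.1.continuous.continuousAt
  refine ⟨?_, fun x => (hd x).deriv⟩
  refine Function.HasTemperateGrowth.of_fderiv ?_ (fun x => (hd x).differentiableAt)
    (k := 1) (C := M) fun x => ?_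
  · have : fderiv ℝ (fun x : ℝ => ∫ t in (0 : ℝ)..x, ψ t)
        = fun x => ψ x • ContinuousLinearMap.toSpanSingleton ℝ (1 : ℝ) := by
      ext x
      rw [(hd x).hasFDerivAt.fderiv]
      simp
    rw [this]
    exact hψ.fun_smul (.const _)
  · have := intervalIntegral.norm_integral_le_of_norm_le_const (a := 0) (b := x) (f := ψ) (C := M)
      (fun t _ => hM t)
    have hM0 : 0 ≤ M := (abs_nonneg _).trans (hM 0)
    simp only [Real.norm_eq_abs, sub_zero, pow_one] at this ⊢
    nlinarith

variable {Ω H : Type*} [MeasurableSpace Ω] [NormedAddCommGroup H] [InnerProductSpace ℝ H]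
  {P : Measure Ω} {W : H → Ω → ℝ}

theorem integrable_gVar {X : Ω → ℝ} : Integrable (gVar P W X) P := integrable_condExp

/-- The random variable `⟨DF, -DL⁻¹F⟩`. -/
noncomputable def gammaVar (P : Measure Ω) (W : H → Ω → ℝ) (F : Ω → ℝ) (ω : Ω) : ℝ :=
  inner ℝ (malliavinD P W F ω) (-(malliavinD P W (ouInv P W F) ω))

variable [CompleteSpace H]

namespace IsIsonormal

theorem integrable_gammaVar (hW : IsIsonormal P W) {X : Ω → ℝ} (hX : MemD12 P W X)
    (hX0 : ∫ ω, X ω ∂P = 0) : Integrable (gammaVar P W X) P :=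
  integrable_inner_of_memLp (hasMalliavinDeriv_malliavinD hX).2.1
    (hW.integral_inner_malliavinD_ouInv hX hX0).1.neg

/-- The law of `X` under the signed measure with density `⟨DX, -DL⁻¹X⟩` is the zero-bias
measure. -/
theorem mapDensity_gammaVar (hW : IsIsonormal P W) {X : Ω → ℝ} (hXm : Measurable X)
    (hX : MemD12 P W X) (hX0 : ∫ ω, X ω ∂P = 0) :
    mapDensity P X (gammaVar P W X)
      = (mapDensity P X fun ω => -gammaVar P W X ω) + zeroBias P X := by
  have := hW.gaussian.isProbabilityMeasure
  have hX2 : MemLp X 2 P := (hasMalliavinDeriv_malliavinD hX).1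
  have hY := hW.integrable_gammaVar hX hX0
  set Y := gammaVar P W X with hYdef
  have := isFiniteMeasure_mapDensity X hY
  have := isFiniteMeasure_mapDensity X hY.neg
  have : IsFiniteMeasure (mapDensity P X fun ω => -Y ω) := isFiniteMeasure_mapDensity X hY.neg
  have := isFiniteMeasure_zeroBias hXm hX2
  have key : ∀ {ψ : ℝ → ℝ}, ψ.HasTemperateGrowth → (∀ t, |ψ t| ≤ 1) →
      ∫ x, ψ x ∂(mapDensity P X Y)
        = ∫ x, ψ x ∂((mapDensity P X fun ω => -Y ω) + zeroBias P X) := by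
    intro ψ hψ hM
    have hψm : Measurable ψ := hψ.1.continuous.measurable
    have hbd : ∀ μ : Measure ℝ, IsFiniteMeasure μ → Integrable ψ μ := fun μ _ =>
      (integrable_const (1 : ℝ)).mono' hψm.aestronglyMeasurable (Eventually.of_forall hM)
    rw [integral_add_measure (hbd _ inferInstance) (hbd _ inferInstance), ← sub_eq_iff_eq_add',
      integral_mapDensity_sub hXm.aemeasurable hY.aemeasurable hψm.stronglyMeasurable,
      integral_zeroBias hXm hX2 hψm hM]
    · obtain ⟨t1, t2⟩ := temperate_primitive hψ hM
      have := hW.integral_mul_comp hX hX0 t1 (M := 1) (fun x => by rw [t2]; exact hM x)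
      simp only [t2] at this
      exact this.symm
    · refine hY.norm.mono' (hY.aestronglyMeasurable.smul
        (hψm.comp hXm).aestronglyMeasurable) ?_
      filter_upwards with ω
      rw [norm_smul]
      exact mul_le_of_le_one_right (norm_nonneg _) (hM _)
  -- Cosine and sine are bounded temperate functions, so smooth test functions already determine the
  -- measures through their characteristic functions.
  refine Measure.ext_of_charFun ?_
  ext t
  have hsplit : ∀ μ : Measure ℝ, IsFiniteMeasure μ → charFun μ t
      = ((∫ x, Real.cos (t * x) ∂μ : ℝ) : ℂ) + ((∫ x, Real.sin (t * x) ∂μ : ℝ) : ℂ)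
        * Complex.I := by
    intro μ _
    have i1 : Integrable (fun x => Real.cos (t * x)) μ := (integrable_const (1 : ℝ)).mono'
      (by fun_prop) (Eventually.of_forall fun x => Real.abs_cos_le_one _)
    have i2 : Integrable (fun x => Real.sin (t * x)) μ := (integrable_const (1 : ℝ)).mono'
      (by fun_prop) (Eventually.of_forall fun x => Real.abs_sin_le_one _)
    rw [charFun_apply_real, ← integral_complex_ofReal, ← integral_complex_ofReal,
      ← integral_mul_const, ← integral_add i1.ofReal (i2.ofReal.mul_const _)]
    congr 1; ext x
    rw [Complex.exp_mul_I]; push_cast; rfl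
  have tl : (fun x : ℝ => t * x).HasTemperateGrowth := by fun_prop
  have k1 := key (temperate_cos.comp tl) (fun x => Real.abs_cos_le_one _)
  have k2 := key (temperate_sin.comp tl) (fun x => Real.abs_sin_le_one _)
  simp only [Function.comp_apply] at k1 k2
  rw [hsplit _ inferInstance, hsplit _ inferInstance, k1, k2]

/-- `E[ψ(X) ⟨DX, -DL⁻¹X⟩] = ∫ ψ dλ` for bounded `ψ`, `λ` the zero-bias measure. -/
theorem integral_gammaVar_mul (hW : IsIsonormal P W) {X : Ω → ℝ} (hXm : Measurable X)
    (hX : MemD12 P W X) (hX0 : ∫ ω, X ω ∂P = 0) {ψ : ℝ → ℝ} (hψ : Measurable ψ) {M : ℝ}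
    (hM : ∀ t, |ψ t| ≤ M) :
    ∫ ω, gammaVar P W X ω * ψ (X ω) ∂P = ∫ t, ψ t ∂(zeroBias P X) := by
  have := hW.gaussian.isProbabilityMeasure
  have hX2 : MemLp X 2 P := (hasMalliavinDeriv_malliavinD hX).1
  have hY := hW.integrable_gammaVar hX hX0
  have : IsFiniteMeasure (mapDensity P X fun ω => -gammaVar P W X ω) :=
    isFiniteMeasure_mapDensity X hY.neg
  have := isFiniteMeasure_zeroBias hXm hX2
  have hbd : ∀ μ : Measure ℝ, IsFiniteMeasure μ → Integrable ψ μ := fun μ _ =>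
    (integrable_const M).mono' hψ.aestronglyMeasurable (Eventually.of_forall hM)
  have hi : Integrable (fun ω => gammaVar P W X ω • ψ (X ω)) P :=
    hY.mul_bdd (c := M) (hψ.comp hXm).aestronglyMeasurable (Eventually.of_forall fun ω => hM _)
  have := integral_mapDensity_sub hXm.aemeasurable hY.aemeasurable hψ.stronglyMeasurable hi
  rw [hW.mapDensity_gammaVar hXm hX hX0, integral_add_measure (hbd _ inferInstance)
    (hbd _ inferInstance), add_sub_cancel_left] at this
  exact this.symm

/-- `E[ψ(X) g_X] = ∫ ψ dλ` on level sets. -/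
theorem setIntegral_gVar (hW : IsIsonormal P W) {X : Ω → ℝ} (hXm : Measurable X)
    (hX : MemD12 P W X) (hX0 : ∫ ω, X ω ∂P = 0) {A : Set ℝ} (hA : MeasurableSet A) :
    ∫ ω in X ⁻¹' A, gVar P W X ω ∂P = (zeroBias P X).real A := by
  have := hW.gaussian.isProbabilityMeasure
  have h1 := hW.integral_gammaVar_mul hXm hX hX0 (ψ := A.indicator 1) (M := 1)
    (measurable_one.indicator hA) (fun t => by
      by_cases h : t ∈ A <;> simp [h])
  rw [integral_indicator_one hA] at h1
  rw [← h1]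
  have h2 := setIntegral_condExp hXm.comap_le (hW.integrable_gammaVar hX hX0)
    (s := X ⁻¹' A) ⟨A, hA, rfl⟩
  refine Eq.trans h2 ?_
  rw [← integral_indicator (hXm hA)]
  congr 1; ext ω
  by_cases h : X ω ∈ A <;> simp [h, gammaVar]

/-- The event `g_X < 0` has the form `X ∈ A`, and over it `g_X` integrates to the zero-bias mass of
`A`, which is nonnegative. Hence the event is null. -/
theorem gVar_nonneg (hW : IsIsonormal P W) {X : Ω → ℝ} (hXm : Measurable X)
    (hX : MemD12 P W X) (hX0 : ∫ ω, X ω ∂P = 0) : 0 ≤ᵐ[P] gVar P W X := by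
  have hsm : StronglyMeasurable[MeasurableSpace.comap X inferInstance] (gVar P W X) :=
    stronglyMeasurable_condExp
  obtain ⟨γ, hγ, hγX⟩ := hsm.measurable.exists_eq_measurable_comp
  have h1 := hW.setIntegral_gVar hXm hX hX0 (measurableSet_lt hγ (measurable_const (a := (0 : ℝ))))
  have h2 : ∀ ω ∈ X ⁻¹' {x | γ x < 0}, gVar P W X ω ≤ 0 := by
    intro ω hω
    rw [hγX]; exact le_of_lt hω
  have hms : MeasurableSet (X ⁻¹' {x | γ x < 0}) :=
    hXm (measurableSet_lt hγ measurable_const)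
  have h3 : ∫ ω in X ⁻¹' {x | γ x < 0}, -gVar P W X ω ∂P = 0 := by
    rw [integral_neg, neg_eq_zero]
    refine le_antisymm (setIntegral_nonpos hms h2) ?_
    rw [h1]; exact measureReal_nonneg
  rw [setIntegral_eq_zero_iff_of_nonneg_ae] at h3
  · rw [EventuallyEq, ae_restrict_iff' hms] at h3
    filter_upwards [h3] with ω hω
    by_contra hneg
    have hmem : ω ∈ X ⁻¹' {x | γ x < 0} := by
      have : gVar P W X ω < 0 := not_le.1 hneg
      rw [hγX] at this; exact this
    have := hω hmem
    simp only [Pi.zero_apply, neg_eq_zero] at this hneg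
    exact hneg this.ge
  · rw [EventuallyLE, ae_restrict_iff' hms]
    exact Eventually.of_forall fun ω hω => by simpa using h2 ω hω
  · exact integrable_gVar.neg.integrableOn

/-- The law of `X` under the measure with density `g_X` is the zero-bias measure. -/
theorem mapDensity_gVar (hW : IsIsonormal P W) {X : Ω → ℝ} (hXm : Measurable X)
    (hX : MemD12 P W X) (hX0 : ∫ ω, X ω ∂P = 0) : mapDensity P X (gVar P W X) = zeroBias P X := by
  have := hW.gaussian.isProbabilityMeasure
  have := isFiniteMeasure_zeroBias hXm (hasMalliavinDeriv_malliavinD hX).1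
  ext A hA
  rw [mapDensity, Measure.map_apply hXm hA, withDensity_apply _ (hXm hA),
    ← ofReal_integral_eq_lintegral_ofReal integrable_gVar.integrableOn
      (ae_restrict_of_ae (hW.gVar_nonneg hXm hX hX0)), hW.setIntegral_gVar hXm hX hX0 hA,
    ofReal_measureReal]

/-- `E[ψ(X) g_X] = E[X ∫₀^X ψ]` for measurable `ψ ≥ 0`, as an identity in `[0, ∞]`. -/
theorem lintegral_mul_gVar (hW : IsIsonormal P W) {X : Ω → ℝ} (hXm : Measurable X)
    (hX : MemD12 P W X) (hX0 : ∫ ω, X ω ∂P = 0) {ψ : ℝ → ℝ≥0∞} (hψ : Measurable ψ) :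
    ∫⁻ ω, ENNReal.ofReal (gVar P W X ω) * ψ (X ω) ∂P
      = ∫⁻ ω, ‖X ω‖ₑ * (∫⁻ t in uIoc 0 (X ω), ψ t) ∂P := by
  have := hW.gaussian.isProbabilityMeasure
  rw [← lintegral_zeroBias hXm hψ, ← hW.mapDensity_gVar hXm hX hX0, mapDensity,
    lintegral_map hψ hXm]
  exact (lintegral_withDensity_eq_lintegral_mul₀ integrable_gVar.aemeasurable.ennreal_ofReal
    (hψ.comp hXm).aemeasurable).symm

/-- Stein's identity `E[X f(X)] = E[f'(X) g_X]` for Lipschitz `f`. -/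
theorem integral_mul_lipschitz (hW : IsIsonormal P W) {X : Ω → ℝ} (hXm : Measurable X)
    (hX : MemD12 P W X) (hX0 : ∫ ω, X ω ∂P = 0) {f : ℝ → ℝ} {K : ℝ≥0} (hf : LipschitzWith K f) :
    Integrable (fun ω => X ω * f (X ω)) P ∧ Integrable (fun ω => gVar P W X ω * deriv f (X ω)) P ∧
    ∫ ω, X ω * f (X ω) ∂P = ∫ ω, gVar P W X ω * deriv f (X ω) ∂P := by
  have := hW.gaussian.isProbabilityMeasure
  have hX2 : MemLp X 2 P := (hasMalliavinDeriv_malliavinD hX).1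
  have hM : ∀ t, |deriv f t| ≤ K := fun t => norm_deriv_le_of_lipschitz hf
  have hdm := measurable_deriv f
  -- A Lipschitz function is absolutely continuous. The zero-bias formula sees `deriv f` only
  -- through these integrals, so its default value at points of non-differentiability is harmless
  -- even if the law of `X` has atoms.
  have hint : ∀ x, ∫ t in (0 : ℝ)..x, deriv f t = f x - f 0 := fun x =>
    (hf.lipschitzOnWith.absolutelyContinuousOnInterval).integral_deriv_eq_sub
  have i1 := integrable_mul_integral hX2 hdm hM
  simp only [hint] at i1
  have i2 : Integrable (fun ω => X ω * f 0) P := (hX2.integrable (by norm_num)).mul_const _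
  have e : ∀ ω, X ω * f (X ω) = X ω * (f (X ω) - f 0) + X ω * f 0 := fun ω => by ring
  have i3 : Integrable (fun ω => gVar P W X ω * deriv f (X ω)) P :=
    integrable_gVar.mul_bdd (c := K) (hdm.comp hXm).aestronglyMeasurable
      (Eventually.of_forall fun ω => hM _)
  refine ⟨by simp_rw [e]; exact i1.add i2, i3, ?_⟩
  have h1 := integral_zeroBias hXm hX2 hdm hM
  simp only [hint] at h1
  simp_rw [e]
  rw [integral_add i1 i2, integral_mul_const, hX0, zero_mul, add_zero, ← h1,
    ← hW.mapDensity_gVar hXm hX hX0, integral_mapDensity hXm.aemeasurable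
      integrable_gVar.aemeasurable hdm.stronglyMeasurable]
  refine integral_congr_ae ?_
  filter_upwards [hW.gVar_nonneg hXm hX hX0] with ω hω
  rw [max_eq_left (show 0 ≤ gVar P W X ω from hω), smul_eq_mul]

end IsIsonormal

end

end WienerNP

/-! ### Filters at the ends of the support and the tail estimate. -/

namespace WienerNP

/-- A real threshold replaces the extended-real filter, so finite and infinite ends are treated
together. -/
theorem eventually_toRightEnd_iff {u : EReal} (hu : ⊥ < u) {p : ℝ → Prop} :
    (∀ᶠ x in toRightEnd u, p x) ↔ ∃ c : ℝ, (c : EReal) < u ∧ ∀ x : ℝ, c < x → (x : EReal) < u → p x := by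
  rw [toRightEnd, eventually_comap, eventually_iff, mem_nhdsLT_iff_exists_Ioo_subset' hu]
  constructor
  · rintro ⟨a, ha, h⟩
    obtain ⟨c, hc1, hc2⟩ := EReal.lt_iff_exists_real_btwn.1 ha
    exact ⟨c, hc2, fun x hx hxu => h ⟨hc1.trans (by exact_mod_cast hx), hxu⟩ x rfl⟩
  · rintro ⟨c, hc, h⟩
    refine ⟨c, hc, ?_⟩
    rintro y ⟨hy1, hy2⟩ x rfl
    exact h x (by exact_mod_cast hy1) hy2

theorem toRightEnd_neBot {u : EReal} (hu : ⊥ < u) : (toRightEnd u).NeBot := by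
  rw [← frequently_true_iff_neBot]
  intro h
  obtain ⟨c, hc, h⟩ := (eventually_toRightEnd_iff hu).1 h
  obtain ⟨x, hx1, hx2⟩ := EReal.lt_iff_exists_real_btwn.1 hc
  exact h x (by exact_mod_cast hx1) hx2 trivial

theorem tendsto_neg_toRightEnd (l : EReal) :
    Tendsto (fun x : ℝ => -x) (toRightEnd (-l)) (toLeftEnd l) := by
  rw [toLeftEnd, tendsto_comap_iff]
  have h1 : Tendsto (fun x : ℝ => (x : EReal)) (toRightEnd (-l)) (𝓝[<] (-l)) := tendsto_comap
  have h2 : Tendsto (fun y : EReal => -y) (𝓝[<] (-l)) (𝓝[>] l) := by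
    have := continuous_neg.continuousWithinAt.tendsto_nhdsWithin (f := fun y : EReal => -y)
      (s := Iio (-l)) (x := -l) (t := Ioi l) (fun y hy => by
        have : y < -l := hy
        exact EReal.lt_neg_comm.1 this)
    simpa using this
  have := h2.comp h1
  refine this.congr fun x => by simp

theorem isOpen_openInt (l u : EReal) : IsOpen (openInt l u) :=
  (isOpen_Ioi.preimage continuous_coe_real_ereal).inter
    (isOpen_Iio.preimage continuous_coe_real_ereal)

theorem ordConnected_openInt (l u : EReal) : (openInt l u).OrdConnected := by
  constructor
  rintro x hx y hy z ⟨hz1, hz2⟩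
  exact ⟨hx.1.trans_le (by exact_mod_cast hz1), lt_of_le_of_lt (by exact_mod_cast hz2) hy.2⟩

theorem convex_openInt (l u : EReal) : Convex ℝ (openInt l u) := (ordConnected_openInt l u).convex

/-- The tail estimate at the right end of the support. -/
theorem exists_mul_tail_le {u : EReal} (hu : 0 < u) {p B T g gt : ℝ → ℝ}
    (hp : ∀ᶠ x in toRightEnd u, 0 < p x ∧ HasDerivAt p (-(x * p x / g x)) x)
    (hB : ∀ᶠ x in toRightEnd u, B x ≤ p x ∧ HasDerivAt B (-T x) x)
    (hT : ∀ᶠ x in toRightEnd u, x * T x ≤ p x)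
    (hB0 : Tendsto B (toRightEnd u) (𝓝 0))
    (hgt : ∀ᶠ x in toRightEnd u, 0 < gt x ∧ DifferentiableAt ℝ gt x)
    {c C : ℝ} (hc : 0 < c) (hcg : ∀ᶠ x in toRightEnd u, c ≤ g x / gt x ∧ g x / gt x ≤ C)
    {b : EReal} (hb : Tendsto (fun x => ((deriv gt x : ℝ) : EReal)) (toRightEnd u) (𝓝 b)) :
    ∃ K : ℝ, 0 ≤ K ∧ ∀ᶠ x in toRightEnd u, x * B x ≤ K * (p x * g x) := by
  have hu' : ⊥ < u := lt_trans EReal.bot_lt_zero hu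
  have := toRightEnd_neBot hu'
  obtain ⟨x₀, hx₀, hx₀u⟩ := EReal.lt_iff_exists_real_btwn.1 hu
  have hx₀' : 0 < x₀ := by exact_mod_cast hx₀
  have hx : ∀ᶠ x in toRightEnd u, x₀ < x :=
    (eventually_toRightEnd_iff hu').2 ⟨x₀, hx₀u, fun x hx _ => hx⟩
  have hC : 0 < C := by
    obtain ⟨x, hx⟩ := hcg.exists
    linarith
  -- If `b ≤ 0`, the slope of `gt` is eventually below any positive number and a monotone auxiliary
  -- function works. If `b > 0`, then `g` dominates a multiple of `x` and the crude bound `B ≤ p` is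
  -- enough.
  rcases le_or_gt b 0 with hb0 | hb0
  -- With this `δ`, `gt'/x ≤ 1/(2C)` uses up only half of the lower bound `gt/g ≥ 1/C`.
  · set δ : ℝ := x₀ / (2 * C) with hδ
    have hδ0 : 0 < δ := by positivity
    have hd : ∀ᶠ x in toRightEnd u, deriv gt x < δ := by
      have : b < (δ : EReal) := lt_of_le_of_lt hb0 (by exact_mod_cast hδ0)
      filter_upwards [hb.eventually_lt_const this] with x hx
      exact_mod_cast hx
    obtain ⟨d, hdu, hall⟩ := (eventually_toRightEnd_iff hu').1
      (((((hp.and hB).and hT).and hgt).and (hcg.and hd)).and hx)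
    -- This `E` makes the remaining `-1/(2C)` contribute `-p/x₀` to `Φ'`, which absorbs the term `T
    -- ≤ p/x ≤ p/x₀`.
    set E : ℝ := 2 * C / x₀ with hE
    have hE0 : 0 < E := by positivity
    set Φ : ℝ → ℝ := fun x => E * (p x * gt x / x) - B x with hΦ
    have hmemd : ∀ x ∈ openInt d u, d < x ∧ (x : EReal) < u := fun x hx =>
      ⟨by exact_mod_cast hx.1, hx.2⟩
    have hΦd : ∀ x ∈ openInt d u, ∃ D, HasDerivAt Φ D x ∧ D ≤ 0 := by
      intro x hx
      obtain ⟨⟨⟨⟨⟨⟨p0, pd⟩, ⟨-, Bd⟩⟩, hT⟩, ⟨g0, gd⟩⟩, ⟨⟨r1, r2⟩, gδ⟩⟩, hxx⟩ :=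
        hall x (hmemd x hx).1 (hmemd x hx).2
      have x0 : 0 < x := hx₀'.trans hxx
      have gpos : 0 < g x := by
        rw [le_div_iff₀ g0] at r1
        exact lt_of_lt_of_le (by positivity) r1
      refine ⟨_, (((pd.mul gd.hasDerivAt).div (hasDerivAt_id x) x0.ne').const_mul E).sub Bd, ?_⟩
      simp only [id, Pi.mul_apply, mul_one]
      have e : E * (((-(x * p x / g x) * gt x + p x * deriv gt x) * x - p x * gt x) / x ^ 2) - -T x
          = E * (p x * (deriv gt x / x - gt x / g x) - p x * gt x / x ^ 2) + T x := by
        field_simp; ring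
      rw [e]
      have h1 : 1 / C ≤ gt x / g x := by
        rw [div_le_div_iff₀ hC gpos]
        rw [div_le_iff₀ g0] at r2
        linarith
      have h2 : deriv gt x / x ≤ 1 / (2 * C) := by
        rw [div_le_iff₀ x0]
        have : δ ≤ 1 / (2 * C) * x := by
          rw [hδ, div_mul_eq_mul_div, one_mul]
          gcongr
        linarith
      have h3 : deriv gt x / x - gt x / g x ≤ -(1 / (2 * C)) := by
        have : 1 / C = 1 / (2 * C) + 1 / (2 * C) := by field_simp; norm_num
        linarith
      have h4 : p x * (deriv gt x / x - gt x / g x) ≤ p x * (-(1 / (2 * C))) :=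
        mul_le_mul_of_nonneg_left h3 p0.le
      have h5 : 0 ≤ p x * gt x / x ^ 2 := by positivity
      have h6 : E * (p x * (deriv gt x / x - gt x / g x) - p x * gt x / x ^ 2)
          ≤ E * (p x * (-(1 / (2 * C)))) := mul_le_mul_of_nonneg_left (by linarith) hE0.le
      have h7 : E * (p x * (-(1 / (2 * C)))) = -(p x / x₀) := by
        rw [hE]; field_simp
      have h8 : T x ≤ p x / x₀ := by
        have : T x ≤ p x / x := by rw [le_div_iff₀ x0]; linarith
        exact this.trans (div_le_div_of_nonneg_left p0.le hx₀' hxx.le)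
      linarith
    have hanti : AntitoneOn Φ (openInt d u) := by
      have hopen := isOpen_openInt (d : EReal) u
      refine antitoneOn_of_deriv_nonpos (convex_openInt _ _) (fun x hx => ?_) (fun x hx => ?_)
        (fun x hx => ?_)
      · obtain ⟨D, hD, -⟩ := hΦd x hx
        exact hD.continuousAt.continuousWithinAt
      · rw [hopen.interior_eq] at hx
        obtain ⟨D, hD, -⟩ := hΦd x hx
        exact hD.differentiableAt.differentiableWithinAt
      · rw [hopen.interior_eq] at hx
        obtain ⟨D, hD, hD0⟩ := hΦd x hx
        rw [hD.deriv]; exact hD0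
    refine ⟨E / c, by positivity, (eventually_toRightEnd_iff hu').2 ⟨d, hdu, fun x hdx hxu => ?_⟩⟩
    -- `Φ` is nonincreasing and bounded below by `-B`, which tends to `0` at the end, so `Φ ≥ 0`.
    have hΦ0 : 0 ≤ Φ x := by
      have ht : Tendsto (fun y => -B y) (toRightEnd u) (𝓝 0) := by simpa using hB0.neg
      refine le_of_tendsto ht ?_
      refine (eventually_toRightEnd_iff hu').2 ⟨x, hxu, fun y hxy hyu => ?_⟩
      have h1 := hanti (a := x) ⟨by exact_mod_cast hdx, hxu⟩ (b := y)
        ⟨by exact_mod_cast hdx.trans hxy, hyu⟩ hxy.le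
      obtain ⟨⟨⟨⟨⟨⟨p0, -⟩, -⟩, -⟩, ⟨g0, -⟩⟩, -⟩, hxx⟩ := hall y (hdx.trans hxy) hyu
      have y0 : 0 < y := hx₀'.trans hxx
      refine le_trans ?_ h1
      have : 0 ≤ E * (p y * gt y / y) := by positivity
      simp only [hΦ]; linarith
    obtain ⟨⟨⟨⟨⟨⟨p0, -⟩, -⟩, -⟩, ⟨g0, -⟩⟩, ⟨⟨r1, -⟩, -⟩⟩, hxx⟩ := hall x hdx hxu
    have x0 : 0 < x := hx₀'.trans hxx
    have h1 : x * B x ≤ E * (p x * gt x) := by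
      have h2 : B x ≤ E * (p x * gt x) / x := by
        have : 0 ≤ E * (p x * gt x / x) - B x := hΦ0
        rw [← mul_div_assoc] at this
        linarith
      rw [le_div_iff₀ x0] at h2
      linarith
    rw [le_div_iff₀ g0] at r1
    calc x * B x ≤ E * (p x * gt x) := h1
      _ = E / c * (p x * (c * gt x)) := by field_simp
      _ ≤ E / c * (p x * g x) := by gcongr
  · obtain ⟨ε, hε0, hεb⟩ := EReal.lt_iff_exists_real_btwn.1 hb0
    have hε : 0 < ε := by exact_mod_cast hε0
    have hd : ∀ᶠ x in toRightEnd u, ε < deriv gt x := by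
      filter_upwards [hb.eventually_const_lt hεb] with x hx
      exact_mod_cast hx
    obtain ⟨d, hdu, hall⟩ := (eventually_toRightEnd_iff hu').1
      ((((hp.and hB).and hgt).and (hcg.and hd)).and hx)
    obtain ⟨e, hde, heu⟩ := EReal.lt_iff_exists_real_btwn.1 hdu
    have hde' : d < e := by exact_mod_cast hde
    obtain ⟨⟨⟨-, ⟨ge0, -⟩⟩, -⟩, hxe⟩ := hall e hde' heu
    have e0 : 0 < e := hx₀'.trans hxe
    -- Chosen so that `α x ≤ gt x` holds at `x = e` and is preserved beyond `e`, where `gt' ≥ ε ≥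
    -- α`.
    set α := min (gt e / e) ε with hα
    have hα0 : 0 < α := lt_min (by positivity) hε
    refine ⟨1 / (c * α), by positivity,
      (eventually_toRightEnd_iff hu').2 ⟨e, heu, fun x hex hxu => ?_⟩⟩
    obtain ⟨⟨⟨⟨⟨p0, -⟩, ⟨Bp, -⟩⟩, ⟨g0, -⟩⟩, ⟨⟨r1, -⟩, -⟩⟩, hxx⟩ := hall x (hde'.trans hex) hxu
    have x0 : 0 < x := hx₀'.trans hxx
    have hmem : ∀ y ∈ Icc e x, d < y ∧ (y : EReal) < u := fun y hy =>
      ⟨hde'.trans_le hy.1, lt_of_le_of_lt (by exact_mod_cast hy.2) hxu⟩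
    have hgr : ε * (x - e) ≤ gt x - gt e := by
      refine (convex_Icc e x).mul_sub_le_image_sub_of_le_deriv (fun y hy => ?_) (fun y hy => ?_)
        (fun y hy => ?_) e ⟨le_rfl, hex.le⟩ x ⟨hex.le, le_rfl⟩ hex.le
      · exact (hall y (hmem y hy).1 (hmem y hy).2).1.1.2.2.continuousAt.continuousWithinAt
      · have hy' := interior_subset hy
        exact (hall y (hmem y hy').1 (hmem y hy').2).1.1.2.2.differentiableWithinAt
      · have hy' := interior_subset hy
        exact (hall y (hmem y hy').1 (hmem y hy').2).1.2.2.le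
    have hlow : α * x ≤ gt x := by
      have h1 : α * e ≤ gt e := by
        have : α ≤ gt e / e := min_le_left _ _
        rwa [le_div_iff₀ e0] at this
      have h2 : α * (x - e) ≤ ε * (x - e) :=
        mul_le_mul_of_nonneg_right (min_le_right _ _) (by linarith)
      linarith
    rw [le_div_iff₀ g0] at r1
    have h3 : c * (α * x) ≤ g x := (mul_le_mul_of_nonneg_left hlow hc.le).trans r1
    calc x * B x ≤ x * p x := by gcongr
      _ = 1 / (c * α) * (p x * (c * (α * x))) := by field_simp
      _ ≤ 1 / (c * α) * (p x * g x) := by gcongr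

end WienerNP

/-! ### Centered densities, tail functionals and reflection. -/

namespace WienerNP

/-- `ρ` is a centered probability density, continuous and positive exactly on `(l, u)`. -/
structure CenteredDensity (l u : EReal) (ρ : ℝ → ℝ) : Prop where
  left_neg : l < 0
  right_pos : 0 < u
  pos : ∀ x ∈ openInt l u, 0 < ρ x
  zero : ∀ x ∉ openInt l u, ρ x = 0
  cont : ContinuousOn ρ (openInt l u)
  integrable : Integrable ρ
  integrable_mul : Integrable fun y => y * ρ y
  integral_eq : ∫ y, ρ y = 1
  mean_eq : ∫ y, y * ρ y = 0

/-- The mass `∫_x^∞ ρ`. -/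
noncomputable def tailMass (ρ : ℝ → ℝ) (x : ℝ) : ℝ := ∫ y in Ioi x, ρ y

/-- The partial mean `∫_x^∞ y ρ(y) dy`. -/
noncomputable def tailMean (ρ : ℝ → ℝ) (x : ℝ) : ℝ := ∫ y in Ioi x, y * ρ y

/-- The mean excess `∫_x^∞ (y - x) ρ(y) dy`. -/
noncomputable def tailExcess (ρ : ℝ → ℝ) (x : ℝ) : ℝ := tailMean ρ x - x * tailMass ρ x

theorem hasDerivAt_integral_Ioi {k : ℝ → ℝ} (hk : Integrable k) {x : ℝ} (hx : ContinuousAt k x) :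
    HasDerivAt (fun x => ∫ y in Ioi x, k y) (-(k x)) x := by
  have h1 : ∀ z, ∫ y in Ioi z, k y = (∫ y in Ioi 0, k y) - ∫ y in (0:ℝ)..z, k y := fun z => by
    rw [← intervalIntegral.integral_interval_add_Ioi hk.integrableOn hk.integrableOn (a := 0)
      (b := z)]
    ring
  have h2 : HasDerivAt (fun z => ∫ y in (0:ℝ)..z, k y) (k x) x :=
    intervalIntegral.integral_hasDerivAt_right hk.intervalIntegrable
      hk.aestronglyMeasurable.stronglyMeasurableAtFilter hx
  have := h2.const_sub (∫ y in Ioi 0, k y)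
  simpa only [← h1] using this

theorem integral_Ioi_neg_comp (k : ℝ → ℝ) (hk : Integrable k) (x : ℝ) :
    ∫ y in Ioi (-x), k (-y) = (∫ y, k y) - ∫ y in Ioi x, k y := by
  rw [integral_comp_neg_Ioi, neg_neg, ← integral_add_compl measurableSet_Iic hk (s := Iic x),
    compl_Iic]
  ring

namespace CenteredDensity

variable {l u : EReal} {ρ : ℝ → ℝ}

theorem nonneg (hρ : CenteredDensity l u ρ) (x : ℝ) : 0 ≤ ρ x := by
  by_cases hx : x ∈ openInt l u
  · exact (hρ.pos x hx).le
  · exact (hρ.zero x hx).ge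

theorem continuousAt (hρ : CenteredDensity l u ρ) {x : ℝ} (hx : x ∈ openInt l u) :
    ContinuousAt ρ x :=
  hρ.cont.continuousAt ((isOpen_openInt l u).mem_nhds hx)

theorem zero_mem (hρ : CenteredDensity l u ρ) : (0 : ℝ) ∈ openInt l u :=
  ⟨hρ.left_neg, hρ.right_pos⟩

theorem mem_neg_iff {x : ℝ} : x ∈ openInt (-u) (-l) ↔ -x ∈ openInt l u := by
  simp only [openInt, mem_ofPred_eq, EReal.coe_neg]
  rw [EReal.neg_lt_comm, EReal.lt_neg_comm]
  exact and_comm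

/-- Passing to the density of `-Z` reduces statements about the left end to statements about the
right end. -/
theorem reflect (hρ : CenteredDensity l u ρ) :
    CenteredDensity (-u) (-l) (fun x => ρ (-x)) where
  left_neg := by simpa using EReal.neg_lt_neg_iff.2 hρ.right_pos
  right_pos := by simpa using EReal.neg_lt_neg_iff.2 hρ.left_neg
  pos x hx := hρ.pos _ (mem_neg_iff.1 hx)
  zero x hx := hρ.zero _ fun h => hx (mem_neg_iff.2 h)
  cont := hρ.cont.comp continuous_neg.continuousOn fun x hx => mem_neg_iff.1 hx
  integrable := hρ.integrable.comp_neg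
  integrable_mul := by
    have := hρ.integrable_mul.comp_neg.neg
    refine this.congr (ae_of_all _ fun x => by simp)
  integral_eq := by rw [integral_neg_eq_self ρ volume]; exact hρ.integral_eq
  mean_eq := by
    have := integral_neg_eq_self (fun y => y * ρ y) volume
    rw [hρ.mean_eq] at this
    simp only [neg_mul, integral_neg] at this
    linarith

theorem tailMass_reflect (hρ : CenteredDensity l u ρ) (x : ℝ) :
    tailMass (fun y => ρ (-y)) (-x) = 1 - tailMass ρ x := by
  rw [tailMass, integral_Ioi_neg_comp _ hρ.integrable, hρ.integral_eq, tailMass]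

theorem tailMean_reflect (hρ : CenteredDensity l u ρ) (x : ℝ) :
    tailMean (fun y => ρ (-y)) (-x) = tailMean ρ x := by
  have := integral_Ioi_neg_comp _ hρ.integrable_mul x
  rw [hρ.mean_eq] at this
  simp only [neg_mul, integral_neg, zero_sub, neg_inj] at this
  exact this

/-- Identifies `tailExcess ρ x + x` as the left-hand excess `∫_{-∞}^x (x - y) ρ(y) dy`, the partner
of `tailExcess` in all estimates below. -/
theorem tailExcess_reflect (hρ : CenteredDensity l u ρ) (x : ℝ) :
    tailExcess (fun y => ρ (-y)) (-x) = tailExcess ρ x + x := by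
  rw [tailExcess, hρ.tailMass_reflect, hρ.tailMean_reflect, tailExcess]
  ring

theorem tailExcess_eq (hρ : CenteredDensity l u ρ) (x : ℝ) :
    tailExcess ρ x = ∫ y in Ioi x, (y - x) * ρ y := by
  simp only [sub_mul]
  rw [integral_sub hρ.integrable_mul.integrableOn (hρ.integrable.const_mul x).integrableOn,
    integral_const_mul]
  rfl

theorem tailExcess_nonneg (hρ : CenteredDensity l u ρ) (x : ℝ) : 0 ≤ tailExcess ρ x := by
  rw [hρ.tailExcess_eq]
  refine setIntegral_nonneg measurableSet_Ioi fun y hy => ?_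
  exact mul_nonneg (sub_nonneg.2 (le_of_lt hy)) (hρ.nonneg y)

theorem tailExcess_add_nonneg (hρ : CenteredDensity l u ρ) (x : ℝ) : 0 ≤ tailExcess ρ x + x := by
  rw [← hρ.tailExcess_reflect]
  exact hρ.reflect.tailExcess_nonneg _

theorem tailMass_nonneg (hρ : CenteredDensity l u ρ) (x : ℝ) : 0 ≤ tailMass ρ x :=
  setIntegral_nonneg measurableSet_Ioi fun y _ => hρ.nonneg y

theorem mul_tailMass_le (hρ : CenteredDensity l u ρ) (x : ℝ) :
    x * tailMass ρ x ≤ tailMean ρ x :=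
  sub_nonneg.1 (hρ.tailExcess_nonneg x)

theorem tailExcess_le (hρ : CenteredDensity l u ρ) {x : ℝ} (hx : 0 ≤ x) :
    tailExcess ρ x ≤ tailMean ρ x :=
  sub_le_self _ (mul_nonneg hx (hρ.tailMass_nonneg x))

theorem hasDerivAt_tailMass (hρ : CenteredDensity l u ρ) {x : ℝ} (hx : x ∈ openInt l u) :
    HasDerivAt (tailMass ρ) (-(ρ x)) x :=
  hasDerivAt_integral_Ioi hρ.integrable (hρ.continuousAt hx)

theorem hasDerivAt_tailMean (hρ : CenteredDensity l u ρ) {x : ℝ} (hx : x ∈ openInt l u) :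
    HasDerivAt (tailMean ρ) (-(x * ρ x)) x :=
  hasDerivAt_integral_Ioi hρ.integrable_mul (continuousAt_id.mul (hρ.continuousAt hx))

theorem hasDerivAt_tailExcess (hρ : CenteredDensity l u ρ) {x : ℝ} (hx : x ∈ openInt l u) :
    HasDerivAt (tailExcess ρ) (-(tailMass ρ x)) x := by
  have := (hρ.hasDerivAt_tailMean hx).sub ((hasDerivAt_id x).mul (hρ.hasDerivAt_tailMass hx))
  refine this.congr_deriv ?_
  simp only [id]; ring

theorem tailMean_pos_of_nonneg (hρ : CenteredDensity l u ρ) {x : ℝ} (hx : x ∈ openInt l u)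
    (h0 : 0 ≤ x) : 0 < tailMean ρ x := by
  obtain ⟨z, hxz, hzu⟩ := EReal.lt_iff_exists_real_btwn.1 hx.2
  have hxz' : x < z := by exact_mod_cast hxz
  rw [tailMean, setIntegral_pos_iff_support_of_nonneg_ae
    ((ae_restrict_iff' measurableSet_Ioi).2 (ae_of_all _ fun y hy =>
      mul_nonneg (h0.trans (le_of_lt hy)) (hρ.nonneg y))) hρ.integrable_mul.integrableOn]
  refine lt_of_lt_of_le (b := volume (Ioo x z)) (by simpa using hxz') (measure_mono fun y hy => ?_)
  refine ⟨?_, hy.1⟩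
  have hy' : y ∈ openInt l u := (ordConnected_openInt l u).out hx (y := z)
    ⟨hx.1.trans hxz, hzu⟩ ⟨hy.1.le, hy.2.le⟩
  exact (mul_pos (h0.trans_lt hy.1) (hρ.pos y hy')).ne'

theorem tailMean_pos (hρ : CenteredDensity l u ρ) {x : ℝ} (hx : x ∈ openInt l u) :
    0 < tailMean ρ x := by
  rcases le_total 0 x with h0 | h0
  · exact hρ.tailMean_pos_of_nonneg hx h0
  · rw [← hρ.tailMean_reflect]
    exact hρ.reflect.tailMean_pos_of_nonneg (mem_neg_iff.2 (by simpa using hx)) (by linarith)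

theorem tailMean_le_zero (hρ : CenteredDensity l u ρ) {x : ℝ} (hx : 0 ≤ x) :
    tailMean ρ x ≤ tailMean ρ 0 := by
  refine setIntegral_mono_set hρ.integrable_mul.integrableOn
    ((ae_restrict_iff' measurableSet_Ioi).2 (ae_of_all _ fun y hy =>
      mul_nonneg (le_of_lt hy) (hρ.nonneg y))) (Ioi_subset_Ioi hx).eventuallyLE

theorem tendsto_tailMean (hρ : CenteredDensity l u ρ) :
    Tendsto (tailMean ρ) (toRightEnd u) (𝓝 0) := by
  have h1 : tailMean ρ = fun x => ∫ y, (Ioi x).indicator (fun y => y * ρ y) y := by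
    ext x; rw [integral_indicator measurableSet_Ioi]; rfl
  have : (toRightEnd u).IsCountablyGenerated := by unfold toRightEnd; infer_instance
  rw [h1, ← integral_zero ℝ ℝ (μ := volume)]
  refine tendsto_integral_filter_of_dominated_convergence (fun y => ‖y * ρ y‖)
    (Eventually.of_forall fun x => hρ.integrable_mul.aestronglyMeasurable.indicator
      measurableSet_Ioi)
    (Eventually.of_forall fun x => ae_of_all _ fun y => norm_indicator_le_norm_self _ _)
    hρ.integrable_mul.norm (ae_of_all _ fun y => ?_)
  refine tendsto_const_nhds.congr' ?_
  by_cases hy : y ∈ openInt l u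
  · refine (eventually_toRightEnd_iff (lt_trans EReal.bot_lt_zero hρ.right_pos)).2
      ⟨y, hy.2, fun x hx _ => ?_⟩
    exact (indicator_of_notMem (not_lt.2 hx.le : y ∉ Ioi x) _).symm
  · refine Eventually.of_forall fun x => ?_
    by_cases h : y ∈ Ioi x <;> simp [h, hρ.zero y hy]

theorem tendsto_tailExcess (hρ : CenteredDensity l u ρ) :
    Tendsto (tailExcess ρ) (toRightEnd u) (𝓝 0) := by
  refine tendsto_of_tendsto_of_tendsto_of_le_of_le' tendsto_const_nhds hρ.tendsto_tailMean
    (Eventually.of_forall hρ.tailExcess_nonneg) ?_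
  exact (eventually_toRightEnd_iff (lt_trans EReal.bot_lt_zero hρ.right_pos)).2
    ⟨0, hρ.right_pos, fun x hx _ => hρ.tailExcess_le hx.le⟩

theorem gStar_eq (hρ : CenteredDensity l u ρ) {x : ℝ} (hx : x ∈ openInt l u) :
    gStar l u ρ x = tailMean ρ x / ρ x := by
  rw [gStar, indicator_of_mem hx]
  congr 1
  have h1 : {y : ℝ | x < y ∧ (y : EReal) < u} ⊆ Ioi x := fun y hy => hy.1
  refine setIntegral_eq_of_subset_of_forall_sdiff_eq_zero measurableSet_Ioi h1 (fun y hy => ?_) |>.symm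
  rw [hρ.zero y, mul_zero]
  exact fun h => hy.2 ⟨hy.1, h.2⟩

/-- To the right of the support nothing is left to integrate. To its left the integral is the full
mean, which is zero; reflection exchanges the two cases. -/
theorem tailMean_eq_zero (hρ : CenteredDensity l u ρ) {x : ℝ} (hx : x ∉ openInt l u) :
    tailMean ρ x = 0 := by
  by_cases hxl : l < (x : EReal)
  · refine setIntegral_eq_zero_of_forall_eq_zero fun y hy => ?_
    rw [hρ.zero y, mul_zero]
    intro h
    exact hx ⟨hxl, lt_trans (by exact_mod_cast hy) h.2⟩
  · rw [← hρ.tailMean_reflect]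
    refine setIntegral_eq_zero_of_forall_eq_zero fun y hy => ?_
    refine mul_eq_zero_of_right _ (hρ.zero (-y) fun h => ?_)
    refine hxl (h.1.trans ?_)
    have : -y < x := by have : -x < y := hy; linarith
    exact_mod_cast this

theorem gStar_mul (hρ : CenteredDensity l u ρ) (x : ℝ) : gStar l u ρ x * ρ x = tailMean ρ x := by
  by_cases hx : x ∈ openInt l u
  · rw [hρ.gStar_eq hx, div_mul_cancel₀ _ (hρ.pos x hx).ne']
  · rw [hρ.tailMean_eq_zero hx, hρ.zero x hx, mul_zero]

theorem gStar_nonneg (hρ : CenteredDensity l u ρ) (x : ℝ) : 0 ≤ gStar l u ρ x := by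
  by_cases hx : x ∈ openInt l u
  · rw [hρ.gStar_eq hx]
    exact div_nonneg (hρ.tailMean_pos hx).le (hρ.nonneg x)
  · rw [gStar, indicator_of_notMem hx]

theorem continuousOn_gStar (hρ : CenteredDensity l u ρ) :
    ContinuousOn (gStar l u ρ) (openInt l u) := by
  have : ContinuousOn (fun x => tailMean ρ x / ρ x) (openInt l u) :=
    ContinuousOn.div (fun x hx => (hρ.hasDerivAt_tailMean hx).continuousAt.continuousWithinAt)
      hρ.cont fun x hx => (hρ.pos x hx).ne'
  exact this.congr fun x hx => hρ.gStar_eq hx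

theorem measurable_gStar (hρ : CenteredDensity l u ρ) : Measurable (gStar l u ρ) := by
  have hm := (isOpen_openInt l u).measurableSet
  classical
  have h := hρ.continuousOn_gStar.measurable_piecewise (g := fun _ => 0) continuousOn_const hm
  convert h using 1
  ext x
  by_cases hx : x ∈ openInt l u
  · simp [hx]
  · simp [hx, gStar]

theorem gStar_reflect (hρ : CenteredDensity l u ρ) (x : ℝ) :
    gStar (-u) (-l) (fun y => ρ (-y)) (-x) = gStar l u ρ x := by
  by_cases hx : x ∈ openInt l u
  · rw [hρ.gStar_eq hx, hρ.reflect.gStar_eq (mem_neg_iff.2 (by simpa using hx)),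
      hρ.tailMean_reflect, neg_neg]
  · rw [gStar, indicator_of_notMem (fun h => hx (by simpa using mem_neg_iff.1 h)), gStar,
      indicator_of_notMem hx]

end CenteredDensity

end WienerNP

/-! ### The pointwise bound for the product of the two excesses. -/

namespace WienerNP

theorem exists_real_bounds_of_liminf_limsup {f : Filter ℝ} {r : ℝ → ℝ}
    (h1 : 0 < liminf (fun x => (r x : EReal)) f) (h2 : limsup (fun x => (r x : EReal)) f < ⊤) :
    ∃ c C : ℝ, 0 < c ∧ ∀ᶠ x in f, c ≤ r x ∧ r x ≤ C := by
  obtain ⟨c, hc0, hc⟩ := EReal.lt_iff_exists_real_btwn.1 h1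
  obtain ⟨C, hC, -⟩ := EReal.lt_iff_exists_real_btwn.1 h2
  refine ⟨c, C, by exact_mod_cast hc0, ?_⟩
  filter_upwards [eventually_lt_of_lt_liminf hc, eventually_lt_of_limsup_lt hC] with x hx1 hx2
  exact ⟨by exact_mod_cast hx1.le, by exact_mod_cast hx2.le⟩

namespace CenteredDensity

variable {l u : EReal} {ρ : ℝ → ℝ}

theorem gStar_pos (hρ : CenteredDensity l u ρ) {x : ℝ} (hx : x ∈ openInt l u) :
    0 < gStar l u ρ x := by
  rw [hρ.gStar_eq hx]
  exact div_pos (hρ.tailMean_pos hx) (hρ.pos x hx)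

/-- On a compact `[0, e]` inside the support the quotient is continuous, hence bounded. Beyond `e`
the left excess is at most `q + x ≤ (q / e + 1) x` with `q = tailMean ρ 0`, and the tail estimate
finishes. -/
theorem exists_right_bound (hρ : CenteredDensity l u ρ) {gt : ℝ → ℝ}
    (hgt : ∀ x ∈ openInt l u, 0 < gt x ∧ DifferentiableAt ℝ gt x)
    {c C : ℝ} (hc : 0 < c)
    (hcg : ∀ᶠ x in toRightEnd u, c ≤ gStar l u ρ x / gt x ∧ gStar l u ρ x / gt x ≤ C)
    {b : EReal} (hb : Tendsto (fun x => ((deriv gt x : ℝ) : EReal)) (toRightEnd u) (𝓝 b)) :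
    ∃ K : ℝ, 0 ≤ K ∧ ∀ x ∈ openInt l u, 0 ≤ x →
      (tailExcess ρ x + x) * tailExcess ρ x ≤ K * (tailMean ρ x * gStar l u ρ x) := by
  have hu' : ⊥ < u := lt_trans EReal.bot_lt_zero hρ.right_pos
  have hpos : ∀ᶠ x in toRightEnd u, 0 ≤ x ∧ x ∈ openInt l u :=
    (eventually_toRightEnd_iff hu').2 ⟨0, hρ.right_pos, fun x hx hxu =>
      ⟨hx.le, hρ.left_neg.trans (by exact_mod_cast hx), hxu⟩⟩
  obtain ⟨K₀, hK₀, hev⟩ := exists_mul_tail_le (u := u) hρ.right_pos (p := tailMean ρ)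
    (B := tailExcess ρ) (T := tailMass ρ) (g := gStar l u ρ) (gt := gt)
    (hpos.mono fun x hx => ⟨hρ.tailMean_pos hx.2, by
      refine (hρ.hasDerivAt_tailMean hx.2).congr_deriv ?_
      have h1 := hρ.gStar_mul x
      rw [← h1]
      have h2 := (hρ.gStar_pos hx.2).ne'
      field_simp⟩)
    (hpos.mono fun x hx => ⟨hρ.tailExcess_le hx.1, hρ.hasDerivAt_tailExcess hx.2⟩)
    (Eventually.of_forall hρ.mul_tailMass_le) hρ.tendsto_tailExcess
    (hpos.mono fun x hx => hgt x hx.2) hc hcg hb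
  obtain ⟨d, hdu, hd⟩ := (eventually_toRightEnd_iff hu').1 hev
  obtain ⟨e, he, heu⟩ := EReal.lt_iff_exists_real_btwn.1 (max_lt hdu hρ.right_pos)
  have hde : d < e := by exact_mod_cast (le_max_left _ _).trans_lt he
  have he0 : 0 < e := by exact_mod_cast (le_max_right _ _).trans_lt he
  have hsub : Icc 0 e ⊆ openInt l u := (ordConnected_openInt l u).out hρ.zero_mem
    ⟨hρ.left_neg.trans (by exact_mod_cast he0), heu⟩
  have hcont : ContinuousOn (fun x => (tailExcess ρ x + x) * tailExcess ρ x /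
      (tailMean ρ x * gStar l u ρ x)) (Icc 0 e) := by
    have hB : ContinuousOn (tailExcess ρ) (openInt l u) := fun x hx =>
      (hρ.hasDerivAt_tailExcess hx).continuousAt.continuousWithinAt
    have hp : ContinuousOn (tailMean ρ) (openInt l u) := fun x hx =>
      (hρ.hasDerivAt_tailMean hx).continuousAt.continuousWithinAt
    exact (((hB.add continuousOn_id).mul hB).div (hp.mul hρ.continuousOn_gStar) fun x hx =>
      (mul_pos (hρ.tailMean_pos hx) (hρ.gStar_pos hx)).ne').mono hsub
  obtain ⟨K₁, hK₁⟩ := isCompact_Icc.exists_bound_of_continuousOn hcont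
  set q := tailMean ρ 0 with hq
  have hq0 : 0 < q := hρ.tailMean_pos hρ.zero_mem
  have hm : 0 ≤ max K₁ ((q / e + 1) * K₀) := (by positivity : 0 ≤ (q / e + 1) * K₀).trans
    (le_max_right _ _)
  refine ⟨max K₁ ((q / e + 1) * K₀), hm, fun x hx hx0 => ?_⟩
  have hpg : 0 < tailMean ρ x * gStar l u ρ x := mul_pos (hρ.tailMean_pos hx) (hρ.gStar_pos hx)
  have hB := hρ.tailExcess_nonneg x
  rcases le_or_gt x e with hxe | hxe
  · have h1 := (le_abs_self _).trans (hK₁ x ⟨hx0, hxe⟩)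
    rw [div_le_iff₀ hpg] at h1
    exact h1.trans (mul_le_mul_of_nonneg_right (le_max_left _ _) hpg.le)
  · have h1 := hd x (hde.trans hxe) hx.2
    have h2 : tailExcess ρ x ≤ q := (hρ.tailExcess_le hx0).trans (hρ.tailMean_le_zero hx0)
    have h3 : tailExcess ρ x + x ≤ (q / e + 1) * x := by
      have : q ≤ q / e * x := by
        rw [div_mul_eq_mul_div, le_div_iff₀ he0]
        gcongr
      linarith
    calc (tailExcess ρ x + x) * tailExcess ρ x ≤ (q / e + 1) * x * tailExcess ρ x := by gcongr
      _ = (q / e + 1) * (x * tailExcess ρ x) := by ring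
      _ ≤ (q / e + 1) * (K₀ * (tailMean ρ x * gStar l u ρ x)) := by gcongr
      _ = (q / e + 1) * K₀ * (tailMean ρ x * gStar l u ρ x) := by ring
      _ ≤ _ := mul_le_mul_of_nonneg_right (le_max_right _ _) hpg.le

/-- The pointwise bound behind the uniform Lipschitz estimate for solutions of Stein's equation. -/
theorem exists_bound (hρ : CenteredDensity l u ρ)
    (hB : EndpointConditions l u (gStar l u ρ)) :
    ∃ K : ℝ, 0 ≤ K ∧ ∀ x ∈ openInt l u,
      (tailExcess ρ x + x) * tailExcess ρ x ≤ K * (tailMean ρ x * gStar l u ρ x) := by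
  obtain ⟨⟨gt, hgt, hgt0, ⟨hr1, hr2⟩, ⟨hl1, hl2⟩, ⟨a, ha⟩, ⟨b, hb⟩⟩, -⟩ := hB
  have hd : ∀ x ∈ openInt l u, 0 < gt x ∧ DifferentiableAt ℝ gt x := fun x hx =>
    ⟨hgt0 x hx, (hgt.differentiableOn one_ne_zero).differentiableAt
      ((isOpen_openInt l u).mem_nhds hx)⟩
  obtain ⟨c, C, hc, hcC⟩ := exists_real_bounds_of_liminf_limsup hr1 hr2
  obtain ⟨c', C', hc', hcC'⟩ := exists_real_bounds_of_liminf_limsup hl1 hl2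
  obtain ⟨K, hK, hKx⟩ := hρ.exists_right_bound hd hc hcC hb
  have hgr : ∀ x, gStar (-u) (-l) (fun y => ρ (-y)) x = gStar l u ρ (-x) := fun x => by
    simpa using hρ.gStar_reflect (-x)
  -- The left half comes from the reflected density with comparison function `gt (-x)`. Its
  -- derivative changes sign, so the limit becomes `-a`.
  obtain ⟨K', hK', hKx'⟩ := hρ.reflect.exists_right_bound (gt := fun x => gt (-x)) (c := c')
    (C := C') (b := -a)
    (fun x hx => by
      obtain ⟨h0, h1⟩ := hd (-x) (mem_neg_iff.1 hx)
      exact ⟨h0, h1.comp x differentiableAt_id.neg⟩) hc'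
    (by
      filter_upwards [(tendsto_neg_toRightEnd l).eventually hcC'] with x hx
      simpa only [hgr] using hx)
    (by
      have h1 := (continuous_neg.tendsto a).comp (ha.comp (tendsto_neg_toRightEnd l))
      refine h1.congr fun x => ?_
      simp [deriv_comp_neg])
  refine ⟨max K K', hK.trans (le_max_left _ _), fun x hx => ?_⟩
  have hpg : 0 < tailMean ρ x * gStar l u ρ x := mul_pos (hρ.tailMean_pos hx) (hρ.gStar_pos hx)
  rcases le_total 0 x with h0 | h0
  · exact (hKx x hx h0).trans (mul_le_mul_of_nonneg_right (le_max_left _ _) hpg.le)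
  · have h1 := hKx' (-x) (mem_neg_iff.2 (by simpa using hx)) (by linarith)
    rw [hρ.tailExcess_reflect, hρ.tailMean_reflect, hρ.gStar_reflect] at h1
    refine le_trans (le_of_eq (by ring)) (h1.trans (mul_le_mul_of_nonneg_right (le_max_right _ _) hpg.le))

end CenteredDensity

end WienerNP

/-! ### Solutions of Stein's equation and their uniform Lipschitz bound. -/

namespace WienerNP

/-- The tail `∫_x^∞ (h - ∫ h ρ) ρ` of a centered test function. -/
noncomputable def steinTail (ρ h : ℝ → ℝ) (x : ℝ) : ℝ := ∫ y in Ioi x, (h y - ∫ z, h z * ρ z) * ρ y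

open Classical in
/-- The solution `f` of Stein's equation `h - ∫ h ρ = g_* f' - x f`. -/
noncomputable def steinSol (l u : EReal) (ρ h : ℝ → ℝ) (x : ℝ) : ℝ :=
  if x ∈ openInt l u then -(steinTail ρ h x / tailMean ρ x) else -((h x - ∫ z, h z * ρ z) / x)

namespace CenteredDensity

variable {l u : EReal} {ρ h : ℝ → ℝ}

theorem integrable_abs_mul (hρ : CenteredDensity l u ρ) : Integrable fun y => |y| * ρ y := by
  refine hρ.integrable_mul.norm.congr (ae_of_all _ fun y => ?_)
  simp [abs_of_nonneg (hρ.nonneg y)]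

theorem integrable_lipschitz_mul (hρ : CenteredDensity l u ρ) (hh : LipschitzWith 1 h) :
    Integrable fun y => h y * ρ y := by
  refine ((hρ.integrable.const_mul |h 0|).add hρ.integrable_abs_mul).mono'
    (hh.continuous.aestronglyMeasurable.mul hρ.integrable.aestronglyMeasurable)
    (ae_of_all _ fun y => ?_)
  have h1 := hh.dist_le_mul y 0
  simp only [Real.dist_eq, NNReal.coe_one, one_mul, sub_zero] at h1
  have h2 : |h y| ≤ |h 0| + |y| := by
    have := abs_sub_abs_le_abs_sub (h y) (h 0)
    linarith
  have := mul_le_mul_of_nonneg_right h2 (hρ.nonneg y)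
  simpa [abs_of_nonneg (hρ.nonneg y), add_mul] using this

theorem integrable_centered_mul (hρ : CenteredDensity l u ρ) (hh : LipschitzWith 1 h) (m : ℝ) :
    Integrable fun y => (h y - m) * ρ y := by
  simp only [sub_mul]
  exact (hρ.integrable_lipschitz_mul hh).sub (hρ.integrable.const_mul m)

theorem abs_centered_le (hρ : CenteredDensity l u ρ) (hh : LipschitzWith 1 h) (x : ℝ) :
    |h x - ∫ z, h z * ρ z| ≤ |x| + ∫ z, |z| * ρ z := by
  have h1 : h x - ∫ z, h z * ρ z = -∫ z, (h z - h x) * ρ z := by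
    simp only [sub_mul]
    rw [integral_sub (hρ.integrable_lipschitz_mul hh) (hρ.integrable.const_mul _),
      integral_const_mul, hρ.integral_eq]
    ring
  have h2 : |x| + ∫ z, |z| * ρ z = ∫ z, (|x| * ρ z + |z| * ρ z) := by
    rw [integral_add (hρ.integrable.const_mul _) hρ.integrable_abs_mul, integral_const_mul,
      hρ.integral_eq, mul_one]
  rw [h1, h2, abs_neg]
  refine (abs_integral_le_integral_abs).trans (integral_mono_ae
    (hρ.integrable_centered_mul hh _).abs
    ((hρ.integrable.const_mul _).add hρ.integrable_abs_mul) (ae_of_all _ fun z => ?_))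
  have h3 := hh.dist_le_mul z x
  simp only [Real.dist_eq, NNReal.coe_one, one_mul] at h3
  have h4 := abs_sub z x
  simp only [abs_mul, abs_of_nonneg (hρ.nonneg z), ← add_mul]
  exact mul_le_mul_of_nonneg_right (by linarith) (hρ.nonneg z)

/-- The difference is `∫_x^∞ (h y - h x) ρ y dy`, and `|h y - h x| ≤ y - x`. -/
theorem abs_steinTail_sub_le (hρ : CenteredDensity l u ρ) (hh : LipschitzWith 1 h) (x : ℝ) :
    |steinTail ρ h x - (h x - ∫ z, h z * ρ z) * tailMass ρ x| ≤ tailExcess ρ x := by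
  have h1 : steinTail ρ h x - (h x - ∫ z, h z * ρ z) * tailMass ρ x
      = ∫ y in Ioi x, (h y - h x) * ρ y := by
    rw [steinTail, tailMass, ← integral_const_mul,
      ← integral_sub (hρ.integrable_centered_mul hh _).integrableOn
        (hρ.integrable.const_mul _).integrableOn]
    congr 1; ext y; ring
  rw [h1, hρ.tailExcess_eq]
  have hi : Integrable fun y => (y - x) * ρ y := by
    simp only [sub_mul]
    exact hρ.integrable_mul.sub (hρ.integrable.const_mul x)
  refine abs_integral_le_integral_abs.trans (setIntegral_mono_on
    (hρ.integrable_centered_mul hh _).abs.integrableOn hi.integrableOn measurableSet_Ioi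
    fun y hy => ?_)
  have h3 := hh.dist_le_mul y x
  simp only [Real.dist_eq, NNReal.coe_one, one_mul] at h3
  rw [abs_of_pos (show 0 < y - x from sub_pos.2 hy)] at h3
  rw [abs_mul, abs_of_nonneg (hρ.nonneg y)]
  exact mul_le_mul_of_nonneg_right h3 (hρ.nonneg y)

theorem integral_comp_neg_mul : ∫ z, h (-z) * ρ (-z) = ∫ z, h z * ρ z :=
  integral_neg_eq_self (fun z => h z * ρ z) volume

theorem steinTail_reflect (hρ : CenteredDensity l u ρ) (hh : LipschitzWith 1 h) (x : ℝ) :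
    steinTail (fun y => ρ (-y)) (fun y => h (-y)) (-x) = -steinTail ρ h x := by
  have h1 := integral_Ioi_neg_comp _ (hρ.integrable_centered_mul hh (∫ z, h z * ρ z)) x
  have h2 : ∫ y, (h y - ∫ z, h z * ρ z) * ρ y = 0 := by
    simp only [sub_mul]
    rw [integral_sub (hρ.integrable_lipschitz_mul hh) (hρ.integrable.const_mul _),
      integral_const_mul, hρ.integral_eq]
    ring
  rw [h2, zero_sub] at h1
  rw [steinTail, integral_comp_neg_mul]
  exact h1

theorem lipschitz_reflect (hh : LipschitzWith 1 h) : LipschitzWith 1 fun y => h (-y) :=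
  LipschitzWith.of_dist_le_mul fun a b => by simpa using hh.dist_le_mul (-a) (-b)

theorem abs_add_steinTail_le (hρ : CenteredDensity l u ρ) (hh : LipschitzWith 1 h) (x : ℝ) :
    |(h x - ∫ z, h z * ρ z) * (1 - tailMass ρ x) + steinTail ρ h x| ≤ tailExcess ρ x + x := by
  have h1 := hρ.reflect.abs_steinTail_sub_le (lipschitz_reflect hh) (-x)
  rw [hρ.steinTail_reflect hh, hρ.tailMass_reflect, hρ.tailExcess_reflect,
    integral_comp_neg_mul, neg_neg, ← abs_neg] at h1
  convert h1 using 2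
  ring

/-- With `d` the centered value `h x - ∫ h ρ`, `N` the Stein tail, `T` the tail mass and `A`, `B`
the left and right excess, `A - B = x` and `tailMean = B + xT`. The numerator is therefore `(d(1-T)
+ N) B - (N - dT) A`, and the two brackets are bounded by `A` and `B`. -/
theorem abs_stein_numerator_le (hρ : CenteredDensity l u ρ) (hh : LipschitzWith 1 h) (x : ℝ) :
    |(h x - ∫ z, h z * ρ z) * tailMean ρ x - x * steinTail ρ h x|
      ≤ 2 * ((tailExcess ρ x + x) * tailExcess ρ x) := by
  have h1 := hρ.abs_add_steinTail_le hh x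
  have h2 := hρ.abs_steinTail_sub_le hh x
  have hB := hρ.tailExcess_nonneg x
  have hA := hρ.tailExcess_add_nonneg x
  set d := h x - ∫ z, h z * ρ z
  set N := steinTail ρ h x
  have e : d * tailMean ρ x - x * N
      = (d * (1 - tailMass ρ x) + N) * tailExcess ρ x
        - (N - d * tailMass ρ x) * (tailExcess ρ x + x) := by
    rw [tailExcess]; ring
  rw [e]
  refine (abs_sub _ _).trans ?_
  rw [abs_mul, abs_mul, abs_of_nonneg hB, abs_of_nonneg hA]
  nlinarith [mul_le_mul_of_nonneg_right h1 hB, mul_le_mul_of_nonneg_right h2 hA]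

theorem steinSol_of_mem {x : ℝ} (hx : x ∈ openInt l u) :
    steinSol l u ρ h x = -(steinTail ρ h x / tailMean ρ x) := if_pos hx

theorem steinSol_of_notMem {x : ℝ} (hx : x ∉ openInt l u) :
    steinSol l u ρ h x = -((h x - ∫ z, h z * ρ z) / x) := if_neg hx

theorem steinSol_reflect (hρ : CenteredDensity l u ρ) (hh : LipschitzWith 1 h) (x : ℝ) :
    steinSol (-u) (-l) (fun y => ρ (-y)) (fun y => h (-y)) (-x) = -steinSol l u ρ h x := by
  by_cases hx : x ∈ openInt l u
  · rw [steinSol_of_mem hx, steinSol_of_mem (mem_neg_iff.2 (by simpa using hx)),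
      hρ.steinTail_reflect hh, hρ.tailMean_reflect, neg_div]
  · rw [steinSol_of_notMem hx, steinSol_of_notMem (fun h => hx (by simpa using mem_neg_iff.1 h)),
      integral_comp_neg_mul, neg_neg, div_neg]

theorem abs_centered_add_mul_steinSol_le (hρ : CenteredDensity l u ρ) (hh : LipschitzWith 1 h)
    {x : ℝ} (hx : x ∈ openInt l u) :
    |h x - (∫ z, h z * ρ z) + x * steinSol l u ρ h x|
      ≤ 2 * ((tailExcess ρ x + x) * tailExcess ρ x) / tailMean ρ x := by
  have hp := hρ.tailMean_pos hx
  have e : h x - (∫ z, h z * ρ z) + x * steinSol l u ρ h x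
      = ((h x - ∫ z, h z * ρ z) * tailMean ρ x - x * steinTail ρ h x) / tailMean ρ x := by
    rw [steinSol_of_mem hx]; field_simp; ring
  rw [e, abs_div, abs_of_pos hp]
  exact div_le_div_of_nonneg_right (hρ.abs_stein_numerator_le hh x) hp.le

theorem hasDerivAt_steinSol (hρ : CenteredDensity l u ρ) (hh : LipschitzWith 1 h)
    {x : ℝ} (hx : x ∈ openInt l u) :
    HasDerivAt (steinSol l u ρ h)
      ((h x - (∫ z, h z * ρ z) + x * steinSol l u ρ h x) / gStar l u ρ x) x := by
  have hp := (hρ.tailMean_pos hx).ne'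
  have hr := (hρ.pos x hx).ne'
  have hN : HasDerivAt (steinTail ρ h) (-((h x - ∫ z, h z * ρ z) * ρ x)) x :=
    hasDerivAt_integral_Ioi (hρ.integrable_centered_mul hh _)
      ((hh.continuous.continuousAt.sub continuousAt_const).mul (hρ.continuousAt hx))
  have h1 := (hN.div (hρ.hasDerivAt_tailMean hx) hp).neg
  have h2 : steinSol l u ρ h =ᶠ[𝓝 x] -(steinTail ρ h / tailMean ρ) := by
    filter_upwards [(isOpen_openInt l u).mem_nhds hx] with y hy
    exact steinSol_of_mem hy
  refine (h1.congr_of_eventuallyEq h2).congr_deriv ?_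
  rw [steinSol_of_mem hx, hρ.gStar_eq hx]
  field_simp
  ring

theorem abs_deriv_steinSol_le (hρ : CenteredDensity l u ρ) (hh : LipschitzWith 1 h) {K : ℝ}
    (hK : ∀ x ∈ openInt l u,
      (tailExcess ρ x + x) * tailExcess ρ x ≤ K * (tailMean ρ x * gStar l u ρ x))
    {x : ℝ} (hx : x ∈ openInt l u) :
    ‖(h x - (∫ z, h z * ρ z) + x * steinSol l u ρ h x) / gStar l u ρ x‖ ≤ 2 * K := by
  have hp := hρ.tailMean_pos hx
  have hg := hρ.gStar_pos hx
  rw [Real.norm_eq_abs, abs_div, abs_of_pos hg, div_le_iff₀ hg]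
  refine (hρ.abs_centered_add_mul_steinSol_le hh hx).trans ?_
  rw [div_le_iff₀ hp]
  have := hK x hx
  linarith

theorem right_eq_coe_of_notMem (hρ : CenteredDensity l u ρ) {x : ℝ} (hx : x ∉ openInt l u)
    (h0 : 0 ≤ x) : ∃ r : ℝ, u = r ∧ r ≤ x := by
  have h1 : u ≤ x := by
    by_contra h
    exact hx ⟨hρ.left_neg.trans_le (by exact_mod_cast h0), not_le.1 h⟩
  have h2 : u ≠ ⊤ := (h1.trans_lt (EReal.coe_lt_top x)).ne
  have h3 : u ≠ ⊥ := (lt_trans EReal.bot_lt_zero hρ.right_pos).ne'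
  lift u to ℝ using ⟨h2, h3⟩
  exact ⟨u, rfl, by exact_mod_cast h1⟩

theorem tailExcess_le_of_right_eq {r : ℝ} (hρ : CenteredDensity l (r : EReal) ρ) {x : ℝ} :
    tailExcess ρ x ≤ (r - x) * tailMass ρ x := by
  rw [hρ.tailExcess_eq, tailMass, ← integral_const_mul]
  have hi : Integrable fun y => (y - x) * ρ y := by
    simp only [sub_mul]
    exact hρ.integrable_mul.sub (hρ.integrable.const_mul x)
  refine setIntegral_mono_on hi.integrableOn (hρ.integrable.const_mul _).integrableOn
    measurableSet_Ioi fun y _ => ?_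
  by_cases hy : y ∈ openInt l r
  · have : y < r := by exact_mod_cast hy.2
    exact mul_le_mul_of_nonneg_right (by linarith) (hρ.nonneg y)
  · rw [hρ.zero y hy]; simp

/-- Near a finite end `r` the right excess is at most `(r - x) T ≤ (r - x) tailMean / x`. So `h - ∫
h ρ + x f` tends to `0` from inside, which forces `f` to tend to the value prescribed outside the
support. -/
theorem continuousWithinAt_steinSol_right {r : ℝ} (hρ : CenteredDensity l (r : EReal) ρ)
    (hh : LipschitzWith 1 h) : ContinuousWithinAt (steinSol l r ρ h) (Iic r) r := by
  have hr : 0 < r := by exact_mod_cast hρ.right_pos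
  have hrm : r ∉ openInt l r := fun h => lt_irrefl _ h.2
  have hpos : ∀ᶠ x in 𝓝[<] r, 0 < x ∧ x < r := by
    filter_upwards [Ioo_mem_nhdsLT hr] with x hx using hx
  rw [← continuousWithinAt_Iio_iff_Iic, ContinuousWithinAt, steinSol_of_notMem hrm]
  have h1 : Tendsto (fun x => h x - (∫ z, h z * ρ z) + x * steinSol l r ρ h x) (𝓝[<] r) (𝓝 0) := by
    have h2 : Tendsto (fun x => 2 * (tailMean ρ 0 + x) * ((r - x) / x)) (𝓝[<] r) (𝓝 0) := by
      have : ContinuousAt (fun x => 2 * (tailMean ρ 0 + x) * ((r - x) / x)) r := by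
        have := hr.ne'
        fun_prop (disch := assumption)
      have := this.tendsto.mono_left (nhdsWithin_le_nhds (s := Iio r))
      simpa using this
    refine squeeze_zero_norm' ?_ h2
    filter_upwards [hpos] with x ⟨hx0, hxr⟩
    have hx : x ∈ openInt l r :=
      ⟨hρ.left_neg.trans (by exact_mod_cast hx0), by exact_mod_cast hxr⟩
    have hp := hρ.tailMean_pos hx
    refine (hρ.abs_centered_add_mul_steinSol_le hh hx).trans ?_
    rw [div_le_iff₀ hp]
    have hB := hρ.tailExcess_nonneg x
    have h3 : tailExcess ρ x + x ≤ tailMean ρ 0 + x :=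
      add_le_add_left ((hρ.tailExcess_le hx0.le).trans (hρ.tailMean_le_zero hx0.le)) x
    have h4 : tailExcess ρ x ≤ (r - x) / x * tailMean ρ x := by
      have h5 : tailMass ρ x ≤ tailMean ρ x / x := by
        rw [le_div_iff₀ hx0, mul_comm]; exact hρ.mul_tailMass_le x
      refine hρ.tailExcess_le_of_right_eq.trans
        ((mul_le_mul_of_nonneg_left h5 (sub_nonneg.2 hxr.le)).trans_eq ?_)
      ring
    have h6 := hρ.tailExcess_add_nonneg x
    have := mul_le_mul h3 h4 hB (h6.trans h3)
    linarith
  have h2 : Tendsto (fun x => h x - ∫ z, h z * ρ z) (𝓝[<] r) (𝓝 (h r - ∫ z, h z * ρ z)) :=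
    (hh.continuous.continuousAt.tendsto.mono_left nhdsWithin_le_nhds).sub_const _
  have h3 := (h1.sub h2).div (tendsto_id.mono_left (nhdsWithin_le_nhds (s := Iio r))) hr.ne'
  rw [zero_sub, neg_div] at h3
  refine h3.congr' ?_
  filter_upwards [hpos] with x hx
  have := hx.1.ne'
  simp only [Pi.div_apply, id]
  field_simp
  ring

/-- The solution outside the support is, up to sign, the centered `h` divided by `x`. The numerator
grows at most linearly, with a constant independent of `h`, and `x ≥ r > 0`. -/
theorem abs_div_sub_div_le (hρ : CenteredDensity l u ρ) (hh : LipschitzWith 1 h) {r a b : ℝ}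
    (hr : 0 < r) (ha : r ≤ a) (hab : a ≤ b) :
    |(h b - ∫ z, h z * ρ z) / b - (h a - ∫ z, h z * ρ z) / a|
      ≤ (r⁻¹ + (1 + (∫ z, |z| * ρ z) / r) / r) * (b - a) := by
  have ha0 : 0 < a := hr.trans_le ha
  have hb0 : 0 < b := ha0.trans_le hab
  have h1 := hρ.abs_centered_le hh a
  have h2 := hh.dist_le_mul b a
  simp only [Real.dist_eq, NNReal.coe_one, one_mul, abs_of_nonneg (sub_nonneg.2 hab)] at h2
  rw [abs_of_pos ha0] at h1
  set m := ∫ z, h z * ρ z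
  set M := ∫ z, |z| * ρ z
  have hM : 0 ≤ M := integral_nonneg fun z => mul_nonneg (abs_nonneg z) (hρ.nonneg z)
  have e : (h b - m) / b - (h a - m) / a = (h b - h a) / b - (h a - m) / a * ((b - a) / b) := by
    field_simp; ring
  have h3 : |(h b - h a) / b| ≤ r⁻¹ * (b - a) := by
    rw [abs_div, abs_of_pos hb0, div_eq_inv_mul]
    gcongr
    exact ha.trans hab
  have h4 : |(h a - m) / a| ≤ 1 + M / r := by
    rw [abs_div, abs_of_pos ha0, div_le_iff₀ ha0]
    have : M ≤ M / r * a := by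
      rw [div_mul_eq_mul_div, le_div_iff₀ hr]; gcongr
    linarith
  have h5 : |(b - a) / b| ≤ (b - a) / r := by
    rw [abs_div, abs_of_pos hb0, abs_of_nonneg (sub_nonneg.2 hab)]
    have := sub_nonneg.2 hab
    gcongr
    exact ha.trans hab
  rw [e]
  refine (abs_sub _ _).trans ?_
  rw [abs_mul]
  have := mul_le_mul h4 h5 (abs_nonneg _) (by positivity)
  calc _ ≤ r⁻¹ * (b - a) + (1 + M / r) * ((b - a) / r) := add_le_add h3 this
    _ = _ := by ring

theorem exists_lipschitz_steinSol_right (hρ : CenteredDensity l u ρ)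
    (hB : ∃ K : ℝ, 0 ≤ K ∧ ∀ x ∈ openInt l u,
      (tailExcess ρ x + x) * tailExcess ρ x ≤ K * (tailMean ρ x * gStar l u ρ x)) :
    ∃ K : ℝ, 0 ≤ K ∧ ∀ h : ℝ → ℝ, LipschitzWith 1 h → ∀ a b, 0 ≤ a → a ≤ b →
      |steinSol l u ρ h b - steinSol l u ρ h a| ≤ K * (b - a) := by
  obtain ⟨K₀, hK₀, hK⟩ := hB
  -- Only relevant for finite `u`; for `u = ⊤` the default `toReal = 0` makes `L = 0`.
  set L : ℝ := u.toReal⁻¹ + (1 + (∫ z, |z| * ρ z) / u.toReal) / u.toReal with hL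
  refine ⟨max (2 * K₀) L, le_max_of_le_left (by positivity), fun h hh a b ha hab => ?_⟩
  have hmem : ∀ {x : ℝ}, 0 ≤ x → (x : EReal) < u → x ∈ openInt l u := fun hx hxu =>
    ⟨hρ.left_neg.trans_le (by exact_mod_cast hx), hxu⟩
  have mvt : ∀ c, a ≤ c → (c : EReal) ≤ u → ContinuousOn (steinSol l u ρ h) (Icc a c) →
      |steinSol l u ρ h c - steinSol l u ρ h a| ≤ 2 * K₀ * (c - a) := fun c hac hcu hcont => by
    have hm : ∀ x ∈ Ico a c, x ∈ openInt l u := fun x hx =>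
      hmem (ha.trans hx.1) (lt_of_lt_of_le (by exact_mod_cast hx.2) hcu)
    exact norm_image_sub_le_of_norm_deriv_right_le_segment hcont
      (fun x hx => (hρ.hasDerivAt_steinSol hh (hm x hx)).hasDerivWithinAt)
      (fun x hx => hρ.abs_deriv_steinSol_le hh hK (hm x hx)) c ⟨hac, le_rfl⟩
  have hcontOn : ContinuousOn (steinSol l u ρ h) (openInt l u) := fun x hx =>
    (hρ.hasDerivAt_steinSol hh hx).continuousAt.continuousWithinAt
  have hba := sub_nonneg.2 hab
  by_cases hb : b ∈ openInt l u
  · refine (mvt b hab hb.2.le (hcontOn.mono fun x hx => hmem (ha.trans hx.1)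
      (lt_of_le_of_lt (by exact_mod_cast hx.2) hb.2))).trans ?_
    exact mul_le_mul_of_nonneg_right (le_max_left _ _) hba
  · obtain ⟨r, rfl, hrb⟩ := hρ.right_eq_coe_of_notMem hb (ha.trans hab)
    have hr : 0 < r := by exact_mod_cast hρ.right_pos
    rw [EReal.toReal_coe] at hL
    have hout : ∀ x, r ≤ x → x ∉ openInt l r := fun x hx h =>
      absurd h.2 (not_lt.2 (by exact_mod_cast hx))
    have hright : ∀ c, r ≤ c → c ≤ b →
        |steinSol l r ρ h b - steinSol l r ρ h c| ≤ L * (b - c) := fun c hc hcb => by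
      rw [steinSol_of_notMem hb, steinSol_of_notMem (hout c hc), neg_sub_neg, abs_sub_comm]
      exact hρ.abs_div_sub_div_le hh hr hc hcb
    rcases le_or_gt r a with hra | har
    · exact (hright a hra hab).trans (mul_le_mul_of_nonneg_right (le_max_right _ _) hba)
    -- When `r` lies between `a` and `b`, the mean value bound reaches `r` by left continuity there,
    -- and the explicit formula continues from `r` to `b`.
    · have h1 := mvt r har.le le_rfl fun x hx => by
        rcases hx.2.lt_or_eq with hxr | rfl
        · exact (hcontOn x (hmem (ha.trans hx.1) (by exact_mod_cast hxr))).continuousAt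
            ((isOpen_openInt l r).mem_nhds (hmem (ha.trans hx.1) (by exact_mod_cast hxr)))
            |>.continuousWithinAt
        · exact (hρ.continuousWithinAt_steinSol_right hh).mono fun y hy => hy.2
      have h2 := hright r le_rfl hrb
      have h3 : 2 * K₀ * (r - a) ≤ max (2 * K₀) L * (r - a) :=
        mul_le_mul_of_nonneg_right (le_max_left _ _) (by linarith)
      have h4 : L * (b - r) ≤ max (2 * K₀) L * (b - r) :=
        mul_le_mul_of_nonneg_right (le_max_right _ _) (by linarith)
      have h5 := abs_sub_le (steinSol l r ρ h b) (steinSol l r ρ h r) (steinSol l r ρ h a)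
      linarith

/-- The solutions of Stein's equation for `1`-Lipschitz test functions are uniformly Lipschitz. -/
theorem exists_lipschitz_steinSol (hρ : CenteredDensity l u ρ)
    (hB : EndpointConditions l u (gStar l u ρ)) :
    ∃ K : ℝ≥0, ∀ h : ℝ → ℝ, LipschitzWith 1 h → LipschitzWith K (steinSol l u ρ h) := by
  obtain ⟨K₀, hK₀, hK⟩ := hρ.exists_bound hB
  obtain ⟨K₁, hK₁, h1⟩ := hρ.exists_lipschitz_steinSol_right ⟨K₀, hK₀, hK⟩
  obtain ⟨K₂, hK₂, h2⟩ := hρ.reflect.exists_lipschitz_steinSol_right ⟨K₀, hK₀, fun x hx => by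
    have h3 := hK (-x) (mem_neg_iff.1 hx)
    rw [← hρ.tailExcess_reflect, ← hρ.tailMean_reflect, ← hρ.gStar_reflect, neg_neg] at h3
    have h4 := hρ.tailExcess_reflect (-x)
    rw [neg_neg] at h4
    refine le_trans (le_of_eq ?_) h3
    rw [h4]; ring⟩
  refine ⟨⟨max K₁ K₂, hK₁.trans (le_max_left _ _)⟩, fun h hh => ?_⟩
  have hneg : ∀ a b, a ≤ b → b ≤ 0 →
      |steinSol l u ρ h b - steinSol l u ρ h a| ≤ K₂ * (b - a) := fun a b hab hb => by
    have := h2 _ (lipschitz_reflect hh) (-b) (-a) (by linarith) (by linarith)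
    rw [hρ.steinSol_reflect hh, hρ.steinSol_reflect hh] at this
    rw [neg_sub_neg, neg_sub_neg] at this
    exact this
  have key : ∀ a b, a ≤ b →
      |steinSol l u ρ h b - steinSol l u ρ h a| ≤ max K₁ K₂ * (b - a) := fun a b hab => by
    have m1 := le_max_left K₁ K₂
    have m2 := le_max_right K₁ K₂
    rcases le_total 0 a with ha | ha
    · exact (h1 h hh a b ha hab).trans (mul_le_mul_of_nonneg_right m1 (by linarith))
    · rcases le_total b 0 with hb | hb
      · exact (hneg a b hab hb).trans (mul_le_mul_of_nonneg_right m2 (by linarith))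
      · have e1 := (h1 h hh 0 b le_rfl hb).trans (mul_le_mul_of_nonneg_right m1 (by linarith))
        have e2 := (hneg a 0 ha le_rfl).trans (mul_le_mul_of_nonneg_right m2 (by linarith))
        have e3 := abs_sub_le (steinSol l u ρ h b) (steinSol l u ρ h 0) (steinSol l u ρ h a)
        linarith
  refine LipschitzWith.of_dist_le_mul fun a b => ?_
  rw [Real.dist_eq, Real.dist_eq]
  rcases le_total a b with hab | hab
  · rw [abs_sub_comm, abs_sub_comm a b, abs_of_nonneg (sub_nonneg.2 hab)]
    exact key a b hab
  · rw [abs_of_nonneg (sub_nonneg.2 hab)]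
    exact key b a hab

/-- Outside the support `g_*` vanishes, so the value of `deriv` does not matter and the equation
determines `f`; `x ≠ 0` there because `0` is in the support. Since `X` may leave the support, the
equation is needed on all of `ℝ`. -/
theorem steinSol_equation (hρ : CenteredDensity l u ρ) (hh : LipschitzWith 1 h) (x : ℝ) :
    h x - ∫ z, h z * ρ z
      = gStar l u ρ x * deriv (steinSol l u ρ h) x - x * steinSol l u ρ h x := by
  by_cases hx : x ∈ openInt l u
  · rw [(hρ.hasDerivAt_steinSol hh hx).deriv, mul_div_cancel₀ _ (hρ.gStar_pos hx).ne']
    ring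
  · have h0 : x ≠ 0 := fun h => hx (h ▸ hρ.zero_mem)
    rw [gStar, indicator_of_notMem hx, steinSol_of_notMem hx]
    field_simp
    ring

end CenteredDensity

end WienerNP

/-! ### The law of the target, the identity `g_*(Z) = g_Z`, and the Stein bound for `X`. -/

namespace WienerNP

theorem measurable_of_continuousOn_openInt {l u : EReal} {ρ : ℝ → ℝ}
    (hρzero : ∀ x ∉ openInt l u, ρ x = 0) (hρcont : ContinuousOn ρ (openInt l u)) :
    Measurable ρ := by
  classical
  have h := hρcont.measurable_piecewise (g := fun _ => 0) continuousOn_const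
    (isOpen_openInt l u).measurableSet
  convert h using 1
  ext x
  by_cases hx : x ∈ openInt l u
  · simp [hx]
  · simp [hx, hρzero x hx]

section Law

variable {Ω : Type*} [MeasurableSpace Ω] {P : Measure Ω} {Z : Ω → ℝ} {ρ : ℝ → ℝ}

theorem integral_comp_of_density (hZm : Measurable Z) (hρm : Measurable ρ) (hρ0 : ∀ x, 0 ≤ ρ x)
    (hρ : P.map Z = volume.withDensity (fun x => ENNReal.ofReal (ρ x))) {φ : ℝ → ℝ}
    (hφ : Measurable φ) : ∫ ω, φ (Z ω) ∂P = ∫ y, φ y * ρ y := by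
  rw [← integral_map hZm.aemeasurable hφ.aestronglyMeasurable, hρ,
    integral_withDensity_eq_integral_toReal_smul hρm.ennreal_ofReal
      (ae_of_all _ fun x => ENNReal.ofReal_lt_top)]
  refine integral_congr_ae (ae_of_all _ fun y => ?_)
  simp [ENNReal.toReal_ofReal (hρ0 y), mul_comm]

theorem integrable_comp_iff_of_density (hZm : Measurable Z) (hρm : Measurable ρ)
    (hρ0 : ∀ x, 0 ≤ ρ x)
    (hρ : P.map Z = volume.withDensity (fun x => ENNReal.ofReal (ρ x))) {φ : ℝ → ℝ}
    (hφ : Measurable φ) : Integrable (fun ω => φ (Z ω)) P ↔ Integrable fun y => φ y * ρ y := by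
  have h := integrable_map_measure (μ := P) hφ.aestronglyMeasurable hZm.aemeasurable
  rw [hρ, integrable_withDensity_iff hρm.ennreal_ofReal
    (ae_of_all _ fun x => ENNReal.ofReal_lt_top)] at h
  refine h.symm.trans (integrable_congr (ae_of_all _ fun y => ?_))
  simp [ENNReal.toReal_ofReal (hρ0 y)]

theorem centeredDensity_of_map [IsProbabilityMeasure P] (hZm : Measurable Z)
    (hZi : Integrable Z P) (hZ0 : ∫ ω, Z ω ∂P = 0) {l u : EReal} (hl : l < 0) (hu : 0 < u)
    (hρpos : ∀ x ∈ openInt l u, 0 < ρ x) (hρzero : ∀ x ∉ openInt l u, ρ x = 0)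
    (hρcont : ContinuousOn ρ (openInt l u))
    (hρ : P.map Z = volume.withDensity (fun x => ENNReal.ofReal (ρ x))) :
    CenteredDensity l u ρ := by
  have hρm := measurable_of_continuousOn_openInt hρzero hρcont
  have hρ0 : ∀ x, 0 ≤ ρ x := fun x => by
    by_cases hx : x ∈ openInt l u
    · exact (hρpos x hx).le
    · exact (hρzero x hx).ge
  exact
    { left_neg := hl
      right_pos := hu
      pos := hρpos
      zero := hρzero
      cont := hρcont
      integrable := by
        simpa using (integrable_comp_iff_of_density hZm hρm hρ0 hρ
          (measurable_const (a := (1 : ℝ)))).1 (integrable_const 1)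
      integrable_mul := (integrable_comp_iff_of_density hZm hρm hρ0 hρ measurable_id).1 hZi
      integral_eq := by
        simpa using (integral_comp_of_density hZm hρm hρ0 hρ (measurable_const (a := (1 : ℝ)))).symm
      mean_eq := (integral_comp_of_density hZm hρm hρ0 hρ measurable_id).symm.trans hZ0 }

namespace CenteredDensity

variable {l u : EReal}

theorem measurable (hρ : CenteredDensity l u ρ) : Measurable ρ :=
  measurable_of_continuousOn_openInt hρ.zero hρ.cont

theorem tailMean_nonneg (hρ : CenteredDensity l u ρ) (t : ℝ) : 0 ≤ tailMean ρ t := by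
  rw [← hρ.gStar_mul]
  exact mul_nonneg (hρ.gStar_nonneg t) (hρ.nonneg t)

theorem measurable_tailMean (hρ : CenteredDensity l u ρ) : Measurable (tailMean ρ) := by
  have := hρ.measurable_gStar.mul hρ.measurable
  convert this using 1
  ext t
  exact (hρ.gStar_mul t).symm

/-- For `t > 0` only `y ≥ t` contributes. For `t ≤ 0` only `y < t` does, giving `-∫_{-∞}^t y ρ`,
which is the same tail mean because the mean is zero. -/
theorem integral_uIoc_indicator (hρ : CenteredDensity l u ρ) (t : ℝ) :
    ∫ y, (uIoc 0 y).indicator (fun _ => |y|) t * ρ y = tailMean ρ t := by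
  rcases lt_or_ge 0 t with ht | ht
  · have h1 : ∀ y, (uIoc 0 y).indicator (fun _ => |y|) t * ρ y
        = (Ici t).indicator (fun y => y * ρ y) y := fun y => by
      by_cases hy : t ≤ y
      · have : t ∈ uIoc 0 y := by rw [uIoc_of_le (ht.le.trans hy)]; exact ⟨ht, hy⟩
        rw [indicator_of_mem this, indicator_of_mem (show y ∈ Ici t from hy),
          abs_of_pos (ht.trans_le hy)]
      · have : t ∉ uIoc 0 y := fun h => by
          rcases le_total 0 y with h0 | h0
          · rw [uIoc_of_le h0] at h; exact hy h.2
          · rw [uIoc_of_ge h0] at h; exact absurd h.2 (not_le.2 ht)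
        rw [indicator_of_notMem this, indicator_of_notMem (show y ∉ Ici t from hy), zero_mul]
    simp_rw [h1]
    rw [integral_indicator measurableSet_Ici, integral_Ici_eq_integral_Ioi, tailMean]
  · have h1 : ∀ y, (uIoc 0 y).indicator (fun _ => |y|) t * ρ y
        = -(Iio t).indicator (fun y => y * ρ y) y := fun y => by
      by_cases hy : y < t
      · have : t ∈ uIoc 0 y := by rw [uIoc_of_ge (hy.le.trans ht)]; exact ⟨hy, ht⟩
        rw [indicator_of_mem this, indicator_of_mem (show y ∈ Iio t from hy),
          abs_of_neg (hy.trans_le ht), neg_mul]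
      · have : t ∉ uIoc 0 y := fun h => by
          rcases le_total 0 y with h0 | h0
          · rw [uIoc_of_le h0] at h; exact absurd h.1 (not_lt.2 ht)
          · rw [uIoc_of_ge h0] at h; exact hy h.1
        rw [indicator_of_notMem this, indicator_of_notMem (show y ∉ Iio t from hy), zero_mul,
          neg_zero]
    simp_rw [h1]
    have h2 := integral_add_compl (measurableSet_Iic (a := t)) hρ.integrable_mul
    rw [compl_Iic, hρ.mean_eq] at h2
    rw [integral_neg, integral_indicator measurableSet_Iio, ← integral_Iic_eq_integral_Iio, tailMean]
    linarith

theorem zeroBias_eq (hρ : CenteredDensity l u ρ) (hZm : Measurable Z) (hZi : Integrable Z P)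
    (hmap : P.map Z = volume.withDensity (fun x => ENNReal.ofReal (ρ x))) :
    zeroBias P Z = volume.withDensity fun t => ENNReal.ofReal (tailMean ρ t) := by
  rw [zeroBias]
  congr 1
  ext t
  set φ : ℝ → ℝ := fun y => (uIoc 0 y).indicator (fun _ => |y|) t with hφ
  have hφm : Measurable φ := by
    have : φ = {y : ℝ | t ∈ uIoc 0 y}.indicator fun y => |y| := by
      ext y; by_cases h : t ∈ uIoc 0 y <;> simp [hφ, h]
    rw [this]
    refine Measurable.indicator (by fun_prop) ?_
    exact (measurableSet_uIoc_graph measurable_id).preimage (measurable_prodMk_left (x := t))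
  have h1 : ∀ ω, (uIoc 0 (Z ω)).indicator (fun _ => ‖Z ω‖ₑ) t = ENNReal.ofReal (φ (Z ω)) :=
    fun ω => by
      by_cases h : t ∈ uIoc 0 (Z ω) <;> simp [hφ, h, Real.enorm_eq_ofReal_abs]
  have h0 : ∀ y, 0 ≤ φ y := fun y => indicator_nonneg (fun _ _ => abs_nonneg y) t
  have hφi : Integrable (fun ω => φ (Z ω)) P := by
    refine hZi.mono (hφm.comp hZm).aestronglyMeasurable (ae_of_all _ fun ω => ?_)
    refine (norm_indicator_le_norm_self _ _).trans ?_
    simp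
  simp_rw [h1]
  rw [← ofReal_integral_eq_lintegral_ofReal hφi (ae_of_all _ fun ω => h0 _),
    integral_comp_of_density hZm hρ.measurable hρ.nonneg hmap hφm, hρ.integral_uIoc_indicator]

end CenteredDensity

end Law

section Target

variable {Ω H : Type*} [MeasurableSpace Ω] [NormedAddCommGroup H] [InnerProductSpace ℝ H]
  [CompleteSpace H] {P : Measure Ω} {W : H → Ω → ℝ} {l u : EReal} {ρ : ℝ → ℝ}

namespace CenteredDensity

/-- `g_*(Z) = g_Z` almost surely. -/
theorem gStar_comp_ae_eq_gVar (hρ : CenteredDensity l u ρ) (hW : IsIsonormal P W) {Z : Ω → ℝ}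
    (hZm : Measurable Z) (hZ : MemD12 P W Z) (hZ0 : ∫ ω, Z ω ∂P = 0)
    (hmap : P.map Z = volume.withDensity (fun x => ENNReal.ofReal (ρ x))) :
    (fun ω => gStar l u ρ (Z ω)) =ᵐ[P] gVar P W Z := by
  have := hW.gaussian.isProbabilityMeasure
  have hZ2 : MemLp Z 2 P := (hasMalliavinDeriv_malliavinD hZ).1
  have hZi : Integrable Z P := hZ2.integrable one_le_two
  have hzb := hρ.zeroBias_eq hZm hZi hmap
  have hfin := isFiniteMeasure_zeroBias hZm hZ2
  have hint : Integrable (fun ω => gStar l u ρ (Z ω)) P := by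
    rw [integrable_comp_iff_of_density hZm hρ.measurable hρ.nonneg hmap hρ.measurable_gStar]
    simp_rw [hρ.gStar_mul]
    refine ⟨hρ.measurable_tailMean.aestronglyMeasurable, ?_⟩
    rw [hasFiniteIntegral_iff_ofReal (ae_of_all _ hρ.tailMean_nonneg)]
    have := measure_lt_top (zeroBias P Z) univ
    rwa [hzb, withDensity_apply _ MeasurableSet.univ, Measure.restrict_univ] at this
  have hle : MeasurableSpace.comap Z inferInstance ≤ (inferInstance : MeasurableSpace Ω) :=
    hZm.comap_le
  have hsm : StronglyMeasurable[MeasurableSpace.comap Z inferInstance] (gVar P W Z) :=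
    stronglyMeasurable_condExp
  rw [← condExp_of_stronglyMeasurable hle hsm integrable_gVar]
  refine ae_eq_condExp_of_forall_setIntegral_eq hle integrable_gVar
    (fun s _ _ => hint.integrableOn) ?_
    (hρ.measurable_gStar.comp (comap_measurable Z)).stronglyMeasurable.aestronglyMeasurable
  rintro _ ⟨A, hA, rfl⟩ -
  -- On `Z ∈ A` both variables integrate to the zero-bias mass of `A`, which is `∫_A tailMean ρ =
  -- ∫_A g_* ρ`.
  rw [hW.setIntegral_gVar hZm hZ hZ0 hA, hzb, Measure.real, withDensity_apply _ hA,
    ← integral_eq_lintegral_of_nonneg_ae (ae_of_all _ hρ.tailMean_nonneg)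
      hρ.measurable_tailMean.aestronglyMeasurable, ← integral_indicator (hZm hA),
    ← integral_indicator hA]
  have h1 := integral_comp_of_density hZm hρ.measurable hρ.nonneg hmap
    (hρ.measurable_gStar.indicator hA)
  refine Eq.trans (integral_congr_ae (ae_of_all _ fun ω => ?_))
    (h1.trans (integral_congr_ae (ae_of_all _ fun y => ?_)))
  · by_cases h : Z ω ∈ A <;> simp [h]
  · by_cases h : y ∈ A <;> simp [h, hρ.gStar_mul]

/-- Stein's method bound for a single `1`-Lipschitz test function. -/
theorem abs_integral_sub_le (hρ : CenteredDensity l u ρ) (hW : IsIsonormal P W)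
    {K : ℝ≥0} {h : ℝ → ℝ} (hh : LipschitzWith 1 h) (hK : LipschitzWith K (steinSol l u ρ h))
    {X : Ω → ℝ} (hXm : Measurable X) (hX : MemD12 P W X) (hX0 : ∫ ω, X ω ∂P = 0)
    (hg : Integrable (fun ω => gStar l u ρ (X ω) - gVar P W X ω) P) :
    |∫ ω, h (X ω) ∂P - ∫ z, h z * ρ z| ≤ K * ∫ ω, |gStar l u ρ (X ω) - gVar P W X ω| ∂P := by
  have := hW.gaussian.isProbabilityMeasure
  have hX2 : MemLp X 2 P := (hasMalliavinDeriv_malliavinD hX).1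
  have hXi : Integrable X P := hX2.integrable one_le_two
  obtain ⟨h1, h2, h3⟩ := hW.integral_mul_lipschitz hXm hX hX0 hK
  set f := steinSol l u ρ h with hf
  have hM : ∀ t, |deriv f t| ≤ K := fun t => norm_deriv_le_of_lipschitz hK
  have hg' : Integrable (fun ω => (gStar l u ρ (X ω) - gVar P W X ω) * deriv f (X ω)) P := by
    refine hg.mul_bdd (c := K) ((measurable_deriv f).comp hXm).aestronglyMeasurable
      (ae_of_all _ fun ω => hM _)
  have hhi : Integrable (fun ω => h (X ω)) P := by
    refine ((integrable_const |h 0|).add hXi.norm).mono'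
      (hh.continuous.measurable.comp hXm).aestronglyMeasurable (ae_of_all _ fun ω => ?_)
    have h4 := hh.dist_le_mul (X ω) 0
    simp only [Real.dist_eq, NNReal.coe_one, one_mul, sub_zero] at h4
    have := abs_sub_abs_le_abs_sub (h (X ω)) (h 0)
    simp only [Pi.add_apply, Real.norm_eq_abs]
    linarith
  have key : ∫ ω, h (X ω) ∂P - ∫ z, h z * ρ z
      = ∫ ω, (gStar l u ρ (X ω) - gVar P W X ω) * deriv f (X ω) ∂P := by
    -- Stein's equation at `X` replaces `g_* f'`; the terms `X f(X)` and `g_X f'(X)` then cancel in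
    -- expectation by Stein's identity.
    have e1 : ∀ ω, (gStar l u ρ (X ω) - gVar P W X ω) * deriv f (X ω)
        = ((h (X ω) - ∫ z, h z * ρ z) + X ω * f (X ω)) - gVar P W X ω * deriv f (X ω) := fun ω => by
      rw [hρ.steinSol_equation hh (X ω)]; ring
    have i1 : Integrable (fun ω => h (X ω) - ∫ z, h z * ρ z) P := hhi.sub (integrable_const _)
    have i2 : Integrable (fun ω => (h (X ω) - ∫ z, h z * ρ z) + X ω * f (X ω)) P := i1.add h1
    simp_rw [e1]
    rw [integral_sub i2 h2, integral_add i1 h1, integral_sub hhi (integrable_const _), h3]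
    simp
  rw [key, ← integral_const_mul]
  refine abs_integral_le_integral_abs.trans (integral_mono hg'.abs (hg.abs.const_mul _) fun ω => ?_)
  simp only [abs_mul]
  rw [mul_comm]
  exact mul_le_mul_of_nonneg_right (hM _) (abs_nonneg _)

end CenteredDensity

/-- The identity `E[X G(X)] = E[g(X) g_X]` for an antiderivative `G` of a nonnegative `g`. -/
theorem IsIsonormal.integral_mul_antideriv (hW : IsIsonormal P W) {X : Ω → ℝ} (hXm : Measurable X)
    (hX : MemD12 P W X) (hX0 : ∫ ω, X ω ∂P = 0) {g G : ℝ → ℝ} (hgm : Measurable g)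
    (hg0 : ∀ x, 0 ≤ g x) (hG : ∀ x, HasDerivAt G (g x) x)
    (hi : Integrable (fun ω => g (X ω) * gVar P W X ω) P) :
    Integrable (fun ω => X ω * G (X ω)) P ∧
      ∫ ω, X ω * G (X ω) ∂P = ∫ ω, g (X ω) * gVar P W X ω ∂P := by
  have := hW.gaussian.isProbabilityMeasure
  have hX2 : MemLp X 2 P := (hasMalliavinDeriv_malliavinD hX).1
  have hXi : Integrable X P := hX2.integrable one_le_two
  have hGc : Continuous G := continuous_iff_continuousAt.2 fun x => (hG x).continuousAt
  -- A nonnegative function with an everywhere antiderivative is integrable on bounded intervals, so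
  -- no bound on `g` is required.
  have hii : ∀ a b, IntervalIntegrable g volume a b := fun a b =>
    intervalIntegral.intervalIntegrable_deriv_of_nonneg hGc.continuousOn (fun x _ => hG x)
      fun x _ => hg0 x
  have hint : ∀ x, ∫ t in (0 : ℝ)..x, g t = G x - G 0 := fun x =>
    intervalIntegral.integral_eq_sub_of_hasDerivAt (fun y _ => hG y) (hii 0 x)
  set S : Ω → ℝ := fun ω => X ω * (G (X ω) - G 0) with hS
  have hSm : AEStronglyMeasurable S P :=
    (hXm.mul ((hGc.measurable.comp hXm).sub_const _)).aestronglyMeasurable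
  have hS0 : ∀ ω, 0 ≤ S ω := fun ω => by
    rw [hS]
    simp only [← hint, mul_integral_eq_abs_mul]
    exact mul_nonneg (abs_nonneg _) (integral_nonneg hg0)
  have h0 : 0 ≤ᵐ[P] fun ω => g (X ω) * gVar P W X ω := by
    filter_upwards [hW.gVar_nonneg hXm hX hX0] with ω hω using mul_nonneg (hg0 _) hω
  have hl : ∫⁻ ω, ENNReal.ofReal (S ω) ∂P
      = ∫⁻ ω, ENNReal.ofReal (g (X ω) * gVar P W X ω) ∂P := by
    have h1 := hW.lintegral_mul_gVar hXm hX hX0 hgm.ennreal_ofReal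
    calc _ = ∫⁻ ω, ‖X ω‖ₑ * (∫⁻ t in uIoc 0 (X ω), ENNReal.ofReal (g t)) ∂P := by
          refine lintegral_congr fun ω => ?_
          rw [enorm_mul_lintegral_eq (intervalIntegrable_iff.1 (hii 0 (X ω))) hg0, hint]
      _ = _ := h1.symm
      _ = _ := by
          refine lintegral_congr fun ω => ?_
          rw [ENNReal.ofReal_mul (hg0 _), mul_comm]
  have hSi : Integrable S P := by
    refine ⟨hSm, ?_⟩
    rw [hasFiniteIntegral_iff_ofReal (ae_of_all _ hS0), hl]
    exact (hasFiniteIntegral_iff_ofReal h0).1 hi.2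
  have hSe : ∫ ω, S ω ∂P = ∫ ω, g (X ω) * gVar P W X ω ∂P := by
    rw [integral_eq_lintegral_of_nonneg_ae (ae_of_all _ hS0) hSm, hl,
      ← integral_eq_lintegral_of_nonneg_ae h0 hi.1]
  -- The constant `G 0` contributes `G 0 * E[X] = 0`, so the choice of antiderivative is immaterial.
  have e : (fun ω => X ω * G (X ω)) = fun ω => S ω + X ω * G 0 := by
    ext ω; rw [hS]; ring
  refine ⟨e ▸ hSi.add (hXi.mul_const _), ?_⟩
  rw [e, integral_add hSi (hXi.mul_const _), integral_mul_const, hX0, hSe]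
  ring

end Target

end WienerNP

/-! ### Second moments and assembly of the bounds. -/

namespace WienerNP

theorem fortetMourierClass_subset : fortetMourierClass ⊆ wassersteinClass := by
  rintro h ⟨K, M, hK, -, hKM⟩
  exact hK.weaken (le_self_add.trans hKM)

section Moments

variable {Ω : Type*} [MeasurableSpace Ω] {P : Measure Ω}

theorem lintegral_enorm_le_rpow_lintegral_sq [IsProbabilityMeasure P] {D : Ω → ℝ}
    (hD : AEStronglyMeasurable D P) :
    ∫⁻ ω, ‖D ω‖ₑ ∂P ≤ (∫⁻ ω, ‖D ω‖ₑ ^ 2 ∂P) ^ (1 / 2 : ℝ) := by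
  have h := eLpNorm_le_eLpNorm_of_exponent_le (μ := P) (f := D) (p := 1) (q := 2) one_le_two hD
  rw [eLpNorm_one_eq_lintegral_enorm,
    eLpNorm_eq_lintegral_rpow_enorm_toReal two_ne_zero ENNReal.ofNat_ne_top] at h
  simpa using h

theorem rpow_lintegral_sq_eq {D : Ω → ℝ} (hD : MemLp D 2 P) :
    (∫⁻ ω, ‖D ω‖ₑ ^ 2 ∂P) ^ (1 / 2 : ℝ) = ENNReal.ofReal √(∫ ω, D ω ^ 2 ∂P) := by
  have h1 : ∫⁻ ω, ‖D ω‖ₑ ^ 2 ∂P = ENNReal.ofReal (∫ ω, D ω ^ 2 ∂P) := by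
    rw [ofReal_integral_eq_lintegral_ofReal hD.integrable_sq (ae_of_all _ fun ω => sq_nonneg _)]
    refine lintegral_congr fun ω => ?_
    rw [Real.enorm_eq_ofReal_abs, ← ENNReal.ofReal_pow (abs_nonneg _), sq_abs]
  rw [h1, ENNReal.ofReal_rpow_of_nonneg (integral_nonneg fun ω => sq_nonneg _) (by norm_num),
    Real.sqrt_eq_rpow]

theorem integral_sub_sq {U V : Ω → ℝ} (hU : MemLp U 2 P) (hV : MemLp V 2 P) :
    ∫ ω, (U ω - V ω) ^ 2 ∂P = ∫ ω, U ω ^ 2 ∂P - 2 * ∫ ω, U ω * V ω ∂P + ∫ ω, V ω ^ 2 ∂P := by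
  have hUV : Integrable (fun ω => U ω * V ω) P := hU.integrable_mul hV
  have i1 : Integrable (fun ω => U ω ^ 2 - 2 * (U ω * V ω)) P :=
    hU.integrable_sq.sub (hUV.const_mul 2)
  have e : ∀ ω, (U ω - V ω) ^ 2 = U ω ^ 2 - 2 * (U ω * V ω) + V ω ^ 2 := fun ω => by ring
  simp_rw [e]
  rw [integral_add i1 hV.integrable_sq, integral_sub hU.integrable_sq (hUV.const_mul 2),
    integral_const_mul]

end Moments

end WienerNP

theorem mainTheorem1
    {Ω H : Type*} [MeasurableSpace Ω] (P : Measure Ω) [IsProbabilityMeasure P]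
    [NormedAddCommGroup H] [InnerProductSpace ℝ H] [CompleteSpace H]
    [TopologicalSpace.SeparableSpace H]
    (W : H → Ω → ℝ) (hW : WienerNP.IsIsonormal P W)
    -- the metric: Wasserstein or Fortet–Mourier
    (𝓗 : Set (ℝ → ℝ)) (h𝓗 : 𝓗 = WienerNP.wassersteinClass ∨ 𝓗 = WienerNP.fortetMourierClass)
    -- the target `Z`, with density `ρ`, and its support `(l, u)`
    (Z : Ω → ℝ) (hZm : Measurable Z) (hZD : WienerNP.MemD12 P W Z) (hZ0 : ∫ ω, Z ω ∂P = 0)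
    (l u : EReal) (hl : l < 0) (hu : 0 < u) (ρ : ℝ → ℝ)
    (hρpos : ∀ x ∈ WienerNP.openInt l u, 0 < ρ x) (hρzero : ∀ x ∉ WienerNP.openInt l u, ρ x = 0)
    (hρcont : ContinuousOn ρ (WienerNP.openInt l u))
    (hρ : P.map Z = volume.withDensity (fun x => ENNReal.ofReal (ρ x)))
    (hB : WienerNP.EndpointConditions l u (WienerNP.gStar l u ρ)) :
    -- `g_*(Z) = g_Z` almost surely
    (fun ω => WienerNP.gStar l u ρ (Z ω)) =ᵐ[P] WienerNP.gVar P W Z ∧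
    ∃ k : ℝ≥0, ∀ X : Ω → ℝ, Measurable X → WienerNP.MemD12 P W X → ∫ ω, X ω ∂P = 0 →
      -- first two bounds
      (WienerNP.distH 𝓗 P X Z
          ≤ k * ∫⁻ ω, ‖WienerNP.gStar l u ρ (X ω) - WienerNP.gVar P W X ω‖ₑ ∂P) ∧
      ((k : ℝ≥0∞) * ∫⁻ ω, ‖WienerNP.gStar l u ρ (X ω) - WienerNP.gVar P W X ω‖ₑ ∂P
          ≤ k * (∫⁻ ω, ‖WienerNP.gStar l u ρ (X ω) - WienerNP.gVar P W X ω‖ₑ ^ 2 ∂P)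
            ^ (1 / 2 : ℝ)) ∧
      -- bounds by moments, when the second moments are finite
      (MemLp (fun ω => WienerNP.gStar l u ρ (X ω)) 2 P → MemLp (WienerNP.gVar P W X) 2 P →
        MemLp (fun ω => WienerNP.gStar l u ρ (Z ω)) 2 P →
        ((k : ℝ≥0∞) * (∫⁻ ω, ‖WienerNP.gStar l u ρ (X ω) - WienerNP.gVar P W X ω‖ₑ ^ 2 ∂P)
            ^ (1 / 2 : ℝ)
          ≤ ENNReal.ofReal (k * √(
              |∫ ω, WienerNP.gStar l u ρ (X ω) ^ 2 ∂P - ∫ ω, WienerNP.gStar l u ρ (Z ω) ^ 2 ∂P|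
              + 2 * |∫ ω, WienerNP.gStar l u ρ (X ω) * WienerNP.gVar P W X ω ∂P
                  - ∫ ω, WienerNP.gStar l u ρ (Z ω) * WienerNP.gVar P W Z ω ∂P|
              + |∫ ω, WienerNP.gVar P W X ω ^ 2 ∂P - ∫ ω, WienerNP.gVar P W Z ω ^ 2 ∂P|))) ∧
        (WienerNP.distH 𝓗 P X Z
          ≤ ENNReal.ofReal (k * √(
              |∫ ω, WienerNP.gStar l u ρ (X ω) ^ 2 ∂P - ∫ ω, WienerNP.gStar l u ρ (Z ω) ^ 2 ∂P|
              + |∫ ω, WienerNP.gStar l u ρ (X ω) * WienerNP.gVar P W X ω ∂P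
                  - ∫ ω, WienerNP.gStar l u ρ (Z ω) * WienerNP.gVar P W Z ω ∂P|
              + |∫ ω, WienerNP.gVar P W X ω ^ 2 ∂P - ∫ ω, WienerNP.gVar P W Z ω ^ 2 ∂P|))) ∧
        -- if `g_*` is bounded or `X` has a density
        (((∃ C : ℝ, ∀ x, |WienerNP.gStar l u ρ x| ≤ C) ∨ P.map X ≪ volume) →
          ∀ G : ℝ → ℝ, (∀ x, HasDerivAt G (WienerNP.gStar l u ρ x) x) →
            Integrable (fun ω => X ω * G (X ω)) P ∧ Integrable (fun ω => Z ω * G (Z ω)) P ∧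
            WienerNP.distH 𝓗 P X Z
              ≤ ENNReal.ofReal (k * √(
                |∫ ω, WienerNP.gStar l u ρ (X ω) ^ 2 ∂P
                    - ∫ ω, WienerNP.gStar l u ρ (Z ω) ^ 2 ∂P|
                + |∫ ω, X ω * G (X ω) ∂P - ∫ ω, Z ω * G (Z ω) ∂P|
                + |∫ ω, WienerNP.gVar P W X ω ^ 2 ∂P - ∫ ω, WienerNP.gVar P W Z ω ^ 2 ∂P|)))) := by
  have hZ2 : MemLp Z 2 P := hZD.choose_spec.1
  have hden : WienerNP.CenteredDensity l u ρ := WienerNP.centeredDensity_of_map hZm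
    (hZ2.integrable one_le_two) hZ0 hl hu hρpos hρzero hρcont hρ
  have hgZ := hden.gStar_comp_ae_eq_gVar hW hZm hZD hZ0 hρ
  have hgm := hden.measurable_gStar
  obtain ⟨K, hK⟩ := hden.exists_lipschitz_steinSol hB
  -- The factor `√2` pays for `a + 2b + c ≤ 2(a + b + c)`. The maximum with `1` keeps the constant
  -- positive, so that `k * ⊤ = ⊤` when the expectation is infinite.
  refine ⟨hgZ, NNReal.sqrt 2 * max 1 K, fun X hXm hXD hX0 => ?_⟩
  set gX : Ω → ℝ := fun ω => WienerNP.gStar l u ρ (X ω) with hgX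
  set vX := WienerNP.gVar P W X with hvX
  set gZ : Ω → ℝ := fun ω => WienerNP.gStar l u ρ (Z ω) with hgZdef
  set vZ := WienerNP.gVar P W Z with hvZ
  have hDm : AEStronglyMeasurable (fun ω => gX ω - vX ω) P :=
    (hgm.comp hXm).aestronglyMeasurable.sub WienerNP.integrable_gVar.1
  have h𝓗L : ∀ h ∈ 𝓗, LipschitzWith 1 h := by
    rcases h𝓗 with rfl | rfl
    · exact fun h hh => hh
    · exact fun h hh => WienerNP.fortetMourierClass_subset hh
  have hdist : WienerNP.distH 𝓗 P X Z ≤ (max 1 K : ℝ≥0) * ∫⁻ ω, ‖gX ω - vX ω‖ₑ ∂P := by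
    by_cases htop : ∫⁻ ω, ‖gX ω - vX ω‖ₑ ∂P = ⊤
    · rw [htop, ENNReal.mul_top (by simp)]
      exact le_top
    have hDi : Integrable (fun ω => gX ω - vX ω) P := ⟨hDm, lt_top_iff_ne_top.2 htop⟩
    refine iSup₂_le fun h hh => ?_
    have hL := h𝓗L h hh
    rw [WienerNP.integral_comp_of_density hZm hden.measurable hden.nonneg hρ
      hL.continuous.measurable]
    refine (ENNReal.ofReal_le_ofReal
      (hden.abs_integral_sub_le hW hL (hK h hL) hXm hXD hX0 hDi)).trans ?_
    rw [ENNReal.ofReal_mul K.coe_nonneg, ENNReal.ofReal_coe_nnreal,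
      ofReal_integral_eq_lintegral_ofReal hDi.abs (ae_of_all _ fun ω => abs_nonneg _)]
    simp_rw [← Real.enorm_eq_ofReal_abs]
    gcongr
    exact le_max_right _ _
  have hsqrt2 : (1 : ℝ) ≤ √2 := Real.one_le_sqrt.2 one_le_two
  have hkK : max 1 K ≤ NNReal.sqrt 2 * max 1 K :=
    le_mul_of_one_le_left zero_le (NNReal.one_le_sqrt.2 one_le_two)
  have hI := WienerNP.lintegral_enorm_le_rpow_lintegral_sq hDm
  refine ⟨hdist.trans (by gcongr), by gcongr, fun hgX2 hvX2 hgZ2 => ?_⟩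
  have hvZ2 : MemLp vZ 2 P := (memLp_congr_ae hgZ).1 hgZ2
  have e1 : ∫ ω, gZ ω * vZ ω ∂P = ∫ ω, gZ ω ^ 2 ∂P :=
    integral_congr_ae (hgZ.mono fun ω hω => by
      have : gZ ω = vZ ω := hω
      simp only [← this]; ring)
  have e2 : ∫ ω, vZ ω ^ 2 ∂P = ∫ ω, gZ ω ^ 2 ∂P :=
    integral_congr_ae (hgZ.mono fun ω hω => by
      have : gZ ω = vZ ω := hω
      simp only [← this])
  have hE := WienerNP.integral_sub_sq hgX2 hvX2
  have hD2 : MemLp (fun ω => gX ω - vX ω) 2 P := hgX2.sub hvX2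
  have hr := WienerNP.rpow_lintegral_sq_eq hD2
  set α := ∫ ω, gX ω ^ 2 ∂P
  set β := ∫ ω, gX ω * vX ω ∂P
  set γ := ∫ ω, vX ω ^ 2 ∂P
  set α₀ := ∫ ω, gZ ω ^ 2 ∂P
  set β₀ := ∫ ω, gZ ω * vZ ω ∂P
  set γ₀ := ∫ ω, vZ ω ^ 2 ∂P
  -- Since `g_*(Z) = g_Z`, the three target moments coincide, so `α - 2β + γ = (α - α₀) - 2(β - β₀)
  -- + (γ - γ₀)`.
  have hE' : ∫ ω, (gX ω - vX ω) ^ 2 ∂P ≤ |α - α₀| + 2 * |β - β₀| + |γ - γ₀| := by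
    rw [hE]
    have h1 := le_abs_self (α - α₀)
    have h2 := neg_abs_le (β - β₀)
    have h3 := le_abs_self (γ - γ₀)
    linarith
  have hmain : WienerNP.distH 𝓗 P X Z ≤ ENNReal.ofReal
      ((NNReal.sqrt 2 * max 1 K : ℝ≥0) * √(|α - α₀| + |β - β₀| + |γ - γ₀|)) := by
    refine hdist.trans ((mul_le_mul_right hI _).trans ?_)
    rw [hr, ← ENNReal.ofReal_coe_nnreal, ← ENNReal.ofReal_mul NNReal.zero_le_coe]
    refine ENNReal.ofReal_le_ofReal ?_
    rw [NNReal.coe_mul, Real.coe_sqrt, NNReal.coe_ofNat, mul_comm √2, mul_assoc,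
      ← Real.sqrt_mul zero_le_two]
    refine mul_le_mul_of_nonneg_left (Real.sqrt_le_sqrt (hE'.trans ?_)) NNReal.zero_le_coe
    have h1 := abs_nonneg (α - α₀)
    have h3 := abs_nonneg (γ - γ₀)
    linarith
  refine ⟨?_, hmain, fun _ G hG => ?_⟩
  · rw [hr, ← ENNReal.ofReal_coe_nnreal, ← ENNReal.ofReal_mul NNReal.zero_le_coe]
    exact ENNReal.ofReal_le_ofReal
      (mul_le_mul_of_nonneg_left (Real.sqrt_le_sqrt hE') NNReal.zero_le_coe)
  · obtain ⟨hX1, hX2⟩ := hW.integral_mul_antideriv hXm hXD hX0 hgm hden.gStar_nonneg hG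
      (hgX2.integrable_mul hvX2)
    obtain ⟨hZ1, hZ2⟩ := hW.integral_mul_antideriv hZm hZD hZ0 hgm hden.gStar_nonneg hG
      (hgZ2.integrable_mul hvZ2)
    refine ⟨hX1, hZ1, ?_⟩
    rw [hX2, hZ2]
    exact hmain
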